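/- Let $M$ be a smooth manifold of dimension $n\ge 3$ with a conformal structure $[g]$, i.e. a class of pseudo-Riemannian metrics (of any signature) related by $\hat g=e^{2\Upsilon}g$ with $\Upsilon$ smooth. A $k$-form $\sigma$ of conformal weight $w$ (a section of $\Lambda^kT^*M\otimes E[w]$) is represented by an ordinary smooth $k$-form $\sigma_g$ for each $g\in[g]$, with $\sigma_{\hat g}=e^{w\Upsilon}\sigma_g$ if $\hat g=e^{2\Upsilon}g$. For $1\le k\le n-1$, a $k$-form $\sigma$ of weight $k+1$ is a conformal Killing form if, for one (equivalently every) metric $g\in[g]$ with Levi-Civita connection $\nabla$, the component of $\nabla\sigma$ in the trace-free part of $T^*M\otimes\Lambda^kT^*M$ with vanishing total skew part is zero, that is $$\nabla_c\sigma_{a^1\cdots a^k}=\nabla_{[c}\sigma_{a^1\cdots a^k]}+\tfrac{k}{n-k+1}\,g_{c[a^1}\nabla^p\sigma_{|p|a^2\cdots a^k]} .$$ Let $R$ be the curvature, $[\nabla_a,\nabla_b]v^c=R_{ab}{}^c{}_dv^d$, and let $C$ be its totally trace-free part, the Weyl tensor: $R_{abcd}=C_{abcd}+2g_{c[a}P_{b]d}+2g_{d[b}P_{a]c}$,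 where $P$ is the Schouten tensor. For a $k$-form $f$ with $2\le k\le n-1$ put $$(C\blacklozenge f)_{ca^2\cdots a^k}=\tfrac{k-2}{k}\bigl(C_{ca^2}{}^{pq}f_{pqa^3\cdots a^k}+C_{a^3a^2}{}^{pq}f_{pqca^4\cdots a^k}\bigr),$$ skew-symmetrised over $a^2\cdots a^k$ (this is $0$ for $k=2$), and $$(C\lozenge f)_{c^1c^2a^1\cdots a^k}=C_{c^1c^2a^1}{}^{p}f_{pa^2\cdots a^k}+C_{a^1a^2c^1}{}^{p}f_{pc^2a^3\cdots a^k}+\tfrac{k}{n-k}\,g_{c^1a^1}(C\blacklozenge f)_{c^2a^2\cdots a^k},$$ skew-symmetrised over $c^1c^2$ and over $a^1\cdots a^k$. Let $(C\sharp f)_{c^1c^2a^1\cdots a^k}=-\sum_{i}C_{c^1c^2}{}^p{}_{a^i}f_{a^1\cdots p\cdots a^k}$ ($p$ in the $i$-th place), and let $E(2,k)_0$ be the space of trace-free tensors $T_{c^1c^2a^1\cdots a^k}$, skew in $c^1c^2$ and in $a^1\cdots a^k$, with $T_{[c^1c^2a^1\cdots a^k]}=T_{c^1[c^2a^1\cdots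 a^k]}=T_{[c^1c^2a^1\cdots a^{k-1}]a^k}=0$. Let $2\le k\le n-1$ and let $\sigma$ be a conformal Killing $k$-form. Then, for every metric of the conformal class, $C\lozenge\sigma=0$; and the projection of $C\sharp\sigma$ to $E(2,k)_0$ is zero, i.e. $C\sharp\sigma$ is everywhere orthogonal to $E(2,k)_0$ with respect to the inner product induced by the metric. -/

import Mathlib

open scoped Manifold ContDiff

noncomputable section

namespace ConformalKilling

/-! ### Tensor algebra in components

A covariant tensor of valence `r` on an `n`-dimensional vector space with a basis is given by its
components `T (i₀, …, iᵣ₋₁)`. The metric is given by its Gram matrix `G`, the inverse metric by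
`G⁻¹`. -/

/-- Components of a covariant tensor of valence `r` in dimension `n`. -/
abbrev Tensor (n r : ℕ) : Type := (Fin r → Fin n) → ℝ

/-- Skew-symmetrisation (with the factor `1 / |S|!`) over the index positions in `S`. -/
def skewOver {n r : ℕ} (S : Finset (Fin r)) (T : Tensor n r) : Tensor n r := fun t =>
  ((S.card.factorial : ℝ))⁻¹ *
    ∑ s : Equiv.Perm (Fin r) with ∀ i, i ∉ S → s i = i,
      ((Equiv.Perm.sign s : ℤ) : ℝ) * T (t ∘ s)

/-- The inner product induced by the metric on covariant tensors of valence `r`: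
`g^{s₀t₀} ⋯ S_{s₀…} T_{t₀…}`. -/
def tensorInner {n r : ℕ} (G : Matrix (Fin n) (Fin n) ℝ) (S T : Tensor n r) : ℝ :=
  ∑ s : Fin r → Fin n, ∑ t : Fin r → Fin n, (∏ i, G⁻¹ (s i) (t i)) * S s * T t

/-- All metric traces of `T` vanish. -/
def IsTraceFree {n r : ℕ} (G : Matrix (Fin n) (Fin n) ℝ) (T : Tensor n r) : Prop :=
  ∀ (i j : Fin r), i ≠ j → ∀ t : Fin r → Fin n,
    ∑ p, ∑ q, G⁻¹ p q * T (Function.update (Function.update t i p) j q) = 0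

/-- The space `E(2,k)₀` at a point: trace-free tensors `T_{c¹c²a¹…aᵏ}`, skew in `c¹c²` and skew in
`a¹…aᵏ`, with `T_{[c¹c²a¹…aᵏ]} = T_{c¹[c²a¹…aᵏ]} = T_{[c¹c²a¹…aᵏ⁻¹]aᵏ} = 0`.
Positions `0, 1` hold `c¹, c²`, positions `2, …, k + 1` hold `a¹, …, aᵏ`. -/
structure IsE2k0 {n k : ℕ} (G : Matrix (Fin n) (Fin n) ℝ) (T : Tensor n (k + 2)) : Prop where
  skew_c : skewOver {0, 1} T = T
  skew_a : skewOver {i | (2 : ℕ) ≤ (i : ℕ)} T = T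
  skew_all : skewOver Finset.univ T = 0
  skew_tail : skewOver {i | i ≠ 0} T = 0
  skew_init : skewOver {i | i ≠ Fin.last (k + 1)} T = 0
  traceFree : IsTraceFree G T

/-- The projection of `T_{c a¹…aᵏ}` (skew in `a¹…aᵏ`) to the Cartan part, i.e. to the component
`{c a¹…aᵏ}₀` of the `O(g)`-decomposition `Λ¹ ⊗ Λᵏ = Λᵏ⁺¹ ⊕ {c a¹…aᵏ}₀ ⊕ Λᵏ⁻¹`:
`T_{c a¹…aᵏ} - T_{[c a¹…aᵏ]} - k / (n - k + 1) g_{c a¹} g^{pq} T_{p q a²…aᵏ}`,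
the last term being skewed over `a¹…aᵏ`. Position `0` holds `c`. For `k = 0` this part is zero. -/
def cartanProj {n : ℕ} (G : Matrix (Fin n) (Fin n) ℝ) :
    {k : ℕ} → Tensor n (k + 1) → Tensor n (k + 1)
  | 0, _ => 0
  | m + 1, T => T - skewOver Finset.univ T
      - (((m + 1 : ℕ) : ℝ) / ((n : ℝ) - ((m + 1 : ℕ) : ℝ) + 1)) •
          skewOver {i | i ≠ 0} (fun t => G (t 0) (t 1) *
            ∑ p, ∑ q, G⁻¹ p q * T (Fin.cons p (Fin.cons q (Fin.tail (Fin.tail t)))))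

/-- `C_{abc}{}^p`, for `C` with lowered indices. -/
def raiseLast {n : ℕ} (G : Matrix (Fin n) (Fin n) ℝ) (C : Fin n → Fin n → Fin n → Fin n → ℝ)
    (a b c p : Fin n) : ℝ :=
  ∑ q, G⁻¹ p q * C a b c q

/-- `C_{ab}{}^{pq}`, for `C` with lowered indices. -/
def raiseLastTwo {n : ℕ} (G : Matrix (Fin n) (Fin n) ℝ) (C : Fin n → Fin n → Fin n → Fin n → ℝ)
    (a b p q : Fin n) : ℝ :=
  ∑ r, G⁻¹ p r * raiseLast G C a b r q

/-- The action `A ♯ f` of an endomorphism `A^p{}_a` (entry `A p a`) on a covariant tensor: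
`- ∑ᵢ A^p{}_{aⁱ} f_{a¹…p…aᵏ}`. -/
def hash {n k : ℕ} (A : Matrix (Fin n) (Fin n) ℝ) (f : Tensor n k) : Tensor n k := fun a =>
  - ∑ i, ∑ p, A p (a i) * f (Function.update a i p)

/-- `(C ♯ f)_{c¹c²a¹…aᵏ} = (C_{c¹c²} ♯ f)_{a¹…aᵏ}`, where `C_{c¹c²}` is the endomorphism
`C_{c¹c²}{}^p{}_a`. -/
def curvHash {n k : ℕ} (G : Matrix (Fin n) (Fin n) ℝ) (C : Fin n → Fin n → Fin n → Fin n → ℝ)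
    (f : Tensor n k) : Tensor n (k + 2) := fun t =>
  hash (Matrix.of fun p a => ∑ q, G⁻¹ p q * C (t 0) (t 1) q a) f (Fin.tail (Fin.tail t))

/-- `(C ⧫ f)_{c a²…aᵏ} = (k-2)/k (C_{ca²}{}^{pq} f_{pqa³…aᵏ} + C_{a³a²}{}^{pq} f_{pqca⁴…aᵏ})`,
skewed over `a²…aᵏ`, as a tensor of valence `k` (position `0` holds `c`, position `i ≥ 1` holds
`aⁱ⁺¹`). It is zero for `k = 2` because of the factor `k - 2`, and only used for `k ≥ 2`. -/
def blackLozenge {n : ℕ} (G : Matrix (Fin n) (Fin n) ℝ)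
    (C : Fin n → Fin n → Fin n → Fin n → ℝ) : {k : ℕ} → Tensor n k → Tensor n k
  | 0, _ => 0
  | 1, _ => 0
  | 2, _ => 0
  | m + 3, f => ((((m + 3 : ℕ) : ℝ) - 2) / ((m + 3 : ℕ) : ℝ)) •
      skewOver {i | i ≠ 0} (fun t =>
        ∑ p, ∑ q,
          (raiseLastTwo G C (t 0) (t 1) p q
              * f (Fin.cons p (Fin.cons q (Fin.tail (Fin.tail t))))
            + raiseLastTwo G C (t 2) (t 1) p q
              * f (Fin.cons p (Fin.cons q (Fin.cons (t 0) (Fin.tail (Fin.tail (Fin.tail t))))))))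

/-- `(C ◇ f)_{c¹c²a¹…aᵏ} = C_{c¹c²a¹}{}^p f_{pa²…aᵏ} + C_{a¹a²c¹}{}^p f_{pc²a³…aᵏ}
+ k/(n-k) g_{c¹a¹} (C ⧫ f)_{c²a²…aᵏ}`, skewed over `c¹c²` and over `a¹…aᵏ`.
Positions `0, 1` hold `c¹, c²`, positions `2, …, k + 1` hold `a¹, …, aᵏ`.
The operation is defined for `k ≥ 2` only; the values for `k < 2` are placeholders. -/
def lozenge {n : ℕ} (G : Matrix (Fin n) (Fin n) ℝ)
    (C : Fin n → Fin n → Fin n → Fin n → ℝ) : {k : ℕ} → Tensor n k → Tensor n (k + 2)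
  | 0, _ => 0
  | 1, _ => 0
  | m + 2, f => skewOver {0, 1} (skewOver {i | (2 : ℕ) ≤ (i : ℕ)} (fun t =>
      let c₁ := t 0
      let c₂ := t 1
      let a : Fin (m + 2) → Fin n := Fin.tail (Fin.tail t)
      (∑ p, raiseLast G C c₁ c₂ (a 0) p * f (Fin.cons p (Fin.tail a)))
        + (∑ p, raiseLast G C (a 0) (a 1) c₁ p
            * f (Fin.cons p (Fin.cons c₂ (Fin.tail (Fin.tail a)))))
        + (((m + 2 : ℕ) : ℝ) / ((n : ℝ) - ((m + 2 : ℕ) : ℝ))) *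
            (G c₁ (a 0) * blackLozenge G C f (Fin.cons c₂ (Fin.tail a)))))

/-! ### Differential geometry in a coordinate chart

`G y` is the matrix of metric coefficients at the coordinate point `y`. -/

/-- Partial derivative in the `i`-th coordinate direction. -/
def partialDeriv {n : ℕ} (i : Fin n) (f : EuclideanSpace ℝ (Fin n) → ℝ)
    (y : EuclideanSpace ℝ (Fin n)) : ℝ :=
  fderiv ℝ f y (EuclideanSpace.single i 1)

/-- Christoffel symbols `Γ^c{}_{ab}` of the Levi-Civita connection. -/
def christoffel {n : ℕ} (G : EuclideanSpace ℝ (Fin n) → Matrix (Fin n) (Fin n) ℝ)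
    (c a b : Fin n) (y : EuclideanSpace ℝ (Fin n)) : ℝ :=
  (1 / 2) * ∑ d, (G y)⁻¹ c d *
    (partialDeriv a (fun z => G z b d) y + partialDeriv b (fun z => G z a d) y
      - partialDeriv d (fun z => G z a b) y)

/-- The Levi-Civita covariant derivative `∇_c τ_{a¹…aᵏ}` (position `0` holds `c`). -/
def covDeriv {n k : ℕ} (G : EuclideanSpace ℝ (Fin n) → Matrix (Fin n) (Fin n) ℝ)
    (τ : EuclideanSpace ℝ (Fin n) → Tensor n k) (y : EuclideanSpace ℝ (Fin n)) :
    Tensor n (k + 1) := fun t =>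
  partialDeriv (t 0) (fun z => τ z (Fin.tail t)) y
    - ∑ i, ∑ p, christoffel G p (t 0) (Fin.tail t i) y
        * τ y (Function.update (Fin.tail t) i p)

/-- The Riemann curvature `R_{ab}{}^c{}_d`, with `[∇_a, ∇_b] v^c = R_{ab}{}^c{}_d v^d`. -/
def riemannUp {n : ℕ} (G : EuclideanSpace ℝ (Fin n) → Matrix (Fin n) (Fin n) ℝ)
    (a b c d : Fin n) (y : EuclideanSpace ℝ (Fin n)) : ℝ :=
  partialDeriv a (christoffel G c b d) y - partialDeriv b (christoffel G c a d) y
    + ∑ e, (christoffel G c a e y * christoffel G e b d y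
        - christoffel G c b e y * christoffel G e a d y)

/-- `R_{abcd} = g_{ce} R_{ab}{}^e{}_d`. -/
def riemann {n : ℕ} (G : EuclideanSpace ℝ (Fin n) → Matrix (Fin n) (Fin n) ℝ)
    (a b c d : Fin n) (y : EuclideanSpace ℝ (Fin n)) : ℝ :=
  ∑ e, G y c e * riemannUp G a b e d y

/-- The Ricci tensor `Ric_{ab} = R_{ca}{}^c{}_b`. -/
def ricci {n : ℕ} (G : EuclideanSpace ℝ (Fin n) → Matrix (Fin n) (Fin n) ℝ)
    (a b : Fin n) (y : EuclideanSpace ℝ (Fin n)) : ℝ :=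
  ∑ c, riemannUp G c a c b y

/-- `J = Sc / (2 (n - 1))`, the trace of the Schouten tensor. -/
def schoutenTrace {n : ℕ} (G : EuclideanSpace ℝ (Fin n) → Matrix (Fin n) (Fin n) ℝ)
    (y : EuclideanSpace ℝ (Fin n)) : ℝ :=
  (∑ a, ∑ b, (G y)⁻¹ a b * ricci G a b y) / (2 * ((n : ℝ) - 1))

/-- The Schouten tensor `P_{ab}`, with `Ric_{ab} = (n - 2) P_{ab} + J g_{ab}`. -/
def schouten {n : ℕ} (G : EuclideanSpace ℝ (Fin n) → Matrix (Fin n) (Fin n) ℝ)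
    (a b : Fin n) (y : EuclideanSpace ℝ (Fin n)) : ℝ :=
  (ricci G a b y - schoutenTrace G y * G y a b) / ((n : ℝ) - 2)

/-- The Weyl tensor `C_{abcd}`, with `R_{abcd} = C_{abcd} + 2 g_{c[a} P_{b]d} + 2 g_{d[b} P_{a]c}`. -/
def weyl {n : ℕ} (G : EuclideanSpace ℝ (Fin n) → Matrix (Fin n) (Fin n) ℝ)
    (y : EuclideanSpace ℝ (Fin n)) (a b c d : Fin n) : ℝ :=
  riemann G a b c d y
    - (G y c a * schouten G b d y - G y c b * schouten G a d y)
    - (G y d b * schouten G a c y - G y d a * schouten G b c y)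

/-! ### Manifolds -/

section Manifold

variable {n : ℕ} {M : Type*} [TopologicalSpace M] [ChartedSpace (EuclideanSpace ℝ (Fin n)) M]

/-- The coordinate vector field `∂ᵢ` of the chart at `x₀`, at the point with coordinates `y`. -/
def coordVec (x₀ : M) (y : EuclideanSpace ℝ (Fin n)) (i : Fin n) :
    TangentSpace (𝓡 n) ((extChartAt (𝓡 n) x₀).symm y) :=
  mfderiv 𝓘(ℝ, EuclideanSpace ℝ (Fin n)) (𝓡 n) (extChartAt (𝓡 n) x₀).symm y
    (EuclideanSpace.single i (1 : ℝ))

variable (n M) in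
/-- A smooth pseudo-Riemannian metric (of arbitrary signature). -/
structure PseudoRiemannianMetric [IsManifold (𝓡 n) ∞ M] where
  val : ∀ x : M, TangentSpace (𝓡 n) x →L[ℝ] TangentSpace (𝓡 n) x →L[ℝ] ℝ
  symm : ∀ (x : M) (v w : TangentSpace (𝓡 n) x), val x v w = val x w v
  nondegenerate : ∀ (x : M) (v : TangentSpace (𝓡 n) x), (∀ w, val x v w = 0) → v = 0
  contMDiff : ContMDiff (𝓡 n)
    ((𝓡 n).prod 𝓘(ℝ, EuclideanSpace ℝ (Fin n) →L[ℝ] EuclideanSpace ℝ (Fin n) →L[ℝ] ℝ)) ∞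
    (fun x => (Bundle.TotalSpace.mk' (EuclideanSpace ℝ (Fin n) →L[ℝ]
      EuclideanSpace ℝ (Fin n) →L[ℝ] ℝ) x (val x) :
      Bundle.TotalSpace (EuclideanSpace ℝ (Fin n) →L[ℝ] EuclideanSpace ℝ (Fin n) →L[ℝ] ℝ)
        (fun x : M => TangentSpace (𝓡 n) x →L[ℝ] TangentSpace (𝓡 n) x →L[ℝ] ℝ)))

/-- The metric coefficients `g(∂ᵢ, ∂ⱼ)` in the chart at `x₀`. -/
def PseudoRiemannianMetric.coeff [IsManifold (𝓡 n) ∞ M] (g : PseudoRiemannianMetric n M) (x₀ : M)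
    (y : EuclideanSpace ℝ (Fin n)) : Matrix (Fin n) (Fin n) ℝ :=
  Matrix.of fun i j => g.val ((extChartAt (𝓡 n) x₀).symm y) (coordVec x₀ y i) (coordVec x₀ y j)

/-- The components `τ(∂_{a¹}, …, ∂_{aᵏ})` in the chart at `x₀` of a (not necessarily smooth)
`k`-form. -/
def formCoeff {k : ℕ} (τ : ∀ x : M, TangentSpace (𝓡 n) x [⋀^Fin k]→L[ℝ] ℝ) (x₀ : M)
    (y : EuclideanSpace ℝ (Fin n)) : Tensor n k := fun a =>
  τ ((extChartAt (𝓡 n) x₀).symm y) (fun i => coordVec x₀ y (a i))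

variable (n M) in
/-- A smooth differential `k`-form: its components in every chart are smooth. -/
structure SmoothForm (k : ℕ) where
  val : ∀ x : M, TangentSpace (𝓡 n) x [⋀^Fin k]→L[ℝ] ℝ
  smooth : ∀ (x₀ : M) (a : Fin k → Fin n),
    ContDiffOn ℝ ∞ (fun y => formCoeff val x₀ y a) (extChartAt (𝓡 n) x₀).target

/-- `ĝ = exp(2Υ) g`. -/
def IsRescaling [IsManifold (𝓡 n) ∞ M] (g g' : PseudoRiemannianMetric n M) (Υ : M → ℝ) : Prop :=
  ContMDiff (𝓡 n) 𝓘(ℝ, ℝ) ∞ Υ ∧ ∀ x, g'.val x = Real.exp (2 * Υ x) • g.val x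

variable (n M) in
/-- A conformal structure: a conformal equivalence class of pseudo-Riemannian metrics. -/
structure ConformalStructure [IsManifold (𝓡 n) ∞ M] where
  metrics : Set (PseudoRiemannianMetric n M)
  nonempty : metrics.Nonempty
  mem_iff : ∀ g ∈ metrics, ∀ g', g' ∈ metrics ↔ ∃ Υ, IsRescaling g g' Υ

/-- A `k`-form of conformal weight `w`, i.e. a section of `Λᵏ T*M ⊗ E[w]`: through the
trivialisation of `E[w]` by a metric of the conformal class it is, for each such metric `g`, an
ordinary `k`-form `σ_g`, and `σ_ĝ = exp(wΥ) σ_g` if `ĝ = exp(2Υ) g`. -/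
structure WeightedForm [IsManifold (𝓡 n) ∞ M] (c : ConformalStructure n M) (k : ℕ) (w : ℝ) where
  inScale : c.metrics → SmoothForm n M k
  rescale : ∀ (g g' : c.metrics) (Υ : M → ℝ), IsRescaling g.1 g'.1 Υ →
    ∀ x, (inScale g').val x = Real.exp (w * Υ x) • (inScale g).val x

/-- The `k`-form `τ` satisfies `∇_{{c} τ_{a¹…aᵏ}}₀ = 0` for the Levi-Civita connection of `g`,
that is, the Cartan part of `∇τ` is zero (in every chart, at every point of the chart). -/
def SolvesCKE [IsManifold (𝓡 n) ∞ M] {k : ℕ} (g : PseudoRiemannianMetric n M)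
    (τ : SmoothForm n M k) : Prop :=
  ∀ (x₀ : M), ∀ y ∈ (extChartAt (𝓡 n) x₀).target,
    cartanProj (g.coeff x₀ y) (covDeriv (g.coeff x₀) (formCoeff τ.val x₀) y) = 0

/-- A conformal Killing `k`-form: a `k`-form of weight `k + 1` that solves the conformal Killing
equation in a scale of the conformal class. (The equation is conformally invariant, so that it
does not matter which one.) -/
def WeightedForm.IsConformalKilling [IsManifold (𝓡 n) ∞ M] {c : ConformalStructure n M} {k : ℕ}
    (σ : WeightedForm c k ((k : ℝ) + 1)) : Prop :=
  ∃ g : c.metrics, SolvesCKE g.1 (σ.inScale g)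

/-- The components of `C ◇ τ` in the chart at `x₀`, with `C` the Weyl tensor of `g`. -/
def lozengeCoeff [IsManifold (𝓡 n) ∞ M] {k : ℕ} (g : PseudoRiemannianMetric n M)
    (τ : SmoothForm n M k) (x₀ : M) (y : EuclideanSpace ℝ (Fin n)) : Tensor n (k + 2) :=
  lozenge (g.coeff x₀ y) (weyl (g.coeff x₀) y) (formCoeff τ.val x₀ y)

/-- The components of `C ♯ τ` in the chart at `x₀`, with `C` the Weyl tensor of `g`. -/
def weylHashCoeff [IsManifold (𝓡 n) ∞ M] {k : ℕ} (g : PseudoRiemannianMetric n M)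
    (τ : SmoothForm n M k) (x₀ : M) (y : EuclideanSpace ℝ (Fin n)) : Tensor n (k + 2) :=
  curvHash (g.coeff x₀ y) (weyl (g.coeff x₀) y) (formCoeff τ.val x₀ y)

end Manifold

end ConformalKilling

end

noncomputable section

namespace ConformalKilling

/-! ### Alternating tensors of all degrees, exterior and interior multiplication -/

/-- Insertion of the basis vector `a` into the first slot. -/
def slot {n k : ℕ} (a : Fin n) (f : Tensor n (k + 1)) : Tensor n k := fun t => f (Fin.cons a t)

/-- A tensor is alternating if it changes sign when two adjacent arguments are swapped. -/
def IsAlt {n : ℕ} : {k : ℕ} → Tensor n k → Prop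
  | 0, _ => True
  | 1, _ => True
  | _ + 2, f => (∀ a, IsAlt (slot a f)) ∧
      ∀ a b t, f (Fin.cons a (Fin.cons b t)) = - f (Fin.cons b (Fin.cons a t))

/-- Exterior multiplication by the basis covector `b`, expanded along the first slot. -/
def wedge {n : ℕ} (b : Fin n) : {k : ℕ} → Tensor n k → Tensor n (k + 1)
  | 0, f => fun t => if t 0 = b then f (Fin.tail t) else 0
  | _ + 1, f => fun t => (if t 0 = b then f (Fin.tail t) else 0)
      - wedge b (slot (t 0) f) (Fin.tail t)

section Alternating

variable {n k : ℕ}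

lemma slot_add (a : Fin n) (f g : Tensor n (k + 1)) : slot a (f + g) = slot a f + slot a g := rfl

lemma slot_smul (a : Fin n) (r : ℝ) (f : Tensor n (k + 1)) : slot a (r • f) = r • slot a f := rfl

lemma slot_neg (a : Fin n) (f : Tensor n (k + 1)) : slot a (-f) = -slot a f := rfl

lemma slot_sub (a : Fin n) (f g : Tensor n (k + 1)) : slot a (f - g) = slot a f - slot a g := rfl

lemma slot_zero (a : Fin n) : slot a (0 : Tensor n (k + 1)) = 0 := rfl

lemma tensor_ext_cons {f g : Tensor n (k + 1)} (h : ∀ a, slot a f = slot a g) : f = g := by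
  funext t
  have := congrFun (h (t 0)) (Fin.tail t)
  simpa [slot] using this

lemma IsAlt.slot : ∀ {k : ℕ} {f : Tensor n (k + 1)}, IsAlt f → ∀ a, IsAlt (slot a f)
  | 0, _, _, _ => trivial
  | _ + 1, _, h, a => h.1 a

lemma IsAlt.add : ∀ {k : ℕ} {f g : Tensor n k}, IsAlt f → IsAlt g → IsAlt (f + g)
  | 0, _, _, _, _ => trivial
  | 1, _, _, _, _ => trivial
  | k + 2, f, g, hf, hg => ⟨fun a => (hf.1 a).add (hg.1 a), fun a b t => by
      simp only [Pi.add_apply, hf.2 a b t, hg.2 a b t]; ring⟩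

lemma IsAlt.smul (r : ℝ) : ∀ {k : ℕ} {f : Tensor n k}, IsAlt f → IsAlt (r • f)
  | 0, _, _ => trivial
  | 1, _, _ => trivial
  | k + 2, f, hf => ⟨fun a => (hf.1 a).smul r, fun a b t => by
      simp only [Pi.smul_apply, hf.2 a b t, smul_eq_mul]; ring⟩

lemma isAlt_zero : ∀ {k : ℕ}, IsAlt (0 : Tensor n k)
  | 0 => trivial
  | 1 => trivial
  | k + 2 => ⟨fun _ => isAlt_zero, fun _ _ _ => by simp⟩

lemma wedge_add (b : Fin n) : ∀ {k : ℕ} (f g : Tensor n k), wedge b (f + g) = wedge b f + wedge b g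
  | 0, f, g => by funext t; simp only [wedge, Pi.add_apply]; split_ifs <;> simp
  | k + 1, f, g => by
      funext t
      simp only [wedge, Pi.add_apply, slot_add, wedge_add b (slot (t 0) f)]
      split_ifs <;> ring

lemma wedge_smul (b : Fin n) (r : ℝ) : ∀ {k : ℕ} (f : Tensor n k), wedge b (r • f) = r • wedge b f
  | 0, f => by funext t; simp [wedge]
  | k + 1, f => by
      funext t
      simp only [wedge, Pi.smul_apply, slot_smul, wedge_smul b r (slot (t 0) f), smul_eq_mul]
      split_ifs <;> ring

lemma wedge_neg (b : Fin n) (f : Tensor n k) : wedge b (-f) = - wedge b f := by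
  simpa using wedge_smul b (-1) f

lemma wedge_sub (b : Fin n) (f g : Tensor n k) : wedge b (f - g) = wedge b f - wedge b g := by
  rw [sub_eq_add_neg, wedge_add, wedge_neg, sub_eq_add_neg]

lemma slot_wedge (a b : Fin n) (f : Tensor n (k + 1)) :
    slot a (wedge b f) = (if a = b then (1 : ℝ) else 0) • f - wedge b (slot a f) := by
  funext t
  by_cases h : a = b <;> simp [slot, wedge, Fin.tail_cons, h]

lemma slot_wedge_zero (a b : Fin n) (f : Tensor n 0) :
    slot a (wedge b f) = (if a = b then (1 : ℝ) else 0) • f := by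
  funext t
  simp [slot, wedge, Fin.tail_cons]

lemma IsAlt.slot_slot {f : Tensor n (k + 2)} (hf : IsAlt f) (a b : Fin n) :
    ConformalKilling.slot a (ConformalKilling.slot b f)
      = - ConformalKilling.slot b (ConformalKilling.slot a f) :=
  funext fun t => hf.2 b a t

lemma isAlt_succ_succ {f : Tensor n (k + 2)} (h : ∀ a, IsAlt (slot a f))
    (h' : ∀ a b, slot a (slot b f) = - slot b (slot a f)) : IsAlt f :=
  ⟨h, fun a b t => congrFun (h' b a) t⟩

lemma IsAlt.wedge (b : Fin n) : ∀ {k : ℕ} {f : Tensor n k}, IsAlt f → IsAlt (wedge b f)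
  | 0, _, _ => trivial
  | 1, f, hf => by
      refine isAlt_succ_succ (fun a => trivial) fun a c => ?_
      simp only [slot_wedge, slot_wedge_zero, slot_sub, slot_smul]
      module
  | k + 2, f, hf => by
      refine isAlt_succ_succ (fun a => ?_) fun a c => ?_
      · rw [slot_wedge, sub_eq_add_neg, ← neg_one_smul ℝ (ConformalKilling.wedge _ _)]
        exact (hf.smul _).add (((hf.slot a).wedge b).smul _)
      · simp only [slot_wedge, slot_sub, slot_smul]
        rw [hf.slot_slot a c, wedge_neg]
        module

lemma wedge_wedge (b c : Fin n) : ∀ {k : ℕ} (f : Tensor n k),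
    wedge b (wedge c f) = - wedge c (wedge b f)
  | 0, f => by
      refine tensor_ext_cons fun a => ?_
      simp only [slot_neg, slot_wedge, slot_wedge_zero, wedge_smul]
      module
  | k + 1, f => by
      refine tensor_ext_cons fun a => ?_
      simp only [slot_neg, slot_wedge, wedge_smul, wedge_sub]
      rw [wedge_wedge b c (slot a f)]
      module

end Alternating

/-- Alternating tensors, with one component in every degree. -/
def Forms (n : ℕ) : Submodule ℝ ((k : ℕ) → Tensor n k) where
  carrier := {F | ∀ k, IsAlt (F k)}
  add_mem' hf hg k := (hf k).add (hg k)
  zero_mem' _ := isAlt_zero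
  smul_mem' r _ hf k := (hf k).smul r

/-- Interior multiplication by the basis vector `a`. -/
def iota {n : ℕ} (a : Fin n) : Forms n →ₗ[ℝ] Forms n where
  toFun F := ⟨fun k => slot a (F.1 (k + 1)), fun k => (F.2 (k + 1)).slot a⟩
  map_add' _ _ := rfl
  map_smul' _ _ := rfl

/-- Exterior multiplication by the basis covector `b`, in all degrees. -/
def wedgeFun {n : ℕ} (b : Fin n) (F : (k : ℕ) → Tensor n k) : (k : ℕ) → Tensor n k
  | 0 => 0
  | k + 1 => wedge b (F k)

/-- Exterior multiplication by the basis covector `b`. -/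
def eps {n : ℕ} (b : Fin n) : Forms n →ₗ[ℝ] Forms n where
  toFun F := ⟨wedgeFun b F.1, fun k => by
    cases k with
    | zero => trivial
    | succ k => exact (F.2 k).wedge b⟩
  map_add' F G := by
    ext k : 2
    cases k with
    | zero => simp [wedgeFun]
    | succ k => exact wedge_add b _ _
  map_smul' r F := by
    ext k : 2
    cases k with
    | zero => simp [wedgeFun]
    | succ k => exact wedge_smul b r _

section CAR

variable {n : ℕ}

/-- The degree-`k` component. -/
def comp {n : ℕ} (k : ℕ) : Forms n →ₗ[ℝ] Tensor n k where
  toFun F := F.1 k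
  map_add' _ _ := rfl
  map_smul' _ _ := rfl

lemma forms_ext {F G : Forms n} (h : ∀ k, comp k F = comp k G) : F = G :=
  Subtype.ext (funext h)

lemma comp_iota (k : ℕ) (a : Fin n) (F : Forms n) : comp k (iota a F) = slot a (comp (k + 1) F) :=
  rfl

lemma comp_eps_succ (k : ℕ) (a : Fin n) (F : Forms n) :
    comp (k + 1) (eps a F) = wedge a (comp k F) := rfl

lemma comp_eps_zero (a : Fin n) (F : Forms n) : comp 0 (eps a F) = 0 := rfl

lemma isAlt_comp (k : ℕ) (F : Forms n) : IsAlt (comp k F) := F.2 k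

lemma iota_iota (a b : Fin n) (F : Forms n) : iota a (iota b F) = - iota b (iota a F) :=
  forms_ext fun k => (isAlt_comp (k + 2) F).slot_slot a b

lemma eps_eps (a b : Fin n) (F : Forms n) : eps a (eps b F) = - eps b (eps a F) := by
  refine forms_ext fun k => ?_
  rw [map_neg]
  rcases k with _ | _ | k
  · simp [comp_eps_zero]
  · simp only [comp_eps_succ, comp_eps_zero]
    have : ∀ c : Fin n, wedge c (0 : Tensor n 0) = 0 := fun c => by funext t; simp [wedge]
    simp [this]
  · simp only [comp_eps_succ, wedge_wedge a b]

lemma iota_eps (a b : Fin n) (F : Forms n) :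
    iota a (eps b F) = (if a = b then (1 : ℝ) else 0) • F - eps b (iota a F) := by
  refine forms_ext fun k => ?_
  rw [map_sub, map_smul]
  rcases k with _ | k
  · simp only [comp_iota, comp_eps_succ, comp_eps_zero, slot_wedge_zero, sub_zero]
  · simp only [comp_iota, comp_eps_succ, slot_wedge]

/-- `F` is homogeneous of degree `k`. -/
def IsHomog (k : ℕ) (F : Forms n) : Prop := ∀ j, j ≠ k → comp j F = 0

lemma sum_eps_iota_comp : ∀ (k : ℕ) (F : Forms n),
    comp k (∑ a, eps a (iota a F)) = (k : ℝ) • comp k F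
  | 0, F => by simp [comp_eps_zero]
  | k + 1, F => by
      refine tensor_ext_cons fun c => ?_
      have h := sum_eps_iota_comp k (iota c F)
      rw [← comp_iota, map_sum]
      simp only [iota_eps, iota_iota c _ F, map_neg, sub_neg_eq_add, Finset.sum_add_distrib,
        ite_smul, one_smul, zero_smul, Finset.sum_ite_eq, Finset.mem_univ, if_true]
      rw [map_add, h, comp_iota, slot_smul]
      push_cast
      module

lemma IsHomog.sum_eps_iota {k : ℕ} {F : Forms n} (hF : IsHomog k F) :
    ∑ a, eps a (iota a F) = (k : ℝ) • F := by
  refine forms_ext fun j => ?_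
  rw [sum_eps_iota_comp, map_smul]
  by_cases h : j = k
  · rw [h]
  · simp [hF j h]

lemma IsHomog.iota {k : ℕ} {F : Forms n} (hF : IsHomog (k + 1) F) (a : Fin n) :
    IsHomog k (iota a F) := fun j hj => by
  rw [comp_iota, hF (j + 1) (by omega), slot_zero]

lemma IsHomog.eps {k : ℕ} {F : Forms n} (hF : IsHomog k F) (a : Fin n) :
    IsHomog (k + 1) (eps a F) := fun j hj => by
  rcases j with _ | j
  · rfl
  · rw [comp_eps_succ, hF j (by omega), ← zero_smul ℝ (0 : Tensor n j), wedge_smul, zero_smul]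

lemma IsHomog.add {k : ℕ} {F G : Forms n} (hF : IsHomog k F) (hG : IsHomog k G) :
    IsHomog k (F + G) := fun j hj => by rw [map_add, hF j hj, hG j hj, add_zero]

lemma IsHomog.smul {k : ℕ} {F : Forms n} (hF : IsHomog k F) (r : ℝ) :
    IsHomog k (r • F) := fun j hj => by rw [map_smul, hF j hj, smul_zero]

lemma isHomog_zero {k : ℕ} : IsHomog k (0 : Forms n) := fun _ _ => map_zero _

lemma IsHomog.neg {k : ℕ} {F : Forms n} (hF : IsHomog k F) : IsHomog k (-F) := by
  rw [← neg_one_smul ℝ]; exact hF.smul _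

lemma IsHomog.sub {k : ℕ} {F G : Forms n} (hF : IsHomog k F) (hG : IsHomog k G) :
    IsHomog k (F - G) := by rw [sub_eq_add_neg]; exact hF.add hG.neg

lemma IsHomog.sum {k : ℕ} {ι : Type*} (s : Finset ι) {F : ι → Forms n}
    (hF : ∀ i ∈ s, IsHomog k (F i)) : IsHomog k (∑ i ∈ s, F i) :=
  Finset.sum_induction _ _ (fun _ _ => IsHomog.add) isHomog_zero hF

lemma IsHomog.ext {k : ℕ} {F G : Forms n} (hF : IsHomog k F) (hG : IsHomog k G)
    (h : comp k F = comp k G) : F = G := forms_ext fun j => by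
  by_cases hj : j = k
  · rw [hj, h]
  · rw [hF j hj, hG j hj]

/-- An alternating tensor as a homogeneous element. -/
def ofAlt {k : ℕ} (f : Tensor n k) (hf : IsAlt f) : Forms n :=
  ⟨Pi.single k f, fun j => by
    by_cases h : j = k
    · subst h; simpa using hf
    · rw [Pi.single_eq_of_ne h]; exact isAlt_zero⟩

lemma comp_ofAlt {k : ℕ} (f : Tensor n k) (hf : IsAlt f) : comp k (ofAlt f hf) = f :=
  Pi.single_eq_same k f

lemma isHomog_ofAlt {k : ℕ} (f : Tensor n k) (hf : IsAlt f) : IsHomog k (ofAlt f hf) :=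
  fun _ hj => Pi.single_eq_of_ne hj f

end CAR

/-- Exterior multiplication by the covector with components `v`. -/
def extBy {n : ℕ} (v : Fin n → ℝ) : Forms n →ₗ[ℝ] Forms n := ∑ d, v d • eps d

/-- Interior multiplication by the vector with components `u`. -/
def intBy {n : ℕ} (u : Fin n → ℝ) : Forms n →ₗ[ℝ] Forms n := ∑ d, u d • iota d

section CARVectors

variable {n : ℕ}

lemma extBy_apply (v : Fin n → ℝ) (F : Forms n) : extBy v F = ∑ d, v d • eps d F := by
  simp [extBy]

lemma intBy_apply (u : Fin n → ℝ) (F : Forms n) : intBy u F = ∑ d, u d • iota d F := by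
  simp [intBy]

lemma iota_extBy (a : Fin n) (v : Fin n → ℝ) (F : Forms n) :
    iota a (extBy v F) = v a • F - extBy v (iota a F) := by
  simp [extBy_apply, iota_eps, smul_sub, Finset.sum_sub_distrib]

lemma intBy_eps (u : Fin n → ℝ) (a : Fin n) (F : Forms n) :
    intBy u (eps a F) = u a • F - eps a (intBy u F) := by
  simp [intBy_apply, iota_eps, smul_sub, Finset.sum_sub_distrib]

lemma intBy_extBy (u v : Fin n → ℝ) (F : Forms n) :
    intBy u (extBy v F) = (∑ d, u d * v d) • F - extBy v (intBy u F) := by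
  rw [intBy_apply]
  simp only [iota_extBy, smul_sub, Finset.sum_sub_distrib, smul_smul, Finset.sum_smul]
  simp [intBy_apply]

lemma eps_extBy (a : Fin n) (v : Fin n → ℝ) (F : Forms n) :
    eps a (extBy v F) = - extBy v (eps a F) := by
  simp [extBy_apply, eps_eps a]

lemma extBy_extBy (u v : Fin n → ℝ) (F : Forms n) :
    extBy u (extBy v F) = - extBy v (extBy u F) := by
  rw [extBy_apply]
  simp [eps_extBy, extBy_apply u]

lemma iota_intBy (a : Fin n) (u : Fin n → ℝ) (F : Forms n) :
    iota a (intBy u F) = - intBy u (iota a F) := by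
  simp [intBy_apply, iota_iota a]

lemma intBy_intBy (u v : Fin n → ℝ) (F : Forms n) :
    intBy u (intBy v F) = - intBy v (intBy u F) := by
  rw [intBy_apply]
  simp [iota_intBy, intBy_apply u]

lemma IsHomog.extBy {k : ℕ} {F : Forms n} (hF : IsHomog k F) (v : Fin n → ℝ) :
    IsHomog (k + 1) (extBy v F) := by
  rw [extBy_apply]; exact IsHomog.sum _ fun d _ => (hF.eps d).smul _

lemma IsHomog.intBy {k : ℕ} {F : Forms n} (hF : IsHomog (k + 1) F) (u : Fin n → ℝ) :
    IsHomog k (intBy u F) := by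
  rw [intBy_apply]; exact IsHomog.sum _ fun d _ => (hF.iota d).smul _

/-- A double sum against an antisymmetric family only sees the antisymmetric part. -/
lemma sum_sum_smul_antisymm {E : Type*} [AddCommGroup E] [Module ℝ E] (A B : Fin n → Fin n → ℝ)
    (y : Fin n → Fin n → E) (hy : ∀ i j, y i j = - y j i)
    (hAB : ∀ i j, A i j - A j i = B i j) :
    ∑ i, ∑ j, A i j • y i j = (1 / 2 : ℝ) • ∑ i, ∑ j, B i j • y i j := by
  have h : ∑ i, ∑ j, A i j • y i j = - ∑ i, ∑ j, A j i • y i j := by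
    rw [Finset.sum_comm, ← Finset.sum_neg_distrib]
    refine Finset.sum_congr rfl fun i _ => ?_
    rw [← Finset.sum_neg_distrib]
    refine Finset.sum_congr rfl fun j _ => ?_
    rw [hy j i, smul_neg]
  have h2 : ∑ i, ∑ j, B i j • y i j
      = ∑ i, ∑ j, A i j • y i j - ∑ i, ∑ j, A j i • y i j := by
    simp only [← hAB, sub_smul, Finset.sum_sub_distrib]
  have h3 : ∑ i, ∑ j, A j i • y i j = - ∑ i, ∑ j, A i j • y i j := by rw [h, neg_neg]
  rw [h2, h3]
  module

lemma sum_sum_smul_symm {E : Type*} [AddCommGroup E] [Module ℝ E] (A : Fin n → Fin n → ℝ)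
    (y : Fin n → Fin n → E) (hy : ∀ i j, y i j = - y j i) (hA : ∀ i j, A i j = A j i) :
    ∑ i, ∑ j, A i j • y i j = 0 := by
  rw [sum_sum_smul_antisymm A (fun _ _ => 0) y hy fun i j => by rw [hA i j, sub_self]]
  simp

lemma sum_sum_sum_rotate {E α β γ : Type*} [Fintype α] [Fintype β] [Fintype γ] [AddCommMonoid E]
    (f : α → β → γ → E) : ∑ a, ∑ b, ∑ c, f a b c = ∑ c, ∑ a, ∑ b, f a b c := by
  rw [Finset.sum_comm (f := fun c a => ∑ b, f a b c)]
  exact Finset.sum_congr rfl fun a _ => Finset.sum_comm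

end CARVectors

/-- The algebraic properties of the Weyl tensor with respect to the inverse metric `H`. -/
structure IsWeylTensor {n : ℕ} (H : Matrix (Fin n) (Fin n) ℝ)
    (C : Fin n → Fin n → Fin n → Fin n → ℝ) : Prop where
  skew_fst : ∀ a b c d, C a b c d = - C b a c d
  skew_snd : ∀ a b c d, C a b c d = - C a b d c
  bianchi : ∀ a b c d, C a b c d + C b c a d + C c a b d = 0
  trace : ∀ b d, ∑ a, ∑ c, H a c * C a b c d = 0

section Core

variable {n : ℕ} {H : Matrix (Fin n) (Fin n) ℝ} {C : Fin n → Fin n → Fin n → Fin n → ℝ}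

lemma IsWeylTensor.pair (hC : IsWeylTensor H C) (a b c d : Fin n) : C a b c d = C c d a b := by
  have h1 := hC.bianchi a b c d
  have h2 := hC.bianchi b c d a
  have h3 := hC.bianchi c d a b
  have h4 := hC.bianchi d a b c
  have e1 := hC.skew_fst
  have e2 := hC.skew_snd
  linarith [e1 a b c d, e1 b c a d, e1 c a b d, e1 c d b a, e1 d b c a, e1 b c d a, e1 d a c b,
    e1 a c d b, e1 c d a b, e1 a b d c, e1 b d a c, e1 d a b c,
    e2 a b c d, e2 b c a d, e2 c a b d, e2 c d b a, e2 d b c a, e2 b c d a, e2 d a c b,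
    e2 a c d b, e2 c d a b, e2 a b d c, e2 b d a c, e2 d a b c]

lemma IsWeylTensor.bianchi' (hC : IsWeylTensor H C) (a b c d : Fin n) :
    C a b c d + C a c d b + C a d b c = 0 := by
  have h1 := hC.bianchi b c d a
  rw [hC.skew_snd b c, hC.skew_snd c d, hC.skew_snd d b] at h1
  rw [hC.pair a b, hC.pair a c, hC.pair a d]
  linarith

/-- `X_{bc} = C_{bcd}{}^p ε^d ι_p σ`. -/
def curvAct (H : Matrix (Fin n) (Fin n) ℝ) (C : Fin n → Fin n → Fin n → Fin n → ℝ) (σ : Forms n)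
    (b c : Fin n) : Forms n :=
  ∑ d, ∑ q, C b c d q • eps d (intBy (H q) σ)

/-- `Z_b = C_{deb}{}^p ε^d ε^e ι_p σ`. -/
def curvSkew (H : Matrix (Fin n) (Fin n) ℝ) (C : Fin n → Fin n → Fin n → Fin n → ℝ) (σ : Forms n)
    (b : Fin n) : Forms n :=
  ∑ d, ∑ e, ∑ q, C d e b q • eps d (eps e (intBy (H q) σ))

/-- `E_b = C_{bd}{}^{pq} ε^d ι_q ι_p σ`. -/
def curvTrace (H : Matrix (Fin n) (Fin n) ℝ) (C : Fin n → Fin n → Fin n → Fin n → ℝ) (σ : Forms n)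
    (b : Fin n) : Forms n :=
  ∑ d, ∑ p, ∑ q, C b d p q • eps d (intBy (H q) (intBy (H p) σ))

lemma sum_eps_curvAct (hC : IsWeylTensor H C) (σ : Forms n) (b : Fin n) :
    ∑ d, eps d (curvAct H C σ d b) = (1 / 2 : ℝ) • curvSkew H C σ b := by
  have h : ∀ q, ∑ d, ∑ e, C d b e q • eps d (eps e (intBy (H q) σ))
      = (1 / 2 : ℝ) • ∑ d, ∑ e, C d e b q • eps d (eps e (intBy (H q) σ)) := fun q => by
    refine sum_sum_smul_antisymm (fun d e => C d b e q) _ _ (fun _ _ => eps_eps _ _ _)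
      fun d e => ?_
    have h1 := hC.bianchi d b e q
    have h2 := hC.skew_fst e b d q
    have h3 := hC.skew_fst e d b q
    linarith
  have h1 : ∑ d, eps d (curvAct H C σ d b)
      = ∑ q, ∑ d, ∑ e, C d b e q • eps d (eps e (intBy (H q) σ)) := by
    simp only [curvAct, map_sum, map_smul]
    rw [Finset.sum_comm' (t' := Finset.univ) (s' := fun _ => Finset.univ) (by simp)]
    rw [Finset.sum_congr rfl fun e _ => Finset.sum_comm, Finset.sum_comm]
    exact Finset.sum_congr rfl fun q _ => Finset.sum_comm
  rw [h1, Finset.sum_congr rfl fun q _ => h q, ← Finset.smul_sum, curvSkew]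
  congr 1
  rw [Finset.sum_comm]
  exact Finset.sum_congr rfl fun d _ => Finset.sum_comm

lemma sum_eps_curvSkew (hC : IsWeylTensor H C) (σ : Forms n) :
    ∑ b, eps b (curvSkew H C σ b) = 0 := by
  have key : ∑ b, eps b (curvSkew H C σ b)
      = ∑ q, ∑ b, ∑ d, ∑ e, C d e b q • eps b (eps d (eps e (intBy (H q) σ))) := by
    simp only [curvSkew, map_sum, map_smul]
    rw [Finset.sum_comm' (s := Finset.univ) (t := fun _ : Fin n => Finset.univ)
      (t' := Finset.univ) (s' := fun _ => Finset.univ) (by simp)]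
    rw [Finset.sum_comm]
    have : ∀ b : Fin n, ∑ d, ∑ e, ∑ q, C d e b q • eps b (eps d (eps e (intBy (H q) σ)))
      = ∑ q, ∑ d, ∑ e, C d e b q • eps b (eps d (eps e (intBy (H q) σ))) := fun b => by
      rw [Finset.sum_congr rfl fun d _ => Finset.sum_comm, Finset.sum_comm]
    rw [Finset.sum_congr rfl fun b _ => this b, Finset.sum_comm]
  rw [key]
  refine Finset.sum_eq_zero fun q _ => ?_
  set y := intBy (H q) σ
  set S := ∑ b, ∑ d, ∑ e, C d e b q • eps b (eps d (eps e y)) with hS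
  have r1 : S = ∑ b, ∑ d, ∑ e, C b d e q • eps b (eps d (eps e y)) := by
    rw [hS, Finset.sum_comm]
    refine Finset.sum_congr rfl fun d _ => ?_
    rw [Finset.sum_comm]
    refine Finset.sum_congr rfl fun e _ => Finset.sum_congr rfl fun b _ => ?_
    rw [eps_eps b d, eps_eps b e, map_neg, neg_neg]
  have r2 : S = ∑ b, ∑ d, ∑ e, C e b d q • eps b (eps d (eps e y)) := by
    rw [hS, Finset.sum_congr rfl fun b _ => Finset.sum_comm, Finset.sum_comm]
    refine Finset.sum_congr rfl fun d _ => Finset.sum_congr rfl fun e _ =>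
      Finset.sum_congr rfl fun b _ => ?_
    rw [eps_eps b d, map_neg, eps_eps e d, neg_neg]
  have r3 : S + S + S = 0 := by
    nth_rewrite 2 [r1]
    nth_rewrite 2 [r2]
    rw [hS]
    simp only [← Finset.sum_add_distrib, ← add_smul]
    refine Finset.sum_eq_zero fun b _ => Finset.sum_eq_zero fun d _ =>
      Finset.sum_eq_zero fun e _ => ?_
    rw [show C d e b q + C b d e q + C e b d q = 0 by linarith [hC.bianchi d e b q], zero_smul]
  have : (3 : ℝ) • S = 0 := by rw [← r3]; module
  simpa using this


lemma sum_intBy_curvAct (hC : IsWeylTensor H C) (σ : Forms n) (b : Fin n) :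
    ∑ c, intBy (H c) (curvAct H C σ b c) = (1 / 2 : ℝ) • curvTrace H C σ b := by
  have h1 : ∑ c, intBy (H c) (curvAct H C σ b c)
      = ∑ c, ∑ d, ∑ q, C b c d q • (H c d • intBy (H q) σ)
        - ∑ d, ∑ c, ∑ q, C b c d q • eps d (intBy (H c) (intBy (H q) σ)) := by
    rw [Finset.sum_comm (s := Finset.univ (α := Fin n))
      (f := fun d c => ∑ q, C b c d q • eps d (intBy (H c) (intBy (H q) σ)))]
    simp only [curvAct, map_sum, map_smul, intBy_eps, smul_sub, Finset.sum_sub_distrib]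
  have h2 : ∑ c, ∑ d, ∑ q, C b c d q • (H c d • intBy (H q) σ) = 0 := by
    have : ∑ c, ∑ d, ∑ q, C b c d q • (H c d • intBy (H q) σ)
        = ∑ q, (∑ c, ∑ d, C b c d q * H c d) • intBy (H q) σ := by
      simp only [Finset.sum_smul, smul_smul]
      rw [Finset.sum_congr rfl fun c _ => Finset.sum_comm, Finset.sum_comm]
    rw [this]
    refine Finset.sum_eq_zero fun q _ => ?_
    have h := hC.trace b q
    have : ∑ c, ∑ d, C b c d q * H c d = - ∑ a, ∑ c, H a c * C a b c q := by
      rw [← Finset.sum_neg_distrib]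
      refine Finset.sum_congr rfl fun c _ => ?_
      rw [← Finset.sum_neg_distrib]
      refine Finset.sum_congr rfl fun d _ => ?_
      rw [hC.skew_fst]; ring
    rw [this, h, neg_zero, zero_smul]
  have h3 : ∀ d, ∑ c, ∑ q, C b c d q • eps d (intBy (H c) (intBy (H q) σ))
      = (1 / 2 : ℝ) • ∑ c, ∑ q, C b d c q • eps d (intBy (H c) (intBy (H q) σ)) := fun d => by
    refine sum_sum_smul_antisymm (fun c q => C b c d q) _ _
      (fun c q => by rw [intBy_intBy, map_neg]) fun c q => ?_
    have := hC.bianchi' b c d q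
    have := hC.skew_snd b q c d
    have := hC.skew_snd b d q c
    linarith
  rw [h1, h2, zero_sub, Finset.sum_congr rfl fun d _ => h3 d, ← Finset.smul_sum, ← smul_neg,
    curvTrace, ← Finset.sum_neg_distrib]
  congr 1
  refine Finset.sum_congr rfl fun d _ => ?_
  rw [← Finset.sum_neg_distrib]
  refine Finset.sum_congr rfl fun p _ => ?_
  rw [← Finset.sum_neg_distrib]
  refine Finset.sum_congr rfl fun q _ => ?_
  rw [intBy_intBy (H p), map_neg, smul_neg, neg_neg]

lemma sum_intBy_curvTrace (hC : IsWeylTensor H C) (hH : ∀ i j, H i j = H j i) (σ : Forms n) :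
    ∑ b, intBy (H b) (curvTrace H C σ b) = 0 := by
  set y : Fin n → Fin n → Fin n → Forms n :=
    fun b p q => intBy (H b) (intBy (H q) (intBy (H p) σ)) with hy
  have h0 : ∀ b, intBy (H b) (curvTrace H C σ b)
      = ∑ p, ∑ q, (∑ d, C b d p q * H b d) • intBy (H q) (intBy (H p) σ)
        - ∑ d, eps d (∑ p, ∑ q, C b d p q • y b p q) := fun b => by
    simp only [curvTrace, map_sum, map_smul, intBy_eps, smul_sub, Finset.sum_sub_distrib,
      Finset.sum_smul, smul_smul]
    rw [← sum_sum_sum_rotate fun p q d => (C b d p q * H b d) • intBy (H q) (intBy (H p) σ),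
      sum_sum_sum_rotate fun p q d => (C b d p q * H b d) • intBy (H q) (intBy (H p) σ)]
  have h1 : ∑ b, intBy (H b) (curvTrace H C σ b)
      = ∑ p, ∑ q, (∑ b, ∑ d, C b d p q * H b d) • intBy (H q) (intBy (H p) σ)
        - ∑ d, eps d (∑ b, ∑ p, ∑ q, C b d p q • y b p q) := by
    rw [Finset.sum_congr rfl fun b _ => h0 b, Finset.sum_sub_distrib]
    congr 1
    · rw [← sum_sum_sum_rotate fun p q b =>
        (∑ d, C b d p q * H b d) • intBy (H q) (intBy (H p) σ)]
      simp only [Finset.sum_smul]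
    · rw [Finset.sum_comm]
      simp only [map_sum]
  rw [h1]
  have h2 : ∀ p q, ∑ b, ∑ d, C b d p q * H b d = 0 := fun p q => by
    have h := sum_sum_smul_symm (E := ℝ) (fun b d => H b d) (fun b d => C b d p q)
      (fun b d => hC.skew_fst _ _ _ _) hH
    simpa [mul_comm] using h
  have h3 : ∀ d, ∑ b, ∑ p, ∑ q, C b d p q • y b p q = 0 := fun d => by
    set S := ∑ b, ∑ p, ∑ q, C b d p q • y b p q with hS
    have s1 : ∀ b p q, y b p q = - y q p b := fun b p q => by simp only [hy]; rw [intBy_intBy]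
    have s2 : ∀ b p q, y b p q = - y b q p := fun b p q => by
      simp only [hy]; rw [intBy_intBy (H q), map_neg]
    have r1 : S = ∑ b, ∑ p, ∑ q, C p d q b • y b p q := by
      rw [hS, sum_sum_sum_rotate fun b p q => C b d p q • y b p q]
      refine Finset.sum_congr rfl fun b _ => Finset.sum_congr rfl fun p _ =>
        Finset.sum_congr rfl fun q _ => ?_
      rw [s1 p q b, s2 b q p, neg_neg]
    have r2 : S = ∑ b, ∑ p, ∑ q, C q d b p • y b p q := by
      rw [sum_sum_sum_rotate fun b p q => C q d b p • y b p q, hS]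
      refine Finset.sum_congr rfl fun q _ => Finset.sum_congr rfl fun b _ =>
        Finset.sum_congr rfl fun p _ => ?_
      rw [s2 q b p, s1 q p b, neg_neg]
    have r3 : S + S + S = 0 := by
      nth_rewrite 2 [r1]
      nth_rewrite 2 [r2]
      rw [hS]
      simp only [← Finset.sum_add_distrib, ← add_smul]
      refine Finset.sum_eq_zero fun b _ => Finset.sum_eq_zero fun p _ =>
        Finset.sum_eq_zero fun q _ => ?_
      rw [show C b d p q + C p d q b + C q d b p = 0 by
        linarith [hC.bianchi' d b p q, hC.skew_fst b d p q, hC.skew_fst p d q b,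
          hC.skew_fst q d b p], zero_smul]
    have : (3 : ℝ) • S = 0 := by rw [← r3]; module
    simpa using this
  simp [h2, h3]

/-- The second term of `C ◇ σ` before skewing over `c¹c²`, up to a constant. -/
lemma sum_eps_eps_iota (hC : IsWeylTensor H C) (σ : Forms n) (a b : Fin n) :
    (∑ d, ∑ e, ∑ q, C d e a q • eps d (eps e (iota b (intBy (H q) σ))))
      = iota b (curvSkew H C σ a) - (2 : ℝ) • ∑ e, ∑ q, C b e a q • eps e (intBy (H q) σ) := by
  have key : iota b (curvSkew H C σ a)
      = ∑ d, ∑ e, ∑ q, C d e a q • eps d (eps e (iota b (intBy (H q) σ)))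
        + ((∑ e, ∑ q, C b e a q • eps e (intBy (H q) σ))
          - ∑ d, ∑ q, C d b a q • eps d (intBy (H q) σ)) := by
    simp only [curvSkew, map_sum, map_smul, iota_eps, map_sub, smul_sub, Finset.sum_sub_distrib]
    have e1 : ∑ d, ∑ e, ∑ q, C d e a q • (if b = d then (1 : ℝ) else 0) • eps e (intBy (H q) σ)
        = ∑ e, ∑ q, C b e a q • eps e (intBy (H q) σ) := by
      rw [Finset.sum_eq_single b]
      · simp
      · intro d _ hd; simp [Ne.symm hd]
      · simp
    have e2 : ∑ d, ∑ e, ∑ q, C d e a q • (if b = e then (1 : ℝ) else 0) • eps d (intBy (H q) σ)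
        = ∑ d, ∑ q, C d b a q • eps d (intBy (H q) σ) := by
      refine Finset.sum_congr rfl fun d _ => ?_
      rw [Finset.sum_eq_single b]
      · simp
      · intro e _ he; simp [Ne.symm he]
      · simp
    rw [e1, e2]
    abel
  have h : ∑ d, ∑ q, C d b a q • eps d (intBy (H q) σ)
      = - ∑ e, ∑ q, C b e a q • eps e (intBy (H q) σ) := by
    simp only [← Finset.sum_neg_distrib]
    exact Finset.sum_congr rfl fun d _ => Finset.sum_congr rfl fun q _ => by
      rw [hC.skew_fst]; module
  rw [key, h]
  module

end Core

section Core

variable {n : ℕ} {G H : Matrix (Fin n) (Fin n) ℝ} {C : Fin n → Fin n → Fin n → Fin n → ℝ}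

lemma iota_sum_eps_curvTrace (hC : IsWeylTensor H C) (σ : Forms n) (c : Fin n) :
    iota c (∑ b, eps b (curvTrace H C σ b)) = (2 : ℝ) • curvTrace H C σ c
      + ∑ d, ∑ e, ∑ p, ∑ q, C d e p q • eps d (eps e (iota c (intBy (H q) (intBy (H p) σ)))) := by
  have e1 : ∀ y : Fin n → Fin n → Forms n,
      ∑ d, ∑ e, ∑ p, ∑ q, C d e p q • (if c = d then (1 : ℝ) else 0) • eps e (y p q)
        = ∑ e, ∑ p, ∑ q, C c e p q • eps e (y p q) := fun y => by
    rw [Finset.sum_eq_single c]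
    · simp
    · intro d _ hd; simp [Ne.symm hd]
    · simp
  have e2 : ∀ y : Fin n → Fin n → Forms n,
      ∑ d, ∑ e, ∑ p, ∑ q, C d e p q • (if c = e then (1 : ℝ) else 0) • eps d (y p q)
        = - ∑ d, ∑ p, ∑ q, C c d p q • eps d (y p q) := fun y => by
    rw [← Finset.sum_neg_distrib]
    refine Finset.sum_congr rfl fun d _ => ?_
    rw [Finset.sum_eq_single c]
    · simp only [if_true, one_smul, ← Finset.sum_neg_distrib]
      refine Finset.sum_congr rfl fun p _ => Finset.sum_congr rfl fun q _ => ?_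
      rw [hC.skew_fst]; module
    · intro e _ he; simp [Ne.symm he]
    · simp
  simp only [curvTrace, map_sum, map_smul, iota_eps, map_sub, smul_sub, Finset.sum_sub_distrib]
  rw [e1, e2]
  module

/-- `X_{bc}` is built from the covector-valued forms `μ` and `ν`. -/
def IsSplit (G : Matrix (Fin n) (Fin n) ℝ) (X : Fin n → Fin n → Forms n) (μ ν : Fin n → Forms n) :
    Prop :=
  ∀ b c, X b c = iota c (μ b) - iota b (μ c) + (extBy (G c) (ν b) - extBy (G b) (ν c))

lemma sum_eps_extBy (hG : ∀ i j, G i j = G j i) (F : Forms n) :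
    ∑ d, eps d (extBy (G d) F) = 0 := by
  have h := sum_sum_smul_symm (fun i j => G i j) (fun i j => eps i (eps j F))
    (fun i j => eps_eps i j F) hG
  simpa [extBy_apply] using h

lemma sum_intBy_iota (hH : ∀ i j, H i j = H j i) (F : Forms n) :
    ∑ d, intBy (H d) (iota d F) = 0 := by
  have h := sum_sum_smul_symm (fun i j => H i j) (fun i j => iota j (iota i F))
    (fun i j => iota_iota j i F) hH
  simpa [intBy_apply] using h

lemma forms_sub_smul (r s : ℝ) (F : Forms n) : r • F - s • F = (r - s) • F := by module

lemma forms_neg_smul (r : ℝ) (F : Forms n) : -(r • F) = (-r) • F := by module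

lemma sum_extBy_intBy (hH : ∀ i j, H i j = H j i)
    (hHG : ∀ i j, ∑ d, H i d * G d j = if i = j then 1 else 0) (F : Forms n) :
    ∑ c, extBy (G c) (intBy (H c) F) = ∑ a, eps a (iota a F) := by
  have h1 : ∑ c, extBy (G c) (intBy (H c) F)
      = ∑ a, ∑ b, (∑ c, H b c * G c a) • eps a (iota b F) := by
    simp only [extBy_apply, intBy_apply, map_sum, map_smul, Finset.smul_sum, smul_smul,
      Finset.sum_smul]
    rw [sum_sum_sum_rotate fun a b c => (H b c * G c a) • eps a (iota b F)]
    refine Finset.sum_congr rfl fun c _ => ?_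
    rw [Finset.sum_comm]
    refine Finset.sum_congr rfl fun a _ => Finset.sum_congr rfl fun b _ => ?_
    rw [hH b c, mul_comm]
  rw [h1]
  simp [hHG]

lemma sum_eps_split {k : ℕ} {X : Fin n → Fin n → Forms n} {μ ν : Fin n → Forms n}
    (hG : ∀ i j, G i j = G j i) (hX : IsSplit G X μ ν) (hμ : ∀ b, IsHomog (k + 1) (μ b))
    (c : Fin n) : ∑ d, eps d (X d c) = - iota c (∑ d, eps d (μ d)) - (k : ℝ) • μ c
      - extBy (G c) (∑ d, eps d (ν d)) := by
  have h1 : ∑ d, eps d (iota c (μ d)) = μ c - iota c (∑ d, eps d (μ d)) := by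
    simp only [map_sum, iota_eps, Finset.sum_sub_distrib]
    simp
  have h2 := (hμ c).sum_eps_iota
  have h3 : ∑ d, eps d (extBy (G c) (ν d)) = - extBy (G c) (∑ d, eps d (ν d)) := by
    simp only [map_sum, eps_extBy, Finset.sum_neg_distrib]
  have h4 := sum_eps_extBy hG (ν c)
  simp only [hX _ _, map_add, map_sub, Finset.sum_add_distrib, Finset.sum_sub_distrib]
  rw [h1, h2, h3, h4]
  push_cast
  module

lemma sum_intBy_split {k : ℕ} {X : Fin n → Fin n → Forms n} {μ ν : Fin n → Forms n}
    (hG : ∀ i j, G i j = G j i) (hH : ∀ i j, H i j = H j i)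
    (hHG : ∀ i j, ∑ d, H i d * G d j = if i = j then 1 else 0)
    (hX : IsSplit G X μ ν) (hν : ∀ b, IsHomog k (ν b)) (b : Fin n) :
    ∑ c, intBy (H c) (X b c) = iota b (∑ c, intBy (H c) (μ c))
      + ((n : ℝ) - k - 1) • ν b + extBy (G b) (∑ c, intBy (H c) (ν c)) := by
  have hHG' : ∀ i j, ∑ d, H i d * G j d = if i = j then 1 else 0 := fun i j => by
    rw [← hHG i j]; exact Finset.sum_congr rfl fun d _ => by rw [hG]
  have h1 := sum_intBy_iota hH (μ b)
  have h2 : ∑ c, intBy (H c) (iota b (μ c)) = - iota b (∑ c, intBy (H c) (μ c)) := by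
    simp only [map_sum, iota_intBy, Finset.sum_neg_distrib, neg_neg]
  have h3 : ∑ c, intBy (H c) (extBy (G c) (ν b)) = ((n : ℝ) - k) • ν b := by
    simp only [intBy_extBy, hHG', Finset.sum_sub_distrib]
    rw [sum_extBy_intBy hH hHG, (hν b).sum_eps_iota]
    simp only [if_true, one_smul, Finset.sum_const, Finset.card_univ, Fintype.card_fin,
      ← Nat.cast_smul_eq_nsmul ℝ]
    module
  have h4 : ∑ c, intBy (H c) (extBy (G b) (ν c))
      = ν b - extBy (G b) (∑ c, intBy (H c) (ν c)) := by
    simp only [intBy_extBy, hHG', Finset.sum_sub_distrib, map_sum]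
    simp
  simp only [hX _ _, map_add, map_sub, Finset.sum_add_distrib, Finset.sum_sub_distrib]
  rw [h1, h2, h3, h4]
  module

/-- The algebraic heart of the theorem: if the curvature action `C_{bc} · σ` is built from
covector-valued forms, then the skew part over `c¹c²` of the three terms of `C ◇ σ` vanishes. -/
theorem lozenge_core {m : ℕ} {σ : Forms n} {μ ν : Fin n → Forms n}
    (hG : ∀ i j, G i j = G j i) (hH : ∀ i j, H i j = H j i)
    (hHG : ∀ i j, ∑ d, H i d * G d j = if i = j then 1 else 0) (hC : IsWeylTensor H C)
    (hmn : m + 2 < n) (hX : IsSplit G (curvAct H C σ) μ ν)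
    (hμ : ∀ b, IsHomog (m + 3) (μ b)) (hν : ∀ b, IsHomog (m + 1) (ν b)) (a b : Fin n) :
    let L : Fin n → Fin n → Forms n := fun a b =>
      curvAct H C σ a b
        + (1 / ((m : ℝ) + 1)) •
          ∑ d, ∑ e, ∑ q, C d e a q • eps d (eps e (iota b (intBy (H q) σ)))
        + (1 / (((n : ℝ) - (m + 2)) * (m + 1))) • extBy (G a) (
            (m : ℝ) • curvTrace H C σ b - ∑ d, ∑ e, ∑ p, ∑ q,
              C d e p q • eps d (eps e (iota b (intBy (H q) (intBy (H p) σ)))))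
    L a b = L b a := by
  intro L
  set X := curvAct H C σ with hXdef
  set Z := curvSkew H C σ with hZ
  set E := curvTrace H C σ with hE
  set P := ∑ d, eps d (μ d) with hP
  set Q := ∑ d, eps d (ν d) with hQ
  set M := ∑ c, intBy (H c) (μ c) with hM
  set N := ∑ c, intBy (H c) (ν c) with hN
  have hm0 : (0 : ℝ) ≤ m := Nat.cast_nonneg m
  have hn0 : (m : ℝ) + 2 < n := by exact_mod_cast hmn
  have hPh : IsHomog (m + 4) P := IsHomog.sum _ fun d _ => (hμ d).eps d
  have hMh : IsHomog (m + 2) M := IsHomog.sum _ fun d _ => (hμ d).intBy _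
  have hNh : IsHomog m N := IsHomog.sum _ fun d _ => (hν d).intBy _
  have hZX : ∀ c, (1 / 2 : ℝ) • Z c
      = - iota c P - ((m + 2 : ℕ) : ℝ) • μ c - extBy (G c) Q := fun c => by
    rw [← sum_eps_split hG hX hμ c, sum_eps_curvAct hC]
  have hP0 : P = 0 := by
    have h1 : ∑ c, eps c ((1 / 2 : ℝ) • Z c) = 0 := by
      simp only [map_smul, ← Finset.smul_sum]
      rw [sum_eps_curvSkew hC, smul_zero]
    simp only [hZX, map_sub, map_neg, map_smul, Finset.sum_sub_distrib, Finset.sum_neg_distrib,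
      ← Finset.smul_sum] at h1
    rw [hPh.sum_eps_iota, sum_eps_extBy hG, ← hP] at h1
    have h2 : ((2 : ℝ) * m + 6) • P = 0 := by
      rw [← neg_eq_zero, ← h1]; push_cast; module
    exact (smul_eq_zero.mp h2).resolve_left (by positivity)
  have hEX : ∀ c, (1 / 2 : ℝ) • E c
      = iota c M + ((n : ℝ) - (m + 1 : ℕ) - 1) • ν c + extBy (G c) N := fun c => by
    rw [← sum_intBy_split hG hH hHG hX hν c, sum_intBy_curvAct hC]
  have hN0 : N = 0 := by
    have h1 : ∑ c, intBy (H c) ((1 / 2 : ℝ) • E c) = 0 := by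
      simp only [map_smul, ← Finset.smul_sum]
      rw [sum_intBy_curvTrace hC hH, smul_zero]
    have h3 : ∑ c, intBy (H c) (extBy (G c) N) = ((n : ℝ) - m) • N := by
      have hHG' : ∀ i j, ∑ d, H i d * G j d = if i = j then 1 else 0 := fun i j => by
        rw [← hHG i j]; exact Finset.sum_congr rfl fun d _ => by rw [hG]
      simp only [intBy_extBy, hHG', Finset.sum_sub_distrib]
      rw [sum_extBy_intBy hH hHG, hNh.sum_eps_iota]
      simp only [if_true, one_smul, Finset.sum_const, Finset.card_univ, Fintype.card_fin,
        ← Nat.cast_smul_eq_nsmul ℝ]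
      module
    simp only [hEX, map_add, map_smul, Finset.sum_add_distrib, ← Finset.smul_sum] at h1
    rw [sum_intBy_iota hH, h3, ← hN] at h1
    have h2 : ((2 : ℝ) * (n - (m + 2)) + 2) • N = 0 := by
      rw [← h1]; push_cast; module
    refine (smul_eq_zero.mp h2).resolve_left ?_
    have : 0 < (2 : ℝ) * (n - (m + 2)) + 2 := by linarith
    exact this.ne'
  have hD : (1 / 2 : ℝ) • ∑ c, eps c (E c) = ((m : ℝ) + 2) • M + ((n : ℝ) - (m + 2)) • Q := by
    have h1 : ∑ c, eps c ((1 / 2 : ℝ) • E c) = (1 / 2 : ℝ) • ∑ c, eps c (E c) := by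
      simp only [map_smul, ← Finset.smul_sum]
    rw [← h1]
    simp only [hEX, hN0, map_add, map_smul, Finset.sum_add_distrib, ← Finset.smul_sum]
    rw [hMh.sum_eps_iota, ← hQ]
    push_cast
    simp only [map_zero, Finset.sum_const_zero]
    module
  have hY : ∀ c, ∑ d, ∑ e, ∑ p, ∑ q,
      C d e p q • eps d (eps e (iota c (intBy (H q) (intBy (H p) σ))))
      = (2 : ℝ) • iota c (((m : ℝ) + 2) • M + ((n : ℝ) - (m + 2)) • Q) - (2 : ℝ) • E c :=
    fun c => by
      rw [← hD, map_smul, iota_sum_eps_curvTrace hC]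
      module
  have hE' : ∀ c, E c = (2 : ℝ) • (iota c M + ((n : ℝ) - (m + 2)) • ν c) := fun c => by
    have h := hEX c
    rw [hN0, map_zero, add_zero] at h
    rw [show iota c M + ((n : ℝ) - (m + 2)) • ν c = (1 / 2 : ℝ) • E c by
      rw [h]; push_cast; module]
    module
  have hB : ∀ c, (m : ℝ) • E c - ∑ d, ∑ e, ∑ p, ∑ q,
      C d e p q • eps d (eps e (iota c (intBy (H q) (intBy (H p) σ))))
      = (2 * ((n : ℝ) - (m + 2))) • (((m : ℝ) + 2) • ν c - iota c Q) := fun c => by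
    rw [hY, hE' c]
    simp only [map_add, map_smul]
    module
  have hZ' : ∀ c, Z c = (-2 : ℝ) • (((m : ℝ) + 2) • μ c + extBy (G c) Q) := fun c => by
    have h := hZX c
    rw [hP0, map_zero, neg_zero, zero_sub] at h
    rw [show Z c = (2 : ℝ) • (1 / 2 : ℝ) • Z c by module, h]
    push_cast
    module
  set W : Fin n → Fin n → Forms n := fun a b =>
    ∑ e, ∑ q, C b e a q • eps e (intBy (H q) σ) with hW
  have hT : ∀ a b, ∑ d, ∑ e, ∑ q, C d e a q • eps d (eps e (iota b (intBy (H q) σ)))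
      = iota b (Z a) - (2 : ℝ) • W a b := sum_eps_eps_iota hC σ
  have hXX : W a b - W b a = - X a b := by
    rw [hXdef, curvAct]
    simp only [hW, ← Finset.sum_sub_distrib, ← Finset.sum_neg_distrib, forms_sub_smul, forms_neg_smul]
    refine Finset.sum_congr rfl fun e _ => Finset.sum_congr rfl fun q _ => ?_
    congr 1
    linarith [hC.bianchi a b e q, hC.skew_fst e a b q]
  have hXs : X b a = - X a b := by rw [hX, hX]; module
  have hXab := hX a b
  have hcoef : (m : ℝ) + 1 ≠ 0 := by positivity
  have hcoef' : (n : ℝ) - (m + 2) ≠ 0 := by linarith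
  have hL : ∀ a b, L a b = X a b
      + (1 / ((m : ℝ) + 1)) • ((-2 : ℝ) • (((m : ℝ) + 2) • iota b (μ a) + (G a b • Q
          - extBy (G a) (iota b Q))) - (2 : ℝ) • W a b)
      + (2 / ((m : ℝ) + 1)) • (((m : ℝ) + 2) • extBy (G a) (ν b) - extBy (G a) (iota b Q)) :=
    fun a b => by
      have h1 : (1 / (((n : ℝ) - (m + 2)) * (m + 1))) * (2 * ((n : ℝ) - (m + 2)))
          = 2 / ((m : ℝ) + 1) := by field_simp
      change X a b + (1 / ((m : ℝ) + 1)) • _ + _ • extBy (G a) ((m : ℝ) • E b - _) = _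
      rw [hT, hB, hZ', map_smul, map_smul, smul_smul, h1, map_add, map_smul, iota_extBy, map_sub,
        map_smul]
  have hW' : W a b = W b a - X a b := by
    rw [sub_eq_add_neg, ← hXX]; abel
  rw [hL, hL, hXs, hW', hXab, hG b a, ← sub_eq_zero]
  match_scalars <;> field_simp <;> ring

end Core

/-! ### Endomorphisms acting as derivations -/

/-- The derivation `A^p{}_d ε^d ι_p` of an endomorphism `A^p{}_d` (entry `A p d`). -/
def endo {n : ℕ} (A : Fin n → Fin n → ℝ) : Forms n →ₗ[ℝ] Forms n :=
  ∑ p, extBy (A p) ∘ₗ iota p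

section Derivations

variable {n : ℕ}

lemma endo_apply (A : Fin n → Fin n → ℝ) (F : Forms n) :
    endo A F = ∑ p, extBy (A p) (iota p F) := by
  simp [endo]

lemma extBy_add_left (u v : Fin n → ℝ) (F : Forms n) :
    extBy (u + v) F = extBy u F + extBy v F := by
  simp [extBy_apply, add_smul, Finset.sum_add_distrib]

lemma extBy_sub_left (u v : Fin n → ℝ) (F : Forms n) :
    extBy (u - v) F = extBy u F - extBy v F := by
  simp only [extBy_apply, Pi.sub_apply, ← Finset.sum_sub_distrib, forms_sub_smul]

lemma extBy_smul_left (r : ℝ) (v : Fin n → ℝ) (F : Forms n) :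
    extBy (r • v) F = r • extBy v F := by
  simp [extBy_apply, Finset.smul_sum, smul_smul]

lemma extBy_sum_left (w : Fin n → ℝ) (A : Fin n → Fin n → ℝ) (F : Forms n) :
    extBy (fun e => ∑ d, w d * A d e) F = ∑ d, w d • extBy (A d) F := by
  simp only [extBy_apply, Finset.sum_smul, Finset.smul_sum, smul_smul]
  rw [Finset.sum_comm]

lemma endo_sub_left (A B : Fin n → Fin n → ℝ) (F : Forms n) :
    endo (A - B) F = endo A F - endo B F := by
  simp only [endo_apply, Pi.sub_apply, ← Finset.sum_sub_distrib, extBy_sub_left]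

lemma endo_add_left (A B : Fin n → Fin n → ℝ) (F : Forms n) :
    endo (A + B) F = endo A F + endo B F := by
  simp only [endo_apply, Pi.add_apply, ← Finset.sum_add_distrib, extBy_add_left]

lemma iota_endo (b : Fin n) (A : Fin n → Fin n → ℝ) (F : Forms n) :
    iota b (endo A F) = endo A (iota b F) + intBy (fun p => A p b) F := by
  simp only [endo_apply, map_sum, iota_extBy, intBy_apply, Finset.sum_sub_distrib,
    iota_iota b _ F, map_neg, Finset.sum_neg_distrib]
  abel

lemma endo_extBy (A : Fin n → Fin n → ℝ) (v : Fin n → ℝ) (F : Forms n) :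
    endo A (extBy v F) = extBy v (endo A F) + extBy (fun e => ∑ d, v d * A d e) F := by
  simp only [endo_apply, map_sum, iota_extBy, map_sub, map_smul, Finset.sum_sub_distrib,
    extBy_sum_left, extBy_extBy v, Finset.sum_neg_distrib]
  abel

lemma endo_endo_sub (A B : Fin n → Fin n → ℝ) (F : Forms n) :
    endo A (endo B F) - endo B (endo A F)
      = endo (fun p d => ∑ e, (B p e * A e d - A p e * B e d)) F := by
  have h1 : endo A (endo B F) = endo B (endo A F) - ∑ q, extBy (B q) (intBy (fun p => A p q) F)
      + endo (fun p d => ∑ e, B p e * A e d) F := by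
    rw [endo_apply B, map_sum, endo_apply B, endo_apply (fun p d => ∑ e, B p e * A e d)]
    simp only [endo_extBy, iota_endo, map_add, Finset.sum_add_distrib]
    abel
  have h2 : ∑ q, extBy (B q) (intBy (fun p => A p q) F)
      = endo (fun p d => ∑ e, A p e * B e d) F := by
    simp only [endo_apply, intBy_apply, map_sum, map_smul, extBy_sum_left]
    rw [Finset.sum_comm]
  have h3 : (fun p d => ∑ e, (B p e * A e d - A p e * B e d))
      = (fun p d => ∑ e, B p e * A e d) - (fun p d => ∑ e, A p e * B e d) := by
    funext p d; simp [Finset.sum_sub_distrib]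
  rw [h1, h2, h3, endo_sub_left]
  abel

lemma IsHomog.endo {k : ℕ} {F : Forms n} (hF : IsHomog k F) (A : Fin n → Fin n → ℝ) :
    IsHomog k (endo A F) := by
  rw [endo_apply]
  refine IsHomog.sum _ fun p _ => ?_
  rcases k with _ | k
  · have : ConformalKilling.iota p F = 0 := forms_ext fun j => by
      rw [comp_iota, hF (j + 1) (by omega), slot_zero, map_zero]
    rw [this, map_zero]; exact isHomog_zero
  · exact (hF.iota p).extBy _

lemma sum_update_eq_endo (A : Fin n → Fin n → ℝ) : ∀ (k : ℕ) (F : Forms n) (t : Fin k → Fin n),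
    ∑ i, ∑ p, A p (t i) * comp k F (Function.update t i p) = comp k (endo A F) t
  | 0, F, t => by
      simp only [Finset.univ_eq_empty, Finset.sum_empty, endo_apply, extBy_apply, map_sum, map_smul]
      simp [comp_eps_zero]
  | k + 1, F, t => by
      have h1 : comp (k + 1) (endo A F) t = comp k (iota (t 0) (endo A F)) (Fin.tail t) := by
        rw [comp_iota]; simp [slot]
      rw [h1, iota_endo, map_add, Pi.add_apply, ← sum_update_eq_endo A k (iota (t 0) F) (Fin.tail t),
        Fin.sum_univ_succ, add_comm]
      congr 1
      · refine Finset.sum_congr rfl fun i _ => Finset.sum_congr rfl fun p _ => ?_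
        rw [comp_iota]
        simp only [slot, Fin.cons_update, Fin.cons_self_tail]
        rfl
      · rw [intBy_apply, map_sum, Finset.sum_apply]
        refine Finset.sum_congr rfl fun p _ => ?_
        rw [map_smul, Pi.smul_apply, smul_eq_mul, comp_iota, slot]
        congr 2
        rw [← Fin.update_cons_zero (t 0) (Fin.tail t) p, Fin.cons_self_tail]

lemma hash_eq_neg_endo {k : ℕ} (A : Matrix (Fin n) (Fin n) ℝ) (F : Forms n) :
    hash A (comp k F) = - comp k (endo A F) := by
  funext t
  exact congrArg Neg.neg (sum_update_eq_endo A k F t)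

end Derivations

/-! ### Differentiation in coordinates -/

/-- Componentwise partial derivative of a field of forms. -/
def dForm {n : ℕ} (c : Fin n) (F : EuclideanSpace ℝ (Fin n) → Forms n)
    (y : EuclideanSpace ℝ (Fin n)) : Forms n :=
  ⟨fun k t => partialDeriv c (fun z => comp k (F z) t) y, by
    have key : ∀ (k : ℕ) (f : EuclideanSpace ℝ (Fin n) → Tensor n k), (∀ z, IsAlt (f z)) →
        IsAlt (fun t => partialDeriv c (fun z => f z t) y : Tensor n k) := by
      intro k
      induction k with
      | zero => intro _ _; trivial
      | succ k ih =>
        rcases k with _ | k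
        · intro _ _; trivial
        · intro f hf
          refine ⟨fun a => ih (fun z => slot a (f z)) fun z => (hf z).slot a, fun a b t => ?_⟩
          have : (fun z => f z (Fin.cons a (Fin.cons b t)))
              = -(fun z => f z (Fin.cons b (Fin.cons a t))) := funext fun z => (hf z).2 a b t
          simp only [this, partialDeriv, fderiv_neg]
          rfl
    exact fun k => key k _ fun z => isAlt_comp k (F z)⟩

/-- Smoothness of all components on a set. -/
def SmoothOn {n : ℕ} (U : Set (EuclideanSpace ℝ (Fin n)))
    (F : EuclideanSpace ℝ (Fin n) → Forms n) : Prop :=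
  ∀ k t, ContDiffOn ℝ ∞ (fun z => comp k (F z) t) U

section Calculus

variable {n : ℕ} {U : Set (EuclideanSpace ℝ (Fin n))} {y : EuclideanSpace ℝ (Fin n)}

lemma diffAt_of_smooth (hU : IsOpen U) (hy : y ∈ U) {f : EuclideanSpace ℝ (Fin n) → ℝ}
    (hf : ContDiffOn ℝ ∞ f U) : DifferentiableAt ℝ f y :=
  (hf.contDiffAt (hU.mem_nhds hy)).differentiableAt (by simp)

lemma partialDeriv_add (c : Fin n) {f g : EuclideanSpace ℝ (Fin n) → ℝ}
    (hf : DifferentiableAt ℝ f y) (hg : DifferentiableAt ℝ g y) :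
    partialDeriv c (fun z => f z + g z) y = partialDeriv c f y + partialDeriv c g y := by
  simp only [partialDeriv]
  rw [fderiv_fun_add hf hg]; rfl

lemma partialDeriv_sub (c : Fin n) {f g : EuclideanSpace ℝ (Fin n) → ℝ}
    (hf : DifferentiableAt ℝ f y) (hg : DifferentiableAt ℝ g y) :
    partialDeriv c (fun z => f z - g z) y = partialDeriv c f y - partialDeriv c g y := by
  simp only [partialDeriv]
  rw [fderiv_fun_sub hf hg]; rfl

lemma partialDeriv_mul (c : Fin n) {f g : EuclideanSpace ℝ (Fin n) → ℝ}
    (hf : DifferentiableAt ℝ f y) (hg : DifferentiableAt ℝ g y) :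
    partialDeriv c (fun z => f z * g z) y = partialDeriv c f y * g y + f y * partialDeriv c g y := by
  simp only [partialDeriv]
  rw [fderiv_fun_mul hf hg]
  simp only [add_apply, smul_apply, smul_eq_mul]
  ring

lemma partialDeriv_sum (c : Fin n) {ι : Type*} (s : Finset ι)
    {f : ι → EuclideanSpace ℝ (Fin n) → ℝ} (hf : ∀ i ∈ s, DifferentiableAt ℝ (f i) y) :
    partialDeriv c (fun z => ∑ i ∈ s, f i z) y = ∑ i ∈ s, partialDeriv c (f i) y := by
  simp only [partialDeriv]
  rw [fderiv_fun_sum hf]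
  simp

lemma partialDeriv_congr (hU : IsOpen U) (hy : y ∈ U) (c : Fin n)
    {f g : EuclideanSpace ℝ (Fin n) → ℝ} (h : ∀ z ∈ U, f z = g z) :
    partialDeriv c f y = partialDeriv c g y := by
  simp only [partialDeriv]
  rw [Filter.EventuallyEq.fderiv_eq (Filter.eventuallyEq_of_mem (hU.mem_nhds hy) h)]

lemma contDiffOn_partialDeriv (hU : IsOpen U) (c : Fin n) {f : EuclideanSpace ℝ (Fin n) → ℝ}
    (hf : ContDiffOn ℝ ∞ f U) : ContDiffOn ℝ ∞ (partialDeriv c f) U :=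
  (hf.fderiv_of_isOpen hU (m := ∞) (by simp)).clm_apply contDiffOn_const

lemma partialDeriv_comm (hU : IsOpen U) (hy : y ∈ U) (b c : Fin n)
    {f : EuclideanSpace ℝ (Fin n) → ℝ} (hf : ContDiffOn ℝ ∞ f U) :
    partialDeriv b (partialDeriv c f) y = partialDeriv c (partialDeriv b f) y := by
  have hf' := hf.contDiffAt (hU.mem_nhds hy)
  have hs := hf'.isSymmSndFDerivAt (by simp; exact ENat.LEInfty.out)
  have hd : DifferentiableAt ℝ (fderiv ℝ f) y :=
    (hf'.fderiv_right (m := 1) (by norm_cast)).differentiableAt (by simp)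
  have key : ∀ a e : Fin n, partialDeriv a (partialDeriv e f) y
      = fderiv ℝ (fderiv ℝ f) y (EuclideanSpace.single a 1) (EuclideanSpace.single e 1) := by
    intro a e
    change fderiv ℝ (fun z => fderiv ℝ f z (EuclideanSpace.single e 1)) y _ = _
    rw [fderiv_clm_apply hd (differentiableAt_const _)]
    simp
  rw [key, key]
  exact hs _ _

lemma comp_dForm (k : ℕ) (t : Fin k → Fin n) (c : Fin n)
    (F : EuclideanSpace ℝ (Fin n) → Forms n) :
    comp k (dForm c F y) t = partialDeriv c (fun z => comp k (F z) t) y := rfl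

lemma dForm_iota (c a : Fin n) (F : EuclideanSpace ℝ (Fin n) → Forms n) :
    dForm c (fun z => iota a (F z)) y = iota a (dForm c F y) := rfl

lemma dForm_congr (hU : IsOpen U) (hy : y ∈ U) (c : Fin n)
    {F K : EuclideanSpace ℝ (Fin n) → Forms n} (h : ∀ z ∈ U, F z = K z) :
    dForm c F y = dForm c K y := by
  refine forms_ext fun k => funext fun t => ?_
  exact partialDeriv_congr hU hy c fun z hz => by rw [h z hz]

lemma dForm_add (hU : IsOpen U) (hy : y ∈ U) (c : Fin n)
    {F K : EuclideanSpace ℝ (Fin n) → Forms n} (hF : SmoothOn U F) (hK : SmoothOn U K) :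
    dForm c (fun z => F z + K z) y = dForm c F y + dForm c K y := by
  refine forms_ext fun k => funext fun t => ?_
  exact partialDeriv_add c (diffAt_of_smooth hU hy (hF k t)) (diffAt_of_smooth hU hy (hK k t))

lemma dForm_smul (hU : IsOpen U) (hy : y ∈ U) (c : Fin n) {φ : EuclideanSpace ℝ (Fin n) → ℝ}
    {F : EuclideanSpace ℝ (Fin n) → Forms n} (hφ : ContDiffOn ℝ ∞ φ U) (hF : SmoothOn U F) :
    dForm c (fun z => φ z • F z) y = partialDeriv c φ y • F y + φ y • dForm c F y := by
  refine forms_ext fun k => funext fun t => ?_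
  exact partialDeriv_mul c (diffAt_of_smooth hU hy hφ) (diffAt_of_smooth hU hy (hF k t))

lemma dForm_sum (hU : IsOpen U) (hy : y ∈ U) (c : Fin n) {ι : Type*} (s : Finset ι)
    {F : ι → EuclideanSpace ℝ (Fin n) → Forms n} (hF : ∀ i, SmoothOn U (F i)) :
    dForm c (fun z => ∑ i ∈ s, F i z) y = ∑ i ∈ s, dForm c (F i) y := by
  refine forms_ext fun k => funext fun t => ?_
  rw [map_sum, Finset.sum_apply, comp_dForm]
  simp only [map_sum, Finset.sum_apply]
  exact partialDeriv_sum c s fun i _ => diffAt_of_smooth hU hy (hF i k t)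

lemma SmoothOn.add {F K : EuclideanSpace ℝ (Fin n) → Forms n} (hF : SmoothOn U F)
    (hK : SmoothOn U K) : SmoothOn U fun z => F z + K z :=
  fun k t => (hF k t).add (hK k t)

lemma SmoothOn.sub {F K : EuclideanSpace ℝ (Fin n) → Forms n} (hF : SmoothOn U F)
    (hK : SmoothOn U K) : SmoothOn U fun z => F z - K z :=
  fun k t => (hF k t).sub (hK k t)

lemma SmoothOn.smul {φ : EuclideanSpace ℝ (Fin n) → ℝ} {F : EuclideanSpace ℝ (Fin n) → Forms n}
    (hφ : ContDiffOn ℝ ∞ φ U) (hF : SmoothOn U F) : SmoothOn U fun z => φ z • F z :=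
  fun k t => hφ.mul (hF k t)

lemma SmoothOn.sum {ι : Type*} (s : Finset ι)
    {F : ι → EuclideanSpace ℝ (Fin n) → Forms n} (hF : ∀ i, SmoothOn U (F i)) :
    SmoothOn U fun z => ∑ i ∈ s, F i z := fun k t => by
  simp only [map_sum, Finset.sum_apply]
  exact ContDiffOn.sum fun i _ => hF i k t

lemma SmoothOn.iota {F : EuclideanSpace ℝ (Fin n) → Forms n} (hF : SmoothOn U F) (a : Fin n) :
    SmoothOn U fun z => iota a (F z) := fun k t => hF (k + 1) (Fin.cons a t)

lemma SmoothOn.dForm (hU : IsOpen U) {F : EuclideanSpace ℝ (Fin n) → Forms n} (hF : SmoothOn U F)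
    (c : Fin n) : SmoothOn U (dForm c F) := fun k t => contDiffOn_partialDeriv hU c (hF k t)

lemma comp_eps_cons (k : ℕ) (a b : Fin n) (t : Fin k → Fin n) (F : Forms n) :
    comp (k + 1) (eps a F) (Fin.cons b t)
      = (if b = a then (1 : ℝ) else 0) * comp k F t - comp k (eps a (iota b F)) t := by
  have h : comp (k + 1) (eps a F) (Fin.cons b t) = comp k (iota b (eps a F)) t := rfl
  rw [h, iota_eps]; rfl

lemma SmoothOn.eps {F : EuclideanSpace ℝ (Fin n) → Forms n} (hF : SmoothOn U F) (a : Fin n) :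
    SmoothOn U fun z => eps a (F z) := by
  intro k
  induction k generalizing F with
  | zero => exact fun t => contDiffOn_const (c := (0 : ℝ))
  | succ k ih =>
    intro t
    rw [← Fin.cons_self_tail t]
    simp only [comp_eps_cons]
    exact (contDiffOn_const.mul (hF k _)).sub (ih (hF.iota (t 0)) _)

lemma dForm_eps (hU : IsOpen U) (hy : y ∈ U) (c a : Fin n)
    {F : EuclideanSpace ℝ (Fin n) → Forms n} (hF : SmoothOn U F) :
    dForm c (fun z => eps a (F z)) y = eps a (dForm c F y) := by
  refine forms_ext fun k => ?_
  induction k generalizing F with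
  | zero => funext t; simp [comp_dForm, comp_eps_zero, partialDeriv]
  | succ k ih =>
    funext t
    rw [← Fin.cons_self_tail t, comp_dForm, comp_eps_cons]
    simp only [comp_eps_cons]
    rw [partialDeriv_sub c (diffAt_of_smooth hU hy (contDiffOn_const.mul (hF k _)))
      (diffAt_of_smooth hU hy ((hF.iota (t 0)).eps a k _)),
      partialDeriv_mul c (differentiableAt_const _) (diffAt_of_smooth hU hy (hF k _)),
      ← comp_dForm (F := fun z => eps a (iota (t 0) (F z))), ih (hF.iota (t 0)), dForm_iota,
      comp_dForm]
    simp [partialDeriv]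

lemma SmoothOn.extBy {v : EuclideanSpace ℝ (Fin n) → Fin n → ℝ}
    {F : EuclideanSpace ℝ (Fin n) → Forms n} (hv : ∀ d, ContDiffOn ℝ ∞ (fun z => v z d) U)
    (hF : SmoothOn U F) : SmoothOn U fun z => extBy (v z) (F z) := by
  simp only [extBy_apply]
  exact SmoothOn.sum _ fun d => SmoothOn.smul (hv d) (hF.eps d)

lemma SmoothOn.intBy {v : EuclideanSpace ℝ (Fin n) → Fin n → ℝ}
    {F : EuclideanSpace ℝ (Fin n) → Forms n} (hv : ∀ d, ContDiffOn ℝ ∞ (fun z => v z d) U)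
    (hF : SmoothOn U F) : SmoothOn U fun z => intBy (v z) (F z) := by
  simp only [intBy_apply]
  exact SmoothOn.sum _ fun d => SmoothOn.smul (hv d) (hF.iota d)

lemma SmoothOn.endo {A : EuclideanSpace ℝ (Fin n) → Fin n → Fin n → ℝ}
    {F : EuclideanSpace ℝ (Fin n) → Forms n} (hA : ∀ p d, ContDiffOn ℝ ∞ (fun z => A z p d) U)
    (hF : SmoothOn U F) : SmoothOn U fun z => endo (A z) (F z) := by
  simp only [endo_apply]
  exact SmoothOn.sum _ fun p => SmoothOn.extBy (hA p) (hF.iota p)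

lemma dForm_extBy (hU : IsOpen U) (hy : y ∈ U) (c : Fin n)
    {v : EuclideanSpace ℝ (Fin n) → Fin n → ℝ} {F : EuclideanSpace ℝ (Fin n) → Forms n}
    (hv : ∀ d, ContDiffOn ℝ ∞ (fun z => v z d) U) (hF : SmoothOn U F) :
    dForm c (fun z => extBy (v z) (F z)) y
      = extBy (fun d => partialDeriv c (fun z => v z d) y) (F y) + extBy (v y) (dForm c F y) := by
  simp only [extBy_apply]
  rw [dForm_sum hU hy c _ fun d => SmoothOn.smul (hv d) (hF.eps d), ← Finset.sum_add_distrib]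
  refine Finset.sum_congr rfl fun d _ => ?_
  rw [dForm_smul hU hy c (hv d) (hF.eps d), dForm_eps hU hy c d hF]

lemma dForm_endo (hU : IsOpen U) (hy : y ∈ U) (c : Fin n)
    {A : EuclideanSpace ℝ (Fin n) → Fin n → Fin n → ℝ} {F : EuclideanSpace ℝ (Fin n) → Forms n}
    (hA : ∀ p d, ContDiffOn ℝ ∞ (fun z => A z p d) U) (hF : SmoothOn U F) :
    dForm c (fun z => endo (A z) (F z)) y
      = endo (fun p d => partialDeriv c (fun z => A z p d) y) (F y)
        + endo (A y) (dForm c F y) := by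
  simp only [endo_apply]
  rw [dForm_sum hU hy c _ fun p => SmoothOn.extBy (hA p) (hF.iota p), ← Finset.sum_add_distrib]
  refine Finset.sum_congr rfl fun p _ => ?_
  rw [dForm_extBy hU hy c (hA p) (hF.iota p), dForm_iota]

lemma dForm_comm (hU : IsOpen U) (hy : y ∈ U) (b c : Fin n)
    {F : EuclideanSpace ℝ (Fin n) → Forms n} (hF : SmoothOn U F) :
    dForm b (dForm c F) y = dForm c (dForm b F) y :=
  forms_ext fun k => funext fun t => partialDeriv_comm hU hy b c (hF k t)

/-- The integrability condition of `∇_c σ = ι_c μ + ε_c ν` for a torsion-free metric connection. -/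
theorem curvature_split (hU : IsOpen U) (hy : y ∈ U)
    {G : EuclideanSpace ℝ (Fin n) → Fin n → Fin n → ℝ}
    {Γ : Fin n → EuclideanSpace ℝ (Fin n) → Fin n → Fin n → ℝ}
    {σ μ ν : EuclideanSpace ℝ (Fin n) → Forms n}
    (hG : ∀ i j, ContDiffOn ℝ ∞ (fun z => G z i j) U)
    (hΓ : ∀ c p d, ContDiffOn ℝ ∞ (fun z => Γ c z p d) U)
    (htor : ∀ c p d, Γ c y p d = Γ d y p c)
    (hmet : ∀ c a b, partialDeriv c (fun z => G z a b) y
      = ∑ d, G y a d * Γ c y d b + ∑ d, G y b d * Γ c y d a)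
    (hσ : SmoothOn U σ) (hμ : SmoothOn U μ) (hν : SmoothOn U ν)
    (h : ∀ z ∈ U, ∀ c, dForm c σ z = endo (Γ c z) (σ z) + (iota c (μ z) + extBy (G z c) (ν z)))
    (b c : Fin n) :
    - endo (fun p d => partialDeriv b (fun z => Γ c z p d) y - partialDeriv c (fun z => Γ b z p d) y
        + ∑ e, (Γ b y p e * Γ c y e d - Γ c y p e * Γ b y e d)) (σ y)
      = iota c (dForm b μ y - endo (Γ b y) (μ y)) - iota b (dForm c μ y - endo (Γ c y) (μ y))
        + (extBy (G y c) (dForm b ν y - endo (Γ b y) (ν y))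
          - extBy (G y b) (dForm c ν y - endo (Γ c y) (ν y))) := by
  have hd : ∀ b c, dForm b (dForm c σ) y
      = endo (fun p d => partialDeriv b (fun z => Γ c z p d) y) (σ y)
        + endo (Γ c y) (endo (Γ b y) (σ y))
        + (iota b (endo (Γ c y) (μ y)) - intBy (fun p => Γ c y p b) (μ y))
        + (extBy (G y b) (endo (Γ c y) (ν y)) + extBy (fun e => ∑ d, G y b d * Γ c y d e) (ν y))
        + (iota c (dForm b μ y)
          + ((extBy (fun e => ∑ d, G y c d * Γ b y d e) (ν y)
            + extBy (fun e => ∑ d, G y e d * Γ b y d c) (ν y)) + extBy (G y c) (dForm b ν y))) := by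
    intro b c
    rw [dForm_congr hU hy b fun z hz => h z hz c,
      dForm_add hU hy b (SmoothOn.endo (hΓ c) hσ) ((hμ.iota c).add (SmoothOn.extBy (hG c) hν)),
      dForm_add hU hy b (hμ.iota c) (SmoothOn.extBy (hG c) hν),
      dForm_endo hU hy b (hΓ c) hσ, dForm_extBy hU hy b (hG c) hν, dForm_iota, h y hy b,
      ← extBy_add_left, map_add, map_add, endo_extBy, iota_endo]
    have : (fun d => partialDeriv b (fun z => G z c d) y)
        = (fun e => ∑ d, G y c d * Γ b y d e) + fun e => ∑ d, G y e d * Γ b y d c := by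
      funext e; exact hmet b c e
    rw [this]
    abel
  have hR : endo (fun p d => partialDeriv b (fun z => Γ c z p d) y
        - partialDeriv c (fun z => Γ b z p d) y
        + ∑ e, (Γ b y p e * Γ c y e d - Γ c y p e * Γ b y e d)) (σ y)
      = endo (fun p d => partialDeriv b (fun z => Γ c z p d) y) (σ y)
        - endo (fun p d => partialDeriv c (fun z => Γ b z p d) y) (σ y)
        + (endo (Γ c y) (endo (Γ b y) (σ y)) - endo (Γ b y) (endo (Γ c y) (σ y))) := by
    rw [endo_endo_sub, ← endo_sub_left, ← endo_add_left]
    rfl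
  have h0 := dForm_comm hU hy b c hσ
  rw [hd b c, hd c b] at h0
  have e1 : (fun p => Γ c y p b) = fun p => Γ b y p c := funext fun p => htor c p b
  have e2 : (fun e => ∑ d, G y e d * Γ b y d c) = fun e => ∑ d, G y e d * Γ c y d b :=
    funext fun e => Finset.sum_congr rfl fun d _ => by rw [htor b d c]
  rw [e1, e2, ← sub_eq_zero] at h0
  rw [hR, ← sub_eq_zero, ← neg_eq_zero, ← h0]
  simp only [map_sub]
  abel

end Calculus

/-! ### The Levi-Civita connection and its curvature -/

/-- Smooth metric coefficients of a nondegenerate symmetric bilinear form on an open set. -/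
structure IsMetricOn {n : ℕ} (U : Set (EuclideanSpace ℝ (Fin n)))
    (G : EuclideanSpace ℝ (Fin n) → Matrix (Fin n) (Fin n) ℝ) : Prop where
  smooth : ∀ i j, ContDiffOn ℝ ∞ (fun z => G z i j) U
  symm : ∀ z, ∀ i j, G z i j = G z j i
  det_ne_zero : ∀ z ∈ U, (G z).det ≠ 0

namespace IsMetricOn

variable {n : ℕ} {U : Set (EuclideanSpace ℝ (Fin n))} {y : EuclideanSpace ℝ (Fin n)}
  {G : EuclideanSpace ℝ (Fin n) → Matrix (Fin n) (Fin n) ℝ}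

lemma inv_mul (hG : IsMetricOn U G) (hy : y ∈ U) (i j : Fin n) :
    ∑ d, (G y)⁻¹ i d * G y d j = if i = j then 1 else 0 := by
  rw [← Matrix.mul_apply, Matrix.nonsing_inv_mul _ (isUnit_iff_ne_zero.2 (hG.det_ne_zero y hy)),
    Matrix.one_apply]

lemma mul_inv (hG : IsMetricOn U G) (hy : y ∈ U) (i j : Fin n) :
    ∑ d, G y i d * (G y)⁻¹ d j = if i = j then 1 else 0 := by
  rw [← Matrix.mul_apply, Matrix.mul_nonsing_inv _ (isUnit_iff_ne_zero.2 (hG.det_ne_zero y hy)),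
    Matrix.one_apply]

lemma inv_symm (hG : IsMetricOn U G) (i j : Fin n) : (G y)⁻¹ i j = (G y)⁻¹ j i := by
  have h : (G y).transpose = G y := Matrix.ext fun i j => hG.symm y j i
  have h2 := Matrix.transpose_nonsing_inv (G y)
  rw [h] at h2
  exact congrFun (congrFun h2 j) i

lemma _root_.ConformalKilling.contDiffOn_det {A : EuclideanSpace ℝ (Fin n) → Matrix (Fin n) (Fin n) ℝ}
    (hA : ∀ i j, ContDiffOn ℝ ∞ (fun z => A z i j) U) :
    ContDiffOn ℝ ∞ (fun z => (A z).det) U := by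
  simp only [Matrix.det_apply]
  refine ContDiffOn.sum fun s _ => ContDiffOn.const_smul _ ?_
  exact contDiffOn_prod fun i _ => hA _ _

lemma smooth_inv (hG : IsMetricOn U G) (i j : Fin n) :
    ContDiffOn ℝ ∞ (fun z => (G z)⁻¹ i j) U := by
  have h : ∀ z, (G z)⁻¹ i j = ((G z).det)⁻¹ * ((G z).updateRow j (Pi.single i 1)).det := fun z => by
    rw [Matrix.inv_def, Matrix.smul_apply, Matrix.adjugate_apply, Ring.inverse_eq_inv', smul_eq_mul]
  simp only [h]
  refine ((contDiffOn_det hG.smooth).inv fun z hz => hG.det_ne_zero z hz).mul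
    (contDiffOn_det fun a b => ?_)
  by_cases hab : a = j
  · subst hab
    simp only [Matrix.updateRow_self]
    exact contDiffOn_const
  · simp only [Matrix.updateRow_ne hab]
    exact hG.smooth a b

lemma smooth_christoffel (hU : IsOpen U) (hG : IsMetricOn U G) (c a b : Fin n) :
    ContDiffOn ℝ ∞ (christoffel G c a b) U :=
  contDiffOn_const.mul (ContDiffOn.sum fun d _ => (hG.smooth_inv c d).mul
    (((contDiffOn_partialDeriv hU a (hG.smooth b d)).add
      (contDiffOn_partialDeriv hU b (hG.smooth a d))).sub
      (contDiffOn_partialDeriv hU d (hG.smooth a b))))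

lemma fun_symm (hG : IsMetricOn U G) (a b : Fin n) : (fun z => G z a b) = fun z => G z b a :=
  funext fun z => hG.symm z a b

lemma christoffel_symm (hG : IsMetricOn U G) (c a b : Fin n) :
    christoffel G c a b y = christoffel G c b a y := by
  simp only [christoffel, hG.fun_symm a b]
  congr 1
  exact Finset.sum_congr rfl fun d _ => by ring

lemma lower_christoffel (hG : IsMetricOn U G) (hy : y ∈ U) (e a b : Fin n) :
    ∑ c, G y e c * christoffel G c a b y = (1 / 2) *
      (partialDeriv a (fun z => G z b e) y + partialDeriv b (fun z => G z a e) y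
        - partialDeriv e (fun z => G z a b) y) := by
  set K : Fin n → ℝ := fun d => partialDeriv a (fun z => G z b d) y
    + partialDeriv b (fun z => G z a d) y - partialDeriv d (fun z => G z a b) y with hK
  have h : ∑ c, G y e c * christoffel G c a b y
      = (1 / 2) * ∑ d, (∑ c, G y e c * (G y)⁻¹ c d) * K d := by
    simp only [christoffel, Finset.mul_sum, Finset.sum_mul]
    rw [Finset.sum_comm]
    exact Finset.sum_congr rfl fun d _ => Finset.sum_congr rfl fun c _ => by simp only [hK]; ring
  rw [h]
  simp [hG.mul_inv hy, hK]

lemma metric_compat (hG : IsMetricOn U G) (hy : y ∈ U) (c a b : Fin n) :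
    partialDeriv c (fun z => G z a b) y
      = ∑ d, G y a d * christoffel G d c b y + ∑ d, G y b d * christoffel G d c a y := by
  rw [hG.lower_christoffel hy, hG.lower_christoffel hy, hG.fun_symm b a, hG.fun_symm c a,
    hG.fun_symm c b]
  ring

lemma riemannUp_skew (a b c d : Fin n) : riemannUp G a b c d y = - riemannUp G b a c d y := by
  have h : ∑ e, (christoffel G c a e y * christoffel G e b d y
        - christoffel G c b e y * christoffel G e a d y)
      = - ∑ e, (christoffel G c b e y * christoffel G e a d y
        - christoffel G c a e y * christoffel G e b d y) := by
    rw [← Finset.sum_neg_distrib]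
    exact Finset.sum_congr rfl fun e _ => by ring
  simp only [riemannUp, h]
  ring

lemma riemannUp_bianchi (hG : IsMetricOn U G) (a b d c : Fin n) :
    riemannUp G a b c d y + riemannUp G b d c a y + riemannUp G d a c b y = 0 := by
  have hs : ∀ a b, christoffel G c a b = christoffel G c b a :=
    fun a b => funext fun z => hG.christoffel_symm c a b
  have hs' : ∀ e a b, christoffel G e a b y = christoffel G e b a y :=
    fun e a b => hG.christoffel_symm e a b
  have h : ∑ e, (christoffel G c a e y * christoffel G e b d y
        - christoffel G c b e y * christoffel G e a d y)
      + ∑ e, (christoffel G c b e y * christoffel G e d a y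
        - christoffel G c d e y * christoffel G e b a y)
      + ∑ e, (christoffel G c d e y * christoffel G e a b y
        - christoffel G c a e y * christoffel G e d b y) = 0 := by
    rw [← Finset.sum_add_distrib, ← Finset.sum_add_distrib]
    refine Finset.sum_eq_zero fun e _ => ?_
    rw [hs' e d b, hs' e d a, hs' e b a]
    ring
  simp only [riemannUp]
  rw [hs d b, hs d a, hs b a]
  linarith

lemma riemann_skew_fst (a b c d : Fin n) : riemann G a b c d y = - riemann G b a c d y := by
  rw [riemann, riemann, ← Finset.sum_neg_distrib]
  exact Finset.sum_congr rfl fun e _ => by rw [riemannUp_skew]; ring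

lemma riemann_bianchi (hG : IsMetricOn U G) (a b c d : Fin n) :
    riemann G a b d c y + riemann G b c d a y + riemann G c a d b y = 0 := by
  simp only [riemann, ← Finset.sum_add_distrib, ← mul_add]
  exact Finset.sum_eq_zero fun e _ => by rw [hG.riemannUp_bianchi, mul_zero]

lemma riemann_skew_snd (hU : IsOpen U) (hG : IsMetricOn U G) (hy : y ∈ U) (b a e f : Fin n) :
    riemann G b a e f y = - riemann G b a f e y := by
  set S : Fin n → Fin n → Fin n → EuclideanSpace ℝ (Fin n) → ℝ :=
    fun a e f z => ∑ d, G z e d * christoffel G d a f z with hS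
  have hSs : ∀ a e f, ContDiffOn ℝ ∞ (S a e f) U := fun a e f =>
    ContDiffOn.sum fun d _ => (hG.smooth e d).mul (hG.smooth_christoffel hU d a f)
  set K : Fin n → Fin n → Fin n → Fin n → ℝ := fun b a e f =>
    ∑ d, ∑ h, G y d h * christoffel G h b e y * christoffel G d a f y with hK
  have hKs : ∀ b a e f, K b a e f = K a b f e := fun b a e f => by
    simp only [hK]
    rw [Finset.sum_comm]
    refine Finset.sum_congr rfl fun d _ => Finset.sum_congr rfl fun h _ => ?_
    rw [hG.symm y h d]; ring
  have hdS : ∀ b a e f, partialDeriv b (S a e f) y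
      = ∑ h, G y e h * (∑ d, christoffel G h b d y * christoffel G d a f y) + K b a e f
        + ∑ d, G y e d * partialDeriv b (christoffel G d a f) y := by
    intro b a e f
    have hΓ : ∀ d, DifferentiableAt ℝ (christoffel G d a f) y :=
      fun d => diffAt_of_smooth hU hy (hG.smooth_christoffel hU d a f)
    have hg : ∀ d, DifferentiableAt ℝ (fun z => G z e d) y :=
      fun d => diffAt_of_smooth hU hy (hG.smooth e d)
    have h1 : partialDeriv b (S a e f) y
        = ∑ d, (partialDeriv b (fun z => G z e d) y * christoffel G d a f y
          + G y e d * partialDeriv b (christoffel G d a f) y) :=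
      (partialDeriv_sum b Finset.univ (f := fun d z => G z e d * christoffel G d a f z)
        fun d _ => (hg d).mul (hΓ d)).trans
        (Finset.sum_congr rfl fun d _ => partialDeriv_mul b (hg d) (hΓ d))
    rw [h1]
    simp only [hG.metric_compat hy, Finset.sum_add_distrib,
      add_mul, hK, Finset.sum_mul, Finset.mul_sum]
    congr 2
    rw [Finset.sum_comm]
    exact Finset.sum_congr rfl fun d _ => Finset.sum_congr rfl fun h _ => by ring
  have hR : ∀ e f, riemann G b a e f y
      = partialDeriv b (S a e f) y - partialDeriv a (S b e f) y - K b a e f + K a b e f := by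
    intro e f
    rw [hdS, hdS]
    simp only [riemann, riemannUp, mul_add, mul_sub, Finset.sum_add_distrib, Finset.sum_sub_distrib]
    ring
  have hcomm : partialDeriv b (S a e f) y + partialDeriv b (S a f e) y
      = partialDeriv a (S b e f) y + partialDeriv a (S b f e) y := by
    have hd : ∀ b a, partialDeriv b (partialDeriv a (fun z => G z e f)) y
        = partialDeriv b (S a e f) y + partialDeriv b (S a f e) y := fun b a => by
      rw [partialDeriv_congr hU hy b (f := partialDeriv a (fun z => G z e f))
        (g := fun z => S a e f z + S a f e z) fun z hz => hG.metric_compat hz a e f]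
      exact partialDeriv_add b (diffAt_of_smooth hU hy (hSs a e f))
        (diffAt_of_smooth hU hy (hSs a f e))
    rw [← hd, ← hd, partialDeriv_comm hU hy b a (hG.smooth e f)]
  rw [hR, hR, hKs b a e f, hKs a b e f]
  linarith

lemma riemann_pair (hU : IsOpen U) (hG : IsMetricOn U G) (hy : y ∈ U) (a b c d : Fin n) :
    riemann G a b c d y = riemann G c d a b y := by
  have h1 := hG.riemann_bianchi (y := y) a b d c
  have h2 := hG.riemann_bianchi (y := y) b c a d
  have h3 := hG.riemann_bianchi (y := y) c d b a
  have h4 := hG.riemann_bianchi (y := y) d a c b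
  have e1 := riemann_skew_fst (G := G) (y := y)
  have e2 := hG.riemann_skew_snd hU hy
  linarith [e1 a b c d, e1 b c a d, e1 c a b d, e1 c d b a, e1 d b c a, e1 b c d a, e1 d a c b,
    e1 a c d b, e1 c d a b, e1 a b d c, e1 b d a c, e1 d a b c,
    e2 a b c d, e2 b c a d, e2 c a b d, e2 c d b a, e2 d b c a, e2 b c d a, e2 d a c b,
    e2 a c d b, e2 c d a b, e2 a b d c, e2 b d a c, e2 d a b c]

lemma riemannUp_eq (hG : IsMetricOn U G) (hy : y ∈ U) (a b c d : Fin n) :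
    riemannUp G a b c d y = ∑ q, (G y)⁻¹ c q * riemann G a b q d y := by
  have h : ∑ q, (G y)⁻¹ c q * riemann G a b q d y
      = ∑ e, (∑ q, (G y)⁻¹ c q * G y q e) * riemannUp G a b e d y := by
    simp only [riemann, Finset.mul_sum, Finset.sum_mul]
    rw [Finset.sum_comm]
    exact Finset.sum_congr rfl fun e _ => Finset.sum_congr rfl fun q _ => by ring
  rw [h]
  simp [hG.inv_mul hy]

lemma ricci_eq (hG : IsMetricOn U G) (hy : y ∈ U) (b d : Fin n) :
    ricci G b d y = ∑ a, ∑ c, (G y)⁻¹ a c * riemann G a b c d y :=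
  Finset.sum_congr rfl fun a _ => hG.riemannUp_eq hy a b a d

lemma ricci_symm (hU : IsOpen U) (hG : IsMetricOn U G) (hy : y ∈ U) (b d : Fin n) :
    ricci G b d y = ricci G d b y := by
  rw [hG.ricci_eq hy, hG.ricci_eq hy, Finset.sum_comm]
  refine Finset.sum_congr rfl fun a _ => Finset.sum_congr rfl fun c _ => ?_
  rw [hG.riemann_pair hU hy, hG.inv_symm]

lemma schouten_symm (hU : IsOpen U) (hG : IsMetricOn U G) (hy : y ∈ U) (a b : Fin n) :
    schouten G a b y = schouten G b a y := by
  rw [schouten, schouten, hG.ricci_symm hU hy, hG.symm]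

lemma schouten_trace (hn : 3 ≤ n) (hG : IsMetricOn U G) (hy : y ∈ U) :
    ∑ a, ∑ c, (G y)⁻¹ a c * schouten G a c y = schoutenTrace G y := by
  have h1 : ∑ a, ∑ c, (G y)⁻¹ a c * G y a c = n := by
    have : ∀ a, ∑ c, (G y)⁻¹ a c * G y a c = 1 := fun a => by
      have := hG.inv_mul hy a a
      rw [if_pos rfl] at this
      rw [← this]
      exact Finset.sum_congr rfl fun c _ => by rw [hG.symm y a c]
    simp [this]
  have h2 : ∑ a, ∑ c, (G y)⁻¹ a c * ricci G a c y
      = schoutenTrace G y * (2 * ((n : ℝ) - 1)) := by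
    rw [schoutenTrace, div_mul_cancel₀]
    have : (3 : ℝ) ≤ n := by exact_mod_cast hn
    linarith
  have h3 : ∑ a, ∑ c, (G y)⁻¹ a c * schouten G a c y
      = (∑ a, ∑ c, (G y)⁻¹ a c * ricci G a c y
        - schoutenTrace G y * ∑ a, ∑ c, (G y)⁻¹ a c * G y a c) / ((n : ℝ) - 2) := by
    simp only [schouten, Finset.mul_sum, Finset.sum_div, ← Finset.sum_sub_distrib]
    exact Finset.sum_congr rfl fun a _ => Finset.sum_congr rfl fun c _ => by ring
  have hn' : (n : ℝ) - 2 ≠ 0 := by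
    have : (3 : ℝ) ≤ n := by exact_mod_cast hn
    linarith
  rw [h3, h1, h2]
  field_simp
  ring

theorem isWeylTensor (hn : 3 ≤ n) (hU : IsOpen U) (hG : IsMetricOn U G) (hy : y ∈ U) :
    IsWeylTensor (G y)⁻¹ (weyl G y) where
  skew_fst a b c d := by
    simp only [weyl]; rw [riemann_skew_fst]; ring
  skew_snd a b c d := by
    simp only [weyl]; rw [hG.riemann_skew_snd hU hy]; ring
  bianchi a b c d := by
    have h := hG.riemann_bianchi (y := y) a b c d
    rw [hG.riemann_skew_snd hU hy a b, hG.riemann_skew_snd hU hy b c,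
      hG.riemann_skew_snd hU hy c a] at h
    have hs := hG.schouten_symm hU hy
    simp only [weyl]
    rw [hG.symm y b a, hG.symm y c a, hG.symm y c b, hs b a, hs c a, hs c b]
    linarith
  trace b d := by
    have hn' : (n : ℝ) - 2 ≠ 0 := by
      have : (3 : ℝ) ≤ n := by exact_mod_cast hn
      linarith
    have hP : ricci G b d y = ((n : ℝ) - 2) * schouten G b d y + schoutenTrace G y * G y b d := by
      rw [schouten]; field_simp; ring
    have h1 : ∑ a, ∑ c, (G y)⁻¹ a c * G y c a = n := by simp [hG.inv_mul hy]
    have h2 : ∑ a, ∑ c, (G y)⁻¹ a c * (G y c b * schouten G a d y) = schouten G b d y := by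
      simp only [← mul_assoc, ← Finset.sum_mul, hG.inv_mul hy]
      simp
    have h3 : ∑ a, ∑ c, (G y)⁻¹ a c * (G y d a * schouten G b c y) = schouten G b d y := by
      rw [Finset.sum_comm]
      have : ∀ c a, (G y)⁻¹ a c * (G y d a * schouten G b c y)
          = (G y d a * (G y)⁻¹ a c) * schouten G b c y := fun c a => by ring
      simp only [this, ← Finset.sum_mul, hG.mul_inv hy]
      simp
    have h4 : ∑ a, ∑ c, (G y)⁻¹ a c * weyl G y a b c d
        = ∑ a, ∑ c, (G y)⁻¹ a c * riemann G a b c d y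
          - ((∑ a, ∑ c, (G y)⁻¹ a c * G y c a) * schouten G b d y
            - ∑ a, ∑ c, (G y)⁻¹ a c * (G y c b * schouten G a d y))
          - (G y d b * ∑ a, ∑ c, (G y)⁻¹ a c * schouten G a c y
            - ∑ a, ∑ c, (G y)⁻¹ a c * (G y d a * schouten G b c y)) := by
      simp only [Finset.mul_sum, Finset.sum_mul, ← Finset.sum_sub_distrib]
      exact Finset.sum_congr rfl fun a _ => Finset.sum_congr rfl fun c _ => by
        simp only [weyl]; ring
    rw [h4, h1, h2, h3, ← hG.ricci_eq hy, hP, hG.schouten_trace hn hy, hG.symm y d b]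
    ring

end IsMetricOn

lemma endo_curv {n : ℕ} {H : Matrix (Fin n) (Fin n) ℝ} {C : Fin n → Fin n → Fin n → Fin n → ℝ}
    (hH : ∀ i j, H i j = H j i) (hC : ∀ b c d q, C b c q d = - C b c d q) (σ : Forms n)
    (b c : Fin n) :
    endo (fun p d => ∑ q, H p q * C b c q d) σ = - curvAct H C σ b c := by
  simp only [endo_apply, curvAct, extBy_apply, intBy_apply, map_sum, map_smul, Finset.sum_smul,
    Finset.smul_sum, smul_smul, ← Finset.sum_neg_distrib, forms_neg_smul]
  rw [Finset.sum_comm]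
  refine Finset.sum_congr rfl fun d _ => ?_
  rw [Finset.sum_comm]
  refine Finset.sum_congr rfl fun q _ => Finset.sum_congr rfl fun p _ => ?_
  rw [hC b c d q, hH p q]
  congr 1; ring

/-- The trace term in the decomposition of the curvature, absorbed into `μ` and `ν`. -/
theorem isSplit_curvAct {n : ℕ} {U : Set (EuclideanSpace ℝ (Fin n))}
    {y : EuclideanSpace ℝ (Fin n)} {G : EuclideanSpace ℝ (Fin n) → Matrix (Fin n) (Fin n) ℝ}
    (hU : IsOpen U) (hG : IsMetricOn U G) (hy : y ∈ U) (σ : Forms n) {μ ν : Fin n → Forms n}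
    (h : ∀ b c, - endo (fun p d => riemannUp G b c p d y) σ
      = iota c (μ b) - iota b (μ c) + (extBy (G y c) (ν b) - extBy (G y b) (ν c))) :
    IsSplit (G y) (curvAct (G y)⁻¹ (weyl G y) σ)
      (fun b => μ b + extBy (fun d => schouten G b d y) σ)
      (fun b => ν b + intBy (fun p => ∑ q, (G y)⁻¹ p q * schouten G b q y) σ) := by
  intro b c
  set P : Fin n → Fin n → ℝ := fun b d => schouten G b d y with hP
  set PU : Fin n → Fin n → ℝ := fun b p => ∑ q, (G y)⁻¹ p q * schouten G b q y with hPU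
  have hR : (fun p d => riemannUp G b c p d y)
      = (fun p d => ∑ q, (G y)⁻¹ p q * weyl G y b c q d)
        + ((fun p d => (if p = b then (1 : ℝ) else 0) * P c d)
          - (fun p d => (if p = c then (1 : ℝ) else 0) * P b d))
        + ((fun p d => PU b p * G y c d) - (fun p d => PU c p * G y b d)) := by
    funext p d
    rw [hG.riemannUp_eq hy]
    simp only [Pi.add_apply, Pi.sub_apply, ← hG.inv_mul hy, Finset.sum_mul, hPU, hP,
      ← Finset.sum_add_distrib, ← Finset.sum_sub_distrib]
    refine Finset.sum_congr rfl fun q _ => ?_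
    rw [weyl, hG.symm y d c, hG.symm y d b]
    ring
  have e1 : endo (fun p d => ∑ q, (G y)⁻¹ p q * weyl G y b c q d) σ
      = - curvAct (G y)⁻¹ (weyl G y) σ b c :=
    endo_curv (fun _ _ => hG.inv_symm _ _) (fun b c d q => by
      simp only [weyl]; rw [hG.riemann_skew_snd hU hy]; ring) σ b c
  have e2 : ∀ (a : Fin n) (v : Fin n → ℝ),
      endo (fun p d => (if p = a then (1 : ℝ) else 0) * v d) σ = extBy v (iota a σ) :=
    fun a v => by
      have : ∀ p, (fun d => (if p = a then (1 : ℝ) else 0) * v d)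
        = (if p = a then (1 : ℝ) else 0) • v := fun p => rfl
      simp only [endo_apply, this, extBy_smul_left]
      simp
  have e3 : ∀ (u v : Fin n → ℝ), endo (fun p d => u p * v d) σ = extBy v (intBy u σ) :=
    fun u v => by
      have : ∀ p, (fun d => u p * v d) = u p • v := fun p => rfl
      simp only [endo_apply, this, extBy_smul_left, intBy_apply, map_sum, map_smul]
  have hbc := h b c
  rw [hR, endo_add_left, endo_add_left, endo_sub_left, endo_sub_left, e1, e2, e2, e3, e3] at hbc
  have hPs : P b c = P c b := hG.schouten_symm hU hy b c
  simp only [map_add, iota_extBy]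
  have h2 : curvAct (G y)⁻¹ (weyl G y) σ b c
      = iota c (μ b) - iota b (μ c) + (extBy (G y c) (ν b) - extBy (G y b) (ν c))
        + ((extBy (P c) (iota b σ) - extBy (P b) (iota c σ))
        + (extBy (G y c) (intBy (PU b) σ) - extBy (G y b) (intBy (PU c) σ))) := by
    rw [← hbc]; abel
  rw [h2, show schouten G b c y = schouten G c b y from hPs]
  abel

/-- The connection coefficients `Γ_c` as an endomorphism. -/
def connEndo {n : ℕ} (G : EuclideanSpace ℝ (Fin n) → Matrix (Fin n) (Fin n) ℝ) (c : Fin n)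
    (y : EuclideanSpace ℝ (Fin n)) : Fin n → Fin n → ℝ := fun p d => christoffel G p c d y

/-- The covariant derivative on fields of forms. -/
def nabla {n : ℕ} (G : EuclideanSpace ℝ (Fin n) → Matrix (Fin n) (Fin n) ℝ) (c : Fin n)
    (F : EuclideanSpace ℝ (Fin n) → Forms n) (y : EuclideanSpace ℝ (Fin n)) : Forms n :=
  dForm c F y - endo (connEndo G c y) (F y)

section Nabla

variable {n : ℕ} {U : Set (EuclideanSpace ℝ (Fin n))} {y : EuclideanSpace ℝ (Fin n)}
  {G : EuclideanSpace ℝ (Fin n) → Matrix (Fin n) (Fin n) ℝ}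

lemma isHomog_dForm {k : ℕ} {F : EuclideanSpace ℝ (Fin n) → Forms n} (hF : ∀ z, IsHomog k (F z))
    (c : Fin n) : IsHomog k (dForm c F y) := fun j hj => by
  funext t
  rw [comp_dForm]
  simp [hF _ j hj, partialDeriv]

lemma isHomog_nabla {k : ℕ} {F : EuclideanSpace ℝ (Fin n) → Forms n} (hF : ∀ z, IsHomog k (F z))
    (c : Fin n) : IsHomog k (nabla G c F y) :=
  (isHomog_dForm hF c).sub ((hF y).endo _)

lemma SmoothOn.nabla (hU : IsOpen U) (hG : IsMetricOn U G)
    {F : EuclideanSpace ℝ (Fin n) → Forms n} (hF : SmoothOn U F) (c : Fin n) :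
    SmoothOn U (nabla G c F) :=
  (hF.dForm hU c).sub (SmoothOn.endo (fun p d => hG.smooth_christoffel hU p c d) hF)

lemma covDeriv_comp (k : ℕ) (F : EuclideanSpace ℝ (Fin n) → Forms n) (c : Fin n) :
    slot c (covDeriv G (fun z => comp k (F z)) y) = comp k (nabla G c F y) := by
  funext t
  rw [nabla, map_sub, Pi.sub_apply, ← sum_update_eq_endo]
  simp only [slot, covDeriv, Fin.cons_zero, Fin.tail_cons]
  rfl

/-- `σ` is a conformal Killing form on `U`: `∇_c σ = ι_c μ + ε_c ν` with smooth forms `μ`, `ν`. -/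
def IsCKOn (U : Set (EuclideanSpace ℝ (Fin n)))
    (G : EuclideanSpace ℝ (Fin n) → Matrix (Fin n) (Fin n) ℝ) (m : ℕ)
    (σ : EuclideanSpace ℝ (Fin n) → Forms n) : Prop :=
  ∃ μ ν : EuclideanSpace ℝ (Fin n) → Forms n, SmoothOn U μ ∧ SmoothOn U ν ∧
    (∀ z, IsHomog (m + 3) (μ z)) ∧ (∀ z, IsHomog (m + 1) (ν z)) ∧
    ∀ z ∈ U, ∀ c, nabla G c σ z = iota c (μ z) + extBy (G z c) (ν z)

theorem IsCKOn.isSplit (hU : IsOpen U) (hG : IsMetricOn U G) (hy : y ∈ U) {m : ℕ}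
    {σ : EuclideanSpace ℝ (Fin n) → Forms n} (hσs : SmoothOn U σ)
    (hσh : ∀ z, IsHomog (m + 2) (σ z)) (hσ : IsCKOn U G m σ) :
    ∃ μ ν : Fin n → Forms n, (∀ b, IsHomog (m + 3) (μ b)) ∧ (∀ b, IsHomog (m + 1) (ν b)) ∧
      IsSplit (G y) (curvAct (G y)⁻¹ (weyl G y) (σ y)) μ ν := by
  obtain ⟨μ, ν, hμs, hνs, hμ, hν, h⟩ := hσ
  refine ⟨_, _, fun b => ?_, fun b => ?_, isSplit_curvAct hU hG hy (σ y)
    (curvature_split (Γ := connEndo G) (σ := σ) (μ := μ) (ν := ν) hU hy hG.smooth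
      (fun c p d => hG.smooth_christoffel hU p c d) (fun c p d => hG.christoffel_symm p c d)
      (fun c a b => hG.metric_compat hy c a b) hσs hμs hνs fun z hz c => ?_)⟩
  · exact (isHomog_nabla (G := G) hμ b).add ((hσh y).extBy _)
  · exact (isHomog_nabla (G := G) hν b).add ((hσh y).intBy _)
  · rw [← h z hz c, nabla]; abel

end Nabla

/-! ### Skew-symmetrisation -/

section Skew

open Equiv

variable {n : ℕ}

lemma IsAlt.swap_adjacent : ∀ {k : ℕ} {f : Tensor n (k + 1)}, IsAlt f → ∀ (i : Fin k)
    (t : Fin (k + 1) → Fin n), f (t ∘ swap i.castSucc i.succ) = - f t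
  | 0, _, _, i, _ => i.elim0
  | k + 1, f, hf, i, t => by
      rw [← Fin.cons_self_tail t]
      refine Fin.cases ?_ (fun j => ?_) i
      · rw [← Fin.cons_self_tail (Fin.tail t)]
        rw [hf.2 (t 0) (Fin.tail t 0), neg_neg]
        congr 1
        funext l
        refine Fin.cases ?_ (fun l => ?_) l
        · simp; rfl
        · refine Fin.cases ?_ (fun l => ?_) l
          · simp
          · simp only [Function.comp_apply, Fin.cons_succ, Fin.castSucc_zero]
            rw [swap_apply_of_ne_of_ne (Fin.succ_ne_zero _) (by simp [Fin.ext_iff])]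
            rfl
      · have h := (hf.slot (t 0)).swap_adjacent j (Fin.tail t)
        simp only [ConformalKilling.slot] at h
        rw [← h]
        congr 1
        funext l
        refine Fin.cases ?_ (fun l => ?_) l
        · simp only [Function.comp_apply, Fin.cons_zero]
          rw [swap_apply_of_ne_of_ne (by simp [Fin.ext_iff]) (Fin.succ_ne_zero _).symm]
          simp
        · simp only [Function.comp_apply, Fin.cons_succ, ← Fin.succ_castSucc]
          rw [(Fin.succ_injective _).swap_apply]
          rfl

lemma IsAlt.comp_perm : ∀ {k : ℕ} {f : Tensor n k}, IsAlt f → ∀ (π : Perm (Fin k))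
    (t : Fin k → Fin n), f (t ∘ π) = ((Perm.sign π : ℤ) : ℝ) * f t
  | 0, f, _, π, t => by
      rw [Subsingleton.elim π 1]; simp
  | k + 1, f, hf, π, t => by
      have hπ : π ∈ Submonoid.closure (Set.range fun i : Fin k => swap i.castSucc i.succ) := by
        rw [Perm.mclosure_swap_castSucc_succ]; trivial
      induction hπ using Submonoid.closure_induction generalizing t with
      | mem π hπ =>
        obtain ⟨i, rfl⟩ := hπ
        rw [hf.swap_adjacent, Perm.sign_swap (Fin.castSucc_lt_succ).ne]
        simp
      | one => simp
      | mul π ρ _ _ hπ hρ =>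
        have : t ∘ ⇑(π * ρ) = (t ∘ π) ∘ ρ := rfl
        rw [this, hρ, hπ, Perm.sign_mul]
        push_cast
        ring

/-- Extension of a permutation by the fixed point `0`. -/
def consPerm {k : ℕ} (π : Perm (Fin k)) : Perm (Fin (k + 1)) := Perm.decomposeFin.symm (0, π)

lemma sign_consPerm {k : ℕ} (π : Perm (Fin k)) : Perm.sign (consPerm π) = Perm.sign π := by
  simp [consPerm]

lemma cons_comp_consPerm {k : ℕ} (a : Fin n) (t : Fin k → Fin n) (π : Perm (Fin k)) :
    (Fin.cons a t : Fin (k + 1) → Fin n) ∘ consPerm π = Fin.cons a (t ∘ π) := by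
  funext l
  refine Fin.cases ?_ (fun l => ?_) l <;> simp [consPerm]

lemma isAlt_of_perm : ∀ {k : ℕ} {f : Tensor n k}, (∀ (π : Perm (Fin k)) (t : Fin k → Fin n),
    f (t ∘ π) = ((Perm.sign π : ℤ) : ℝ) * f t) → IsAlt f
  | 0, _, _ => trivial
  | 1, _, _ => trivial
  | k + 2, f, h => by
      refine ⟨fun a => isAlt_of_perm fun π t => ?_, fun a b t => ?_⟩
      · have := h (consPerm π) (Fin.cons a t)
        rwa [cons_comp_consPerm, sign_consPerm] at this
      · have := h (swap 0 1) (Fin.cons b (Fin.cons a t))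
        rw [Perm.sign_swap (by simp)] at this
        simp only [Units.val_neg, Units.val_one, Int.cast_neg, Int.cast_one, neg_mul, one_mul] at this
        rw [← this]
        congr 1
        funext l
        refine Fin.cases ?_ (fun l => ?_) l
        · simp
        · refine Fin.cases ?_ (fun l => ?_) l
          · simp
          · simp only [Function.comp_apply, Fin.cons_succ]
            rw [swap_apply_of_ne_of_ne (Fin.succ_ne_zero _) (by simp [Fin.ext_iff])]
            simp

lemma skewOver_univ {k : ℕ} (T : Tensor n k) (t : Fin k → Fin n) :
    skewOver Finset.univ T t
      = ((k.factorial : ℝ))⁻¹ * ∑ s : Perm (Fin k), ((Perm.sign s : ℤ) : ℝ) * T (t ∘ s) := by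
  simp [skewOver]

lemma isAlt_skewOver_univ {k : ℕ} (T : Tensor n k) : IsAlt (skewOver Finset.univ T) := by
  refine isAlt_of_perm fun π t => ?_
  rw [skewOver_univ, skewOver_univ, mul_left_comm]
  congr 1
  rw [Finset.mul_sum]
  refine Eq.trans ?_ (Equiv.sum_comp (Equiv.mulLeft π) _)
  refine Finset.sum_congr rfl fun s _ => ?_
  have h1 : t ∘ ⇑(Equiv.mulLeft π s) = (t ∘ π) ∘ s := rfl
  have h2 : ((Perm.sign π : ℤ) : ℝ) * ((Perm.sign π : ℤ) : ℝ) = 1 := by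
    rw [← Int.cast_mul, ← Units.val_mul, Int.units_mul_self]; simp
  rw [h1, Equiv.coe_mulLeft, Perm.sign_mul]
  push_cast
  rw [← mul_assoc, ← mul_assoc, h2, one_mul]

lemma IsAlt.skewOver_univ {k : ℕ} {f : Tensor n k} (hf : IsAlt f) :
    skewOver Finset.univ f = f := by
  funext t
  rw [ConformalKilling.skewOver_univ]
  have h : ∀ s : Perm (Fin k), ((Perm.sign s : ℤ) : ℝ) * f (t ∘ s) = f t := fun s => by
    rw [hf.comp_perm, ← mul_assoc, ← Int.cast_mul, ← Units.val_mul, Int.units_mul_self]; simp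
  simp only [h, Finset.sum_const, Finset.card_univ, Fintype.card_perm, Fintype.card_fin,
    nsmul_eq_mul]
  rw [inv_mul_cancel_left₀]
  exact_mod_cast k.factorial_ne_zero

lemma slot_skewOver {k : ℕ} (S : Finset (Fin k)) (T : Tensor n (k + 1)) (c : Fin n) :
    slot c (skewOver (S.map (Fin.succEmb k)) T) = skewOver S (slot c T) := by
  funext a
  simp only [slot, skewOver, Finset.card_map]
  congr 1
  symm
  refine Finset.sum_bij (fun π _ => consPerm π) (fun π hπ => ?_) (fun π _ ρ _ h => ?_)
    (fun π hπ => ?_) (fun π _ => ?_)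
  · rw [Finset.mem_filter] at hπ ⊢
    refine ⟨Finset.mem_univ _, fun i hi => ?_⟩
    revert hi
    refine Fin.cases (fun _ => by simp [consPerm]) (fun j hj => ?_) i
    have : j ∉ S := fun h => hj (Finset.mem_map_of_mem _ h)
    simp [consPerm, hπ.2 j this]
  · have := Perm.decomposeFin.symm.injective h
    simpa using this
  · rw [Finset.mem_filter] at hπ
    have h0 : π 0 = 0 := hπ.2 0 (by simp [Fin.succ_ne_zero])
    obtain ⟨⟨p, ρ⟩, rfl⟩ := Perm.decomposeFin.symm.surjective π
    rw [Perm.decomposeFin_symm_apply_zero] at h0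
    subst h0
    refine ⟨ρ, ?_, rfl⟩
    rw [Finset.mem_filter]
    refine ⟨Finset.mem_univ _, fun i hi => ?_⟩
    have := hπ.2 i.succ (by simpa using hi)
    simpa using this
  · rw [sign_consPerm, cons_comp_consPerm]

lemma wedge_eq_sum_swap (d : Fin n) : ∀ {k : ℕ} {F : Tensor n k}, IsAlt F →
    ∀ t : Fin (k + 1) → Fin n, wedge d F t
      = ∑ i, (if t i = d then (1 : ℝ) else 0)
        * ((if i = 0 then 1 else -1) * F (fun j => t (swap 0 i j.succ)))
  | 0, F, _, t => by
      have h : ∀ s s' : Fin 0 → Fin n, F s = F s' := fun s s' => congrArg F (Subsingleton.elim _ _)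
      rw [Fin.sum_univ_succ]
      simp [wedge, h _ (Fin.tail t)]
  | k + 1, F, hF, t => by
      rw [Fin.sum_univ_succ]
      have h1 : wedge d F t = (if t 0 = d then (1 : ℝ) else 0) * F (Fin.tail t)
          - wedge d (slot (t 0) F) (Fin.tail t) := by simp [wedge]
      rw [h1, wedge_eq_sum_swap d (hF.slot (t 0)), sub_eq_add_neg, ← Finset.sum_neg_distrib]
      congr 1
      · simp only [if_true, one_mul, swap_self, Equiv.refl_apply]
        rfl
      · refine Finset.sum_congr rfl fun j _ => ?_
        rw [← mul_neg]
        congr 1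
        rw [if_neg (Fin.succ_ne_zero j)]
        by_cases hj : j = 0
        · subst hj
          rw [if_pos rfl, slot, one_mul, neg_one_mul]
          congr 2
          funext l
          refine Fin.cases ?_ (fun l => ?_) l
          · simp
          · rw [swap_apply_of_ne_of_ne (Fin.succ_ne_zero _) (by simp [Fin.ext_iff])]
            simp [Fin.tail]
        · rw [if_neg hj, slot]
          have h2 := hF.comp_perm (swap 0 j) (fun i => t (swap 0 j.succ i.succ))
          rw [Perm.sign_swap (Ne.symm hj)] at h2
          simp only [Units.val_neg, Units.val_one, Int.cast_neg, Int.cast_one] at h2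
          rw [← h2, neg_one_mul, neg_neg]
          congr 1
          funext l
          refine Fin.cases ?_ (fun i => ?_) l
          · simp
          · simp only [Fin.cons_succ, Function.comp_apply, Fin.tail]
            by_cases hi : i.succ = j
            · rw [hi, swap_apply_right, swap_apply_of_ne_of_ne (Fin.succ_ne_zero _)
                (fun h => hj (Fin.succ_injective _ h).symm)]
            · rw [swap_apply_of_ne_of_ne (Fin.succ_ne_zero _) hi,
                swap_apply_of_ne_of_ne (Fin.succ_ne_zero _) fun h => hi (Fin.succ_injective _ h)]

/-- Expansion of the skew-symmetrisation along the first index. -/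
lemma skewOver_univ_succ {k : ℕ} (T : Tensor n (k + 1)) :
    skewOver Finset.univ T
      = (1 / ((k : ℝ) + 1)) • ∑ d, wedge d (skewOver Finset.univ (slot d T)) := by
  funext t
  have h1 : ∑ s : Perm (Fin (k + 1)), ((Perm.sign s : ℤ) : ℝ) * T (t ∘ s)
      = ∑ i, ∑ ρ : Perm (Fin k), (((if i = 0 then 1 else -1) * Perm.sign ρ : ℤ) : ℝ)
          * T (Fin.cons (t i) ((fun j => t (swap 0 i j.succ)) ∘ ρ)) := by
    rw [← Equiv.sum_comp Perm.decomposeFin.symm, Fintype.sum_prod_type]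
    refine Finset.sum_congr rfl fun i _ => Finset.sum_congr rfl fun ρ _ => ?_
    rw [Perm.decomposeFin.symm_sign]
    congr 2
    · split_ifs <;> simp
    · funext l
      refine Fin.cases ?_ (fun l => ?_) l <;> simp
  have h2 : (∑ d, wedge d (skewOver Finset.univ (slot d T))) t
      = ∑ i, (if i = 0 then 1 else -1) *
          skewOver Finset.univ (slot (t i) T) (fun j => t (swap 0 i j.succ)) := by
    rw [Finset.sum_apply]
    simp only [wedge_eq_sum_swap _ (isAlt_skewOver_univ _)]
    rw [Finset.sum_comm]
    exact Finset.sum_congr rfl fun i _ => by simp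
  rw [skewOver_univ, h1, Pi.smul_apply, h2, smul_eq_mul, Finset.mul_sum, Finset.mul_sum]
  refine Finset.sum_congr rfl fun i _ => ?_
  rw [skewOver_univ, Nat.factorial_succ]
  push_cast
  have hk : ((k : ℝ) + 1) ≠ 0 := by positivity
  have hf : (k.factorial : ℝ) ≠ 0 := by exact_mod_cast k.factorial_ne_zero
  rw [mul_left_comm (if i = 0 then (1 : ℝ) else -1), ← mul_assoc, mul_inv, one_div]
  congr 1
  rw [Finset.mul_sum]
  refine Finset.sum_congr rfl fun ρ _ => ?_
  rw [slot]
  split_ifs <;> simp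

end Skew

/-! ### The conformal Killing equation and its conformal invariance -/

section CKE

variable {n : ℕ} {U : Set (EuclideanSpace ℝ (Fin n))} {y : EuclideanSpace ℝ (Fin n)}

lemma filter_ne_zero_eq (k : ℕ) :
    ({i | i ≠ 0} : Finset (Fin (k + 1))) = Finset.univ.map (Fin.succEmb k) := by
  ext i
  refine Fin.cases ?_ (fun i => ?_) i <;> simp [Fin.succ_ne_zero]

/-- A tensor `T_{c a¹…aᵏ}` skew in `a¹…aᵏ` whose Cartan part vanishes. -/
lemma eq_of_cartanProj_eq_zero {m : ℕ} (G : Matrix (Fin n) (Fin n) ℝ)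
    (T : Tensor n (m + 3)) (S : Fin n → Forms n) (hS : ∀ c, IsHomog (m + 2) (S c))
    (hT : ∀ c, slot c T = comp (m + 2) (S c)) (h : cartanProj G T = 0) (c : Fin n) :
    S c = iota c ((1 / ((m : ℝ) + 3)) • ∑ d, eps d (S d))
      + extBy (G c) ((1 / ((n : ℝ) - (m + 2) + 1)) • ∑ p, intBy (G⁻¹ p) (S p)) := by
  set μ := (1 / ((m : ℝ) + 3)) • ∑ d, eps d (S d) with hμ
  set ν := ∑ p, intBy (G⁻¹ p) (S p) with hν
  have hμh : IsHomog (m + 3) μ := (IsHomog.sum _ fun d _ => (hS d).eps d).smul _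
  have hνh : IsHomog (m + 1) ν := IsHomog.sum _ fun p _ => (hS p).intBy _
  refine (hS c).ext ((hμh.iota c).add ((hνh.smul _).extBy _)) ?_
  have h1 : skewOver Finset.univ T = comp (m + 3) μ := by
    rw [skewOver_univ_succ, hμ, map_smul, map_sum]
    push_cast
    rw [show (m : ℝ) + 2 + 1 = m + 3 by ring]
    congr 1
    refine Finset.sum_congr rfl fun d _ => ?_
    rw [hT, (isAlt_comp _ _).skewOver_univ, comp_eps_succ]
  have h2 : slot c (skewOver {i | i ≠ 0} (fun t => G (t 0) (t 1) *
        ∑ p, ∑ q, G⁻¹ p q * T (Fin.cons p (Fin.cons q (Fin.tail (Fin.tail t))))))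
      = (1 / ((m : ℝ) + 2)) • comp (m + 2) (extBy (G c) ν) := by
    rw [filter_ne_zero_eq, slot_skewOver, skewOver_univ_succ, extBy_apply, map_sum]
    push_cast
    rw [show (m : ℝ) + 1 + 1 = m + 2 by ring]
    congr 1
    refine Finset.sum_congr rfl fun d _ => ?_
    rw [map_smul, comp_eps_succ, ← wedge_smul]
    congr 1
    rw [← ((isAlt_comp (m + 1) ν).smul (G c d)).skewOver_univ]
    congr 1
    funext s
    rw [Pi.smul_apply, smul_eq_mul, hν, map_sum, Finset.sum_apply]
    simp only [slot, Fin.cons_zero, Fin.tail_cons, Fin.cons_one]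
    congr 1
    refine Finset.sum_congr rfl fun p _ => ?_
    rw [intBy_apply, map_sum, Finset.sum_apply]
    refine Finset.sum_congr rfl fun q _ => ?_
    rw [map_smul, comp_iota, ← hT]
    rfl
  have h3 : T = skewOver Finset.univ T
      + (((m + 1 + 1 : ℕ) : ℝ) / ((n : ℝ) - ((m + 1 + 1 : ℕ) : ℝ) + 1)) •
        skewOver {i | i ≠ 0} (fun t => G (t 0) (t 1) *
          ∑ p, ∑ q, G⁻¹ p q * T (Fin.cons p (Fin.cons q (Fin.tail (Fin.tail t))))) := by
    have : T - skewOver Finset.univ T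
      - (((m + 1 + 1 : ℕ) : ℝ) / ((n : ℝ) - ((m + 1 + 1 : ℕ) : ℝ) + 1)) •
        skewOver {i | i ≠ 0} (fun t => G (t 0) (t 1) *
          ∑ p, ∑ q, G⁻¹ p q * T (Fin.cons p (Fin.cons q (Fin.tail (Fin.tail t))))) = 0 := h
    rw [sub_sub, sub_eq_zero] at this
    exact this
  have h4 := congrArg (slot c) h3
  rw [slot_add, slot_smul, h2, h1, hT, smul_smul] at h4
  rw [h4, map_add, comp_iota, map_smul, map_smul]
  congr 2
  have : (m : ℝ) + 2 ≠ 0 := by positivity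
  push_cast
  rw [show (m : ℝ) + 1 + 1 = m + 2 by ring]
  field_simp

theorem isCKOn_of_cartanProj {G : EuclideanSpace ℝ (Fin n) → Matrix (Fin n) (Fin n) ℝ} {m : ℕ}
    {σ : EuclideanSpace ℝ (Fin n) → Forms n} (hU : IsOpen U) (hG : IsMetricOn U G)
    (hσs : SmoothOn U σ) (hσh : ∀ z, IsHomog (m + 2) (σ z))
    (h : ∀ z ∈ U, cartanProj (G z) (covDeriv G (fun z => comp (m + 2) (σ z)) z) = 0) :
    IsCKOn U G m σ := by
  have hN : ∀ c, SmoothOn U (nabla G c σ) := fun c => hσs.nabla hU hG c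
  have hNh : ∀ c z, IsHomog (m + 2) (nabla G c σ z) := fun c z => isHomog_nabla hσh c
  refine ⟨fun z => (1 / ((m : ℝ) + 3)) • ∑ d, eps d (nabla G d σ z),
    fun z => (1 / ((n : ℝ) - (m + 2) + 1)) • ∑ p, intBy ((G z)⁻¹ p) (nabla G p σ z),
    SmoothOn.smul contDiffOn_const (SmoothOn.sum _ fun d => (hN d).eps d),
    SmoothOn.smul contDiffOn_const
      (SmoothOn.sum _ fun p => SmoothOn.intBy (fun d => hG.smooth_inv p d) (hN p)),
    fun z => (IsHomog.sum _ fun d _ => (hNh d z).eps d).smul _,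
    fun z => (IsHomog.sum _ fun p _ => (hNh p z).intBy _).smul _, fun z hz c => ?_⟩
  exact eq_of_cartanProj_eq_zero (G z) _ (fun c => nabla G c σ z) (fun c => hNh c z)
    (fun c => covDeriv_comp (m + 2) σ c) (h z hz) c

lemma partialDeriv_exp (c : Fin n) (r : ℝ) {u : EuclideanSpace ℝ (Fin n) → ℝ}
    (hu : DifferentiableAt ℝ u y) : partialDeriv c (fun z => Real.exp (r * u z)) y
      = r * partialDeriv c u y * Real.exp (r * u y) := by
  simp only [partialDeriv]
  have h := ((hu.hasFDerivAt.const_mul r).exp).fderiv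
  rw [h]
  simp only [smul_apply, smul_eq_mul]
  ring

lemma contDiffOn_exp (r : ℝ) {u : EuclideanSpace ℝ (Fin n) → ℝ} (hu : ContDiffOn ℝ ∞ u U) :
    ContDiffOn ℝ ∞ (fun z => Real.exp (r * u z)) U :=
  (contDiffOn_const.mul hu).exp

/-- Change of the Christoffel symbols under a conformal rescaling. -/
lemma christoffel_rescale {G G' : EuclideanSpace ℝ (Fin n) → Matrix (Fin n) (Fin n) ℝ}
    {u : EuclideanSpace ℝ (Fin n) → ℝ} (hU : IsOpen U) (hG : IsMetricOn U G)
    (hu : ContDiffOn ℝ ∞ u U) (hG' : ∀ z, G' z = Real.exp (2 * u z) • G z) (hy : y ∈ U)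
    (c a b : Fin n) : christoffel G' c a b y = christoffel G c a b y
      + partialDeriv a u y * (if c = b then 1 else 0)
      + partialDeriv b u y * (if c = a then 1 else 0)
      - (∑ d, (G y)⁻¹ c d * partialDeriv d u y) * G y a b := by
  have hud := diffAt_of_smooth hU hy hu
  have hed := diffAt_of_smooth hU hy (contDiffOn_exp 2 hu)
  have hgd : ∀ i j, DifferentiableAt ℝ (fun z => G z i j) y :=
    fun i j => diffAt_of_smooth hU hy (hG.smooth i j)
  have h1 : ∀ e i j, partialDeriv e (fun z => G' z i j) y
      = Real.exp (2 * u y) * (2 * partialDeriv e u y * G y i j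
        + partialDeriv e (fun z => G z i j) y) := fun e i j => by
    have : (fun z => G' z i j) = fun z => Real.exp (2 * u z) * G z i j := by
      funext z; rw [hG']; rfl
    rw [this, partialDeriv_mul e hed (hgd i j), partialDeriv_exp e 2 hud]
    ring
  have hne : Real.exp (2 * u y) ≠ 0 := Real.exp_ne_zero _
  have h2 : (G' y)⁻¹ = (Real.exp (2 * u y))⁻¹ • (G y)⁻¹ := by
    refine Matrix.inv_eq_left_inv ?_
    rw [hG', Matrix.smul_mul, Matrix.mul_smul, smul_smul, inv_mul_cancel₀ hne, one_smul,
      Matrix.nonsing_inv_mul _ (isUnit_iff_ne_zero.2 (hG.det_ne_zero y hy))]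
  have h3 : christoffel G' c a b y = christoffel G c a b y
      + (partialDeriv a u y * (∑ d, (G y)⁻¹ c d * G y d b)
      + partialDeriv b u y * (∑ d, (G y)⁻¹ c d * G y d a)
      - (∑ d, (G y)⁻¹ c d * partialDeriv d u y) * G y a b) := by
    simp only [christoffel, h1, h2, Finset.mul_sum, Finset.sum_mul, ← Finset.sum_add_distrib,
      ← Finset.sum_sub_distrib]
    refine Finset.sum_congr rfl fun d _ => ?_
    rw [Matrix.smul_apply, smul_eq_mul, hG.symm y b d, hG.symm y a d]
    field_simp
    ring
  rw [h3, hG.inv_mul hy, hG.inv_mul hy]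
  ring

theorem IsCKOn.rescale {G G' : EuclideanSpace ℝ (Fin n) → Matrix (Fin n) (Fin n) ℝ} {m : ℕ}
    {σ σ' : EuclideanSpace ℝ (Fin n) → Forms n} {u : EuclideanSpace ℝ (Fin n) → ℝ}
    (hU : IsOpen U) (hG : IsMetricOn U G) (hu : ContDiffOn ℝ ∞ u U)
    (hG' : ∀ z, G' z = Real.exp (2 * u z) • G z)
    (hσs : SmoothOn U σ) (hσh : ∀ z, IsHomog (m + 2) (σ z))
    (hσ' : ∀ z, σ' z = Real.exp (((m : ℝ) + 3) * u z) • σ z) (hσ : IsCKOn U G m σ) :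
    IsCKOn U G' m σ' := by
  obtain ⟨μ, ν, hμs, hνs, hμ, hν, h⟩ := hσ
  set du : EuclideanSpace ℝ (Fin n) → Fin n → ℝ := fun z d => partialDeriv d u z with hdu
  set gu : EuclideanSpace ℝ (Fin n) → Fin n → ℝ :=
    fun z c => ∑ d, (G z)⁻¹ c d * partialDeriv d u z with hgu
  have hdus : ∀ d, ContDiffOn ℝ ∞ (fun z => du z d) U := fun d => contDiffOn_partialDeriv hU d hu
  have hgus : ∀ d, ContDiffOn ℝ ∞ (fun z => gu z d) U := fun c =>
    ContDiffOn.sum fun d _ => (hG.smooth_inv c d).mul (hdus d)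
  refine ⟨fun z => Real.exp (((m : ℝ) + 3) * u z) • (μ z + extBy (du z) (σ z)),
    fun z => Real.exp (((m : ℝ) + 1) * u z) • (ν z + intBy (gu z) (σ z)),
    SmoothOn.smul (contDiffOn_exp _ hu) (hμs.add (SmoothOn.extBy hdus hσs)),
    SmoothOn.smul (contDiffOn_exp _ hu) (hνs.add (SmoothOn.intBy hgus hσs)),
    fun z => ((hμ z).add ((hσh z).extBy _)).smul _,
    fun z => ((hν z).add ((hσh z).intBy _)).smul _, fun z hz c => ?_⟩
  have hud := diffAt_of_smooth hU hz hu
  have h1 : dForm c σ' z = Real.exp (((m : ℝ) + 3) * u z) •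
      ((((m : ℝ) + 3) * du z c) • σ z + dForm c σ z) := by
    rw [show σ' = fun z => Real.exp (((m : ℝ) + 3) * u z) • σ z from funext hσ',
      dForm_smul hU hz c (contDiffOn_exp _ hu) hσs, partialDeriv_exp c _ hud]
    module
  have h2 : connEndo G' c z = connEndo G c z
      + (fun p d => du z c * (if p = d then 1 else 0))
      + (fun p d => (if p = c then (1 : ℝ) else 0) * du z d)
      - (fun p d => gu z p * G z c d) := by
    funext p d
    simp only [connEndo, Pi.add_apply, Pi.sub_apply]
    rw [christoffel_rescale hU hG hu hG' hz]
    ring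
  have e1 : endo (fun p d => du z c * (if p = d then (1 : ℝ) else 0)) (σ z)
      = (((m : ℝ) + 2) * du z c) • σ z := by
    have h3 : ∀ p, extBy (fun d => du z c * (if p = d then (1 : ℝ) else 0)) (iota p (σ z))
        = du z c • eps p (iota p (σ z)) := fun p => by
      rw [extBy_apply, Finset.sum_eq_single p]
      · simp
      · intro d _ hd; simp [Ne.symm hd]
      · simp
    simp only [endo_apply, h3, ← Finset.smul_sum]
    rw [(hσh z).sum_eps_iota]
    push_cast
    module
  have e2 : endo (fun p d => (if p = c then (1 : ℝ) else 0) * du z d) (σ z)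
      = extBy (du z) (iota c (σ z)) := by
    have : ∀ p, (fun d => (if p = c then (1 : ℝ) else 0) * du z d)
      = (if p = c then (1 : ℝ) else 0) • du z := fun p => rfl
    simp only [endo_apply, this, extBy_smul_left]
    simp
  have e3 : endo (fun p d => gu z p * G z c d) (σ z) = extBy (G z c) (intBy (gu z) (σ z)) := by
    have : ∀ p, (fun d => gu z p * G z c d) = gu z p • G z c := fun p => rfl
    simp only [endo_apply, this, extBy_smul_left, intBy_apply, map_sum, map_smul]
  have h4 : dForm c σ z = endo (connEndo G c z) (σ z) + (iota c (μ z) + extBy (G z c) (ν z)) := by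
    rw [← h z hz c, nabla]; abel
  have h5 : extBy (G' z c) (Real.exp (((m : ℝ) + 1) * u z) • (ν z + intBy (gu z) (σ z)))
      = Real.exp (((m : ℝ) + 3) * u z) • extBy (G z c) (ν z + intBy (gu z) (σ z)) := by
    have : G' z c = Real.exp (2 * u z) • G z c := by rw [hG']; rfl
    rw [this, extBy_smul_left, map_smul, smul_smul, ← Real.exp_add]
    congr 2
    ring
  rw [nabla, h1, h4, h2, h5, hσ' z, map_smul, map_smul, endo_sub_left,
    endo_add_left, endo_add_left, e1, e2, e3, map_add, map_add, iota_extBy]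
  module

end CKE

/-! ### The operation `C ◇ σ` in terms of exterior and interior multiplication -/

section Lozenge

variable {n : ℕ}

lemma skewOver_add {k : ℕ} (S : Finset (Fin k)) (T T' : Tensor n k) :
    skewOver S (T + T') = skewOver S T + skewOver S T' := by
  funext t
  simp only [skewOver, Pi.add_apply, mul_add, Finset.sum_add_distrib]

lemma skewOver_smul {k : ℕ} (S : Finset (Fin k)) (r : ℝ) (T : Tensor n k) :
    skewOver S (r • T) = r • skewOver S T := by
  funext t
  simp only [skewOver, Pi.smul_apply, smul_eq_mul, Finset.mul_sum]
  exact Finset.sum_congr rfl fun s _ => by ring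

lemma filter_two_le_eq (k : ℕ) : ({i | (2 : ℕ) ≤ (i : ℕ)} : Finset (Fin (k + 2)))
    = (Finset.univ.map (Fin.succEmb k)).map (Fin.succEmb (k + 1)) := by
  ext i
  refine Fin.cases ?_ (fun i => ?_) i
  · simp
  · refine Fin.cases ?_ (fun i => ?_) i
    · simp only [Finset.mem_filter, Finset.mem_univ, Finset.mem_map, true_and, Fin.coe_succEmb]
      constructor
      · intro h; simp at h
      · rintro ⟨x, ⟨z, rfl⟩, hx⟩
        exact absurd (Fin.succ_injective _ hx) (Fin.succ_ne_zero z)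
    · simp [Fin.succ_ne_zero]

lemma raiseLast_sum (G : Matrix (Fin n) (Fin n) ℝ) (hH : ∀ i j, G⁻¹ i j = G⁻¹ j i)
    (C : Fin n → Fin n → Fin n → Fin n → ℝ) (a b c : Fin n) (F : Forms n) :
    ∑ p, raiseLast G C a b c p • iota p F = ∑ q, C a b c q • intBy (G⁻¹ q) F := by
  simp only [raiseLast, intBy_apply, Finset.sum_smul, Finset.smul_sum, smul_smul]
  rw [Finset.sum_comm]
  refine Finset.sum_congr rfl fun q _ => Finset.sum_congr rfl fun p _ => ?_
  rw [hH p q, mul_comm]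

lemma raiseLastTwo_sum (G : Matrix (Fin n) (Fin n) ℝ) (hH : ∀ i j, G⁻¹ i j = G⁻¹ j i)
    (C : Fin n → Fin n → Fin n → Fin n → ℝ) (a b : Fin n) (F : Forms n) :
    ∑ p, ∑ q, raiseLastTwo G C a b p q • iota q (iota p F)
      = ∑ r, ∑ s, C a b r s • intBy (G⁻¹ s) (intBy (G⁻¹ r) F) := by
  have h1 : ∀ p, ∑ q, raiseLastTwo G C a b p q • iota q (iota p F)
      = ∑ r, G⁻¹ p r • ∑ s, C a b r s • intBy (G⁻¹ s) (iota p F) := fun p => by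
    simp only [← raiseLast_sum G hH, raiseLastTwo, Finset.sum_smul, Finset.smul_sum, smul_smul]
    rw [Finset.sum_comm]
  rw [Finset.sum_congr rfl fun p _ => h1 p, Finset.sum_comm]
  refine Finset.sum_congr rfl fun r _ => ?_
  simp only [Finset.smul_sum]
  rw [Finset.sum_comm]
  refine Finset.sum_congr rfl fun s _ => ?_
  rw [intBy_apply (G⁻¹ r), map_sum, Finset.smul_sum]
  refine Finset.sum_congr rfl fun p _ => ?_
  rw [map_smul, smul_comm, hH p r]

/-- Skew-symmetrisation of a tensor whose contractions with the first basis vector are known. -/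
lemma skewOver_univ_of_slot {k : ℕ} {T : Tensor n (k + 1)} {F : Fin n → Forms n}
    (h : ∀ d, skewOver Finset.univ (slot d T) = comp k (F d)) :
    skewOver Finset.univ T = comp (k + 1) ((1 / ((k : ℝ) + 1)) • ∑ d, eps d (F d)) := by
  rw [skewOver_univ_succ, map_smul, map_sum]
  congr 1
  exact Finset.sum_congr rfl fun d _ => by rw [h, comp_eps_succ]

lemma skewOver_univ_comp {k : ℕ} {T : Tensor n k} {F : Forms n} (h : T = comp k F) :
    skewOver Finset.univ T = comp k F := by
  rw [h, (isAlt_comp k F).skewOver_univ]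

lemma comp_sum_smul {k : ℕ} {ι : Type*} (s : Finset ι) (r : ι → ℝ) (F : ι → Forms n)
    (t : Fin k → Fin n) : comp k (∑ i ∈ s, r i • F i) t = ∑ i ∈ s, r i * comp k (F i) t := by
  simp [map_sum, Finset.sum_apply]

lemma comp_sum_sum_smul {k : ℕ} (r : Fin n → Fin n → ℝ) (F : Fin n → Fin n → Forms n)
    (t : Fin k → Fin n) :
    comp k (∑ i, ∑ j, r i j • F i j) t = ∑ i, ∑ j, r i j * comp k (F i j) t := by
  simp [map_sum, Finset.sum_apply]

lemma slot_blackLozenge {G H : Matrix (Fin n) (Fin n) ℝ} (hH : ∀ i j, G⁻¹ i j = G⁻¹ j i)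
    {C : Fin n → Fin n → Fin n → Fin n → ℝ} (hC : IsWeylTensor H C) (m : ℕ) (σ : Forms n)
    (c : Fin n) :
    slot c (blackLozenge G C (comp (m + 2) σ)) = comp (m + 1)
      ((1 / (((m : ℝ) + 2) * (m + 1))) • ((m : ℝ) • curvTrace G⁻¹ C σ c - ∑ d, ∑ e, ∑ p, ∑ q,
        C d e p q • eps d (eps e (iota c (intBy (G⁻¹ q) (intBy (G⁻¹ p) σ)))))) := by
  rcases m with _ | j
  · have h1 : ∀ d e (F : Forms n), comp 1 (eps d (eps e F)) = 0 := fun d e F => by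
      rw [comp_eps_succ, comp_eps_zero, ← zero_smul ℝ (0 : Tensor n 0), wedge_smul, zero_smul]
    have h2 : slot c (blackLozenge G C (comp (0 + 2) σ)) = 0 := rfl
    rw [h2]
    simp [h1]
  · set A : Tensor n (j + 2) := fun a => ∑ p, ∑ q, raiseLastTwo G C c (a 0) p q
      * comp (j + 3) σ (Fin.cons p (Fin.cons q (Fin.tail a))) with hA
    set B : Tensor n (j + 2) := fun a => ∑ p, ∑ q, raiseLastTwo G C (a 1) (a 0) p q
      * comp (j + 3) σ (Fin.cons p (Fin.cons q (Fin.cons c (Fin.tail (Fin.tail a))))) with hB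
    have h1 : slot c (blackLozenge G C (comp (j + 1 + 2) σ))
        = ((((j + 3 : ℕ) : ℝ) - 2) / ((j + 3 : ℕ) : ℝ)) • skewOver Finset.univ (A + B) := by
      have h0 : blackLozenge G C (comp (j + 1 + 2) σ)
        = ((((j + 3 : ℕ) : ℝ) - 2) / ((j + 3 : ℕ) : ℝ)) • skewOver {i | i ≠ 0} (fun t =>
          ∑ p, ∑ q, (raiseLastTwo G C (t 0) (t 1) p q
              * comp (j + 3) σ (Fin.cons p (Fin.cons q (Fin.tail (Fin.tail t))))
            + raiseLastTwo G C (t 2) (t 1) p q * comp (j + 3) σ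
              (Fin.cons p (Fin.cons q (Fin.cons (t 0) (Fin.tail (Fin.tail (Fin.tail t)))))))) := rfl
      rw [h0, slot_smul, filter_ne_zero_eq, slot_skewOver]
      congr 2
      funext a
      simp only [slot, hA, hB, Pi.add_apply, Finset.sum_add_distrib]
      rfl
    have h2 : skewOver Finset.univ A
        = comp (j + 2) ((1 / ((j : ℝ) + 2)) • curvTrace G⁻¹ C σ c) := by
      rw [skewOver_univ_of_slot (F := fun d =>
        ∑ r, ∑ s, C c d r s • intBy (G⁻¹ s) (intBy (G⁻¹ r) σ)) fun d => skewOver_univ_comp ?_]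
      · simp only [curvTrace, map_sum, map_smul]
        push_cast
        rw [show (j : ℝ) + 1 + 1 = j + 2 by ring]
      · rw [← raiseLastTwo_sum G hH]
        funext a
        rw [comp_sum_sum_smul]
        simp only [slot, hA, Fin.cons_zero, Fin.tail_cons]
        rfl
    have h3 : skewOver Finset.univ B
        = comp (j + 2) ((1 / ((j : ℝ) + 2)) • (1 / ((j : ℝ) + 1)) • -∑ d, ∑ e, ∑ p, ∑ q,
          C d e p q • eps d (eps e (iota c (intBy (G⁻¹ q) (intBy (G⁻¹ p) σ))))) := by
      rw [skewOver_univ_of_slot (F := fun d => (1 / ((j : ℝ) + 1)) • ∑ e, eps e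
        (iota c (∑ r, ∑ s, C e d r s • intBy (G⁻¹ s) (intBy (G⁻¹ r) σ)))) fun d =>
          skewOver_univ_of_slot fun e => skewOver_univ_comp ?_]
      · simp only [map_sum, map_smul, ← Finset.smul_sum, ← Finset.sum_neg_distrib,
          forms_neg_smul, ← hC.skew_fst]
        push_cast
        rw [show (j : ℝ) + 1 + 1 = j + 2 by ring]
      · rw [← raiseLastTwo_sum G hH, comp_iota]
        funext a
        rw [slot, slot, slot, comp_sum_sum_smul]
        simp only [hB, Fin.cons_zero, Fin.cons_one, Fin.tail_cons]
        rfl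
    rw [h1, skewOver_add, h2, h3, ← map_add, ← map_smul]
    congr 1
    have hj1 : (j : ℝ) + 1 ≠ 0 := by positivity
    have hj2 : (j : ℝ) + 2 ≠ 0 := by positivity
    have hj3 : (j : ℝ) + 3 ≠ 0 := by positivity
    have hj3' : (j : ℝ) + 1 + 2 ≠ 0 := by positivity
    have hj2' : (j : ℝ) + 1 + 1 ≠ 0 := by positivity
    push_cast
    match_scalars
    · field_simp
      ring
    · field_simp
      ring

lemma skewOver_pair_eq_zero {k : ℕ} {T : Tensor n (k + 2)}
    (h : ∀ t : Fin (k + 2) → Fin n, T (t ∘ Equiv.swap 0 1) = T t) : skewOver {0, 1} T = 0 := by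
  funext t
  rw [skewOver, Finset.sum_involution (fun s _ => s * Equiv.swap 0 1)]
  · simp
  · intro s _
    have : t ∘ ⇑(s * Equiv.swap (0 : Fin (k + 2)) 1) = (t ∘ s) ∘ Equiv.swap 0 1 := rfl
    rw [this, h, Equiv.Perm.sign_mul, Equiv.Perm.sign_swap (by simp)]
    simp
  · intro s _ _ hs
    have h1 : Equiv.swap (0 : Fin (k + 2)) 1 = 1 := by
      simpa only [mul_eq_left] using hs
    have h2 := congrArg (fun e : Equiv.Perm (Fin (k + 2)) => e 0) h1
    simp at h2
  · intro s hs
    rw [Finset.mem_filter] at hs ⊢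
    refine ⟨Finset.mem_univ _, fun i hi => ?_⟩
    have h0 : i ≠ 0 ∧ i ≠ 1 := by simpa using hi
    rw [Equiv.Perm.mul_apply, Equiv.swap_apply_of_ne_of_ne h0.1 h0.2, hs.2 i hi]
  · intro s _
    rw [mul_assoc, Equiv.swap_mul_self, mul_one]

theorem lozenge_eq_zero {G : Matrix (Fin n) (Fin n) ℝ} {m : ℕ} {σ : Forms n}
    {C : Fin n → Fin n → Fin n → Fin n → ℝ} {μ ν : Fin n → Forms n}
    (hG : ∀ i j, G i j = G j i) (hH : ∀ i j, G⁻¹ i j = G⁻¹ j i)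
    (hHG : ∀ i j, ∑ d, G⁻¹ i d * G d j = if i = j then 1 else 0) (hC : IsWeylTensor G⁻¹ C)
    (hmn : m + 2 < n) (hX : IsSplit G (curvAct G⁻¹ C σ) μ ν)
    (hμ : ∀ b, IsHomog (m + 3) (μ b)) (hν : ∀ b, IsHomog (m + 1) (ν b)) :
    lozenge G C (comp (m + 2) σ) = 0 := by
  have hcore := lozenge_core hG hH hHG hC hmn hX hμ hν
  set L : Fin n → Fin n → Forms n := fun a b =>
      curvAct G⁻¹ C σ a b
        + (1 / ((m : ℝ) + 1)) •
          ∑ d, ∑ e, ∑ q, C d e a q • eps d (eps e (iota b (intBy (G⁻¹ q) σ)))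
        + (1 / (((n : ℝ) - (m + 2)) * (m + 1))) • extBy (G a) (
            (m : ℝ) • curvTrace G⁻¹ C σ b - ∑ d, ∑ e, ∑ p, ∑ q,
              C d e p q • eps d (eps e (iota b (intBy (G⁻¹ q) (intBy (G⁻¹ p) σ))))) with hL
  set Φ : Tensor n (m + 2 + 2) := fun t =>
    (∑ p, raiseLast G C (t 0) (t 1) (Fin.tail (Fin.tail t) 0) p
        * comp (m + 2) σ (Fin.cons p (Fin.tail (Fin.tail (Fin.tail t)))))
      + (∑ p, raiseLast G C (Fin.tail (Fin.tail t) 0) (Fin.tail (Fin.tail t) 1) (t 0) p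
          * comp (m + 2) σ
            (Fin.cons p (Fin.cons (t 1) (Fin.tail (Fin.tail (Fin.tail (Fin.tail t)))))))
      + (((m + 2 : ℕ) : ℝ) / ((n : ℝ) - ((m + 2 : ℕ) : ℝ))) *
          (G (t 0) (Fin.tail (Fin.tail t) 0)
            * blackLozenge G C (comp (m + 2) σ) (Fin.cons (t 1) (Fin.tail (Fin.tail (Fin.tail t)))))
    with hΦ
  have hdef : lozenge G C (comp (m + 2) σ)
      = skewOver {0, 1} (skewOver {i | (2 : ℕ) ≤ (i : ℕ)} Φ) := rfl
  have hmain : ∀ a b, slot b (slot a (skewOver {i | (2 : ℕ) ≤ (i : ℕ)} Φ))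
      = comp (m + 2) ((1 / ((m : ℝ) + 2)) • L a b) := by
    intro a b
    rw [filter_two_le_eq, slot_skewOver, slot_skewOver]
    set A : Tensor n (m + 2) := fun t => ∑ p, raiseLast G C a b (t 0) p
      * comp (m + 2) σ (Fin.cons p (Fin.tail t)) with hA
    set B : Tensor n (m + 2) := fun t => ∑ p, raiseLast G C (t 0) (t 1) a p
      * comp (m + 2) σ (Fin.cons p (Fin.cons b (Fin.tail (Fin.tail t)))) with hB
    set D : Tensor n (m + 2) := fun t => G a (t 0)
      * blackLozenge G C (comp (m + 2) σ) (Fin.cons b (Fin.tail t)) with hD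
    have h0 : slot b (slot a Φ)
        = A + B + (((m + 2 : ℕ) : ℝ) / ((n : ℝ) - ((m + 2 : ℕ) : ℝ))) • D := by
      funext t
      simp only [slot, hΦ, hA, hB, hD, Pi.add_apply, Pi.smul_apply, smul_eq_mul]
      rfl
    have h1 : skewOver Finset.univ A
        = comp (m + 2) ((1 / ((m : ℝ) + 2)) • curvAct G⁻¹ C σ a b) := by
      rw [skewOver_univ_of_slot (F := fun d => ∑ q, C a b d q • intBy (G⁻¹ q) σ) fun d =>
        skewOver_univ_comp ?_]
      · simp only [curvAct, map_sum, map_smul]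
        push_cast
        rw [show (m : ℝ) + 1 + 1 = m + 2 by ring]
      · rw [← raiseLast_sum G hH]
        funext t
        rw [comp_sum_smul]
        simp only [slot, hA, Fin.cons_zero, Fin.tail_cons]
        rfl
    have h2 : skewOver Finset.univ B = comp (m + 2) ((1 / ((m : ℝ) + 2)) • (1 / ((m : ℝ) + 1)) •
        ∑ d, ∑ e, ∑ q, C d e a q • eps d (eps e (iota b (intBy (G⁻¹ q) σ)))) := by
      rw [skewOver_univ_of_slot (F := fun d => (1 / ((m : ℝ) + 1)) • ∑ e, eps e
        (iota b (∑ q, C d e a q • intBy (G⁻¹ q) σ))) fun d =>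
          skewOver_univ_of_slot fun e => skewOver_univ_comp ?_]
      · simp only [map_sum, map_smul, ← Finset.smul_sum]
        push_cast
        rw [show (m : ℝ) + 1 + 1 = m + 2 by ring]
      · rw [← raiseLast_sum G hH, comp_iota]
        funext t
        rw [slot, slot, slot, comp_sum_smul]
        simp only [hB, Fin.cons_zero, Fin.cons_one, Fin.tail_cons]
        rfl
    set Y := (m : ℝ) • curvTrace G⁻¹ C σ b - ∑ d, ∑ e, ∑ p, ∑ q,
      C d e p q • eps d (eps e (iota b (intBy (G⁻¹ q) (intBy (G⁻¹ p) σ)))) with hY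
    have h3 : skewOver Finset.univ D = comp (m + 2) ((1 / ((m : ℝ) + 2)) •
        (1 / (((m : ℝ) + 2) * (m + 1))) • extBy (G a) Y) := by
      rw [skewOver_univ_of_slot (F := fun d => G a d • (1 / (((m : ℝ) + 2) * (m + 1))) • Y)
        fun d => skewOver_univ_comp ?_]
      · simp only [extBy_apply, map_smul, Finset.smul_sum]
        push_cast
        rw [show (m : ℝ) + 1 + 1 = m + 2 by ring]
        congr 1
        refine Finset.sum_congr rfl fun d _ => ?_
        module
      · rw [map_smul, ← slot_blackLozenge hH hC]
        rfl
    rw [h0, skewOver_add, skewOver_add, skewOver_smul, h1, h2, h3, ← map_smul, ← map_add,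
      ← map_add]
    congr 1
    have hn0 : (n : ℝ) - (m + 2) ≠ 0 := by
      have : (m : ℝ) + 2 < n := by exact_mod_cast hmn
      linarith
    have hm1 : (m : ℝ) + 1 ≠ 0 := by positivity
    have hm2 : (m : ℝ) + 2 ≠ 0 := by positivity
    simp only [hL, ← hY]
    push_cast
    match_scalars <;> field_simp
  rw [hdef]
  refine skewOver_pair_eq_zero fun t => ?_
  have hval : ∀ t : Fin (m + 2 + 2) → Fin n, skewOver {i | (2 : ℕ) ≤ (i : ℕ)} Φ t
      = comp (m + 2) ((1 / ((m : ℝ) + 2)) • L (t 0) (t 1)) (Fin.tail (Fin.tail t)) := fun t => by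
    rw [← hmain]
    simp only [slot]
    congr 1
    funext l
    refine Fin.cases rfl (fun l => ?_) l
    refine Fin.cases rfl (fun l => rfl) l
  rw [hval, hval]
  have h1 : (t ∘ Equiv.swap 0 1) 0 = t 1 := by simp
  have h2 : (t ∘ Equiv.swap 0 1) 1 = t 0 := by simp
  have h3 : Fin.tail (Fin.tail (t ∘ Equiv.swap 0 1)) = Fin.tail (Fin.tail t) := by
    funext l
    simp only [Fin.tail, Function.comp_apply]
    rw [Equiv.swap_apply_of_ne_of_ne (Fin.succ_ne_zero _) fun h => by
      have := congrArg Fin.val h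
      simp at this]
  rw [h1, h2, h3, show L (t 1) (t 0) = L (t 0) (t 1) from hcore (t 1) (t 0)]

end Lozenge

/-! ### Orthogonality to `E(2,k)₀` -/

section Inner

open Equiv

variable {n r : ℕ}

lemma tensorInner_add (G : Matrix (Fin n) (Fin n) ℝ) (S S' T : Tensor n r) :
    tensorInner G (S + S') T = tensorInner G S T + tensorInner G S' T := by
  simp only [tensorInner, Pi.add_apply, mul_add, add_mul, Finset.sum_add_distrib]

lemma tensorInner_smul (G : Matrix (Fin n) (Fin n) ℝ) (a : ℝ) (S T : Tensor n r) :
    tensorInner G (a • S) T = a * tensorInner G S T := by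
  simp only [tensorInner, Pi.smul_apply, smul_eq_mul, Finset.mul_sum]
  exact Finset.sum_congr rfl fun s _ => Finset.sum_congr rfl fun t _ => by ring

lemma tensorInner_smul_right (G : Matrix (Fin n) (Fin n) ℝ) (a : ℝ) (S T : Tensor n r) :
    tensorInner G S (a • T) = a * tensorInner G S T := by
  simp only [tensorInner, Pi.smul_apply, smul_eq_mul, Finset.mul_sum]
  exact Finset.sum_congr rfl fun s _ => Finset.sum_congr rfl fun t _ => by ring

lemma tensorInner_sum {ι : Type*} (G : Matrix (Fin n) (Fin n) ℝ) (I : Finset ι)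
    (S : ι → Tensor n r) (T : Tensor n r) :
    tensorInner G (∑ i ∈ I, S i) T = ∑ i ∈ I, tensorInner G (S i) T := by
  simp only [tensorInner, Finset.sum_apply, Finset.mul_sum, Finset.sum_mul]
  rw [Finset.sum_comm]
  rw [Finset.sum_congr rfl fun t _ => Finset.sum_comm]
  rw [Finset.sum_comm' (s' := fun _ => Finset.univ) (t' := I) (by simp)]
  refine Finset.sum_congr rfl fun i _ => ?_
  rw [Finset.sum_comm]

lemma tensorInner_sum_right {ι : Type*} (G : Matrix (Fin n) (Fin n) ℝ) (I : Finset ι)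
    (S : Tensor n r) (T : ι → Tensor n r) :
    tensorInner G S (∑ i ∈ I, T i) = ∑ i ∈ I, tensorInner G S (T i) := by
  have hsymm : ∀ T, tensorInner G S T
      = ∑ s : Fin r → Fin n, ∑ t : Fin r → Fin n, (∏ i, G⁻¹ (s i) (t i)) * S s * T t :=
    fun _ => rfl
  simp only [hsymm, Finset.sum_apply, Finset.mul_sum]
  rw [Finset.sum_congr rfl fun s _ => Finset.sum_comm, Finset.sum_comm]

lemma tensorInner_perm (G : Matrix (Fin n) (Fin n) ℝ) (S T : Tensor n r) (π : Perm (Fin r)) :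
    tensorInner G (fun t => S (t ∘ π)) (fun t => T (t ∘ π)) = tensorInner G S T := by
  simp only [tensorInner]
  have key : ∀ f : (Fin r → Fin n) → ℝ, ∑ s : Fin r → Fin n, f (s ∘ π) = ∑ s, f s := fun f =>
    Equiv.sum_comp (Equiv.arrowCongr π.symm (Equiv.refl (Fin n))) f
  rw [← key fun s => ∑ t : Fin r → Fin n, (∏ i, G⁻¹ (s i) (t i)) * S s * T t]
  refine Finset.sum_congr rfl fun s _ => ?_
  rw [← key fun t => (∏ i, G⁻¹ ((s ∘ π) i) (t i)) * S (s ∘ π) * T t]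
  refine Finset.sum_congr rfl fun t _ => ?_
  congr 2
  exact (Equiv.prod_comp π fun i => G⁻¹ (s i) (t i)).symm

lemma tensorInner_perm_left (G : Matrix (Fin n) (Fin n) ℝ) (S T : Tensor n r) (π : Perm (Fin r)) :
    tensorInner G (fun t => S (t ∘ π)) T = tensorInner G S (fun t => T (t ∘ ⇑π⁻¹)) := by
  rw [← tensorInner_perm G S _ π]
  congr 1
  funext t
  congr 1
  funext i
  simp

/-- Tensors that are skew over `A` are orthogonal to tensors whose skew part over `A` is zero. -/
lemma tensorInner_eq_zero_of_skew (G : Matrix (Fin n) (Fin n) ℝ) (A : Finset (Fin r))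
    {S T : Tensor n r} (hS : ∀ s : Perm (Fin r), (∀ i, i ∉ A → s i = i) → ∀ t,
      S (t ∘ s) = ((Perm.sign s : ℤ) : ℝ) * S t) (hT : skewOver A T = 0) :
    tensorInner G S T = 0 := by
  have h1 : ∀ s : Perm (Fin r), (∀ i, i ∉ A → s i = i) →
      ((Perm.sign s : ℤ) : ℝ) * tensorInner G S (fun t => T (t ∘ s)) = tensorInner G S T := by
    intro s hs
    rw [← tensorInner_perm G S T s, show (fun t => S (t ∘ s)) = ((Perm.sign s : ℤ) : ℝ) • S from
      funext fun t => hS s hs t, tensorInner_smul]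
  have h2 : skewOver A T = ((A.card.factorial : ℝ))⁻¹ •
      ∑ s : Perm (Fin r) with ∀ i, i ∉ A → s i = i,
        ((Perm.sign s : ℤ) : ℝ) • fun t => T (t ∘ s) := by
    funext t
    simp [skewOver, Finset.sum_apply]
  have h3 : tensorInner G S (skewOver A T) = 0 := by
    rw [hT]; simp [tensorInner]
  rw [h2, tensorInner_smul_right, tensorInner_sum_right] at h3
  simp only [tensorInner_smul_right] at h3
  rw [Finset.sum_congr rfl fun s hs => h1 s (Finset.mem_filter.1 hs).2, Finset.sum_const,
    nsmul_eq_mul, ← mul_assoc] at h3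
  refine (mul_eq_zero.1 h3).resolve_left (mul_ne_zero (inv_ne_zero ?_) ?_)
  · exact_mod_cast A.card.factorial_ne_zero
  · rw [Nat.cast_ne_zero, ← Nat.pos_iff_ne_zero, Finset.card_pos]
    exact ⟨1, by simp⟩

lemma sum_cons_eq {k : ℕ} (f : (Fin (k + 1) → Fin n) → ℝ) :
    ∑ s, f s = ∑ a : Fin n, ∑ s : Fin k → Fin n, f (Fin.cons a s) := by
  rw [← Equiv.sum_comp (Fin.consEquiv fun _ => Fin n), Fintype.sum_prod_type]
  rfl

lemma tensorInner_metric_mul {k : ℕ} {G : Matrix (Fin n) (Fin n) ℝ}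
    (hH : ∀ i j, G⁻¹ i j = G⁻¹ j i)
    (hHG : ∀ i j, ∑ d, G⁻¹ i d * G d j = if i = j then 1 else 0)
    (h : Tensor n k) {T : Tensor n (k + 2)} (hT : IsTraceFree G T) :
    tensorInner G (fun t => G (t 0) (t 1) * h (Fin.tail (Fin.tail t))) T = 0 := by
  have hT' : ∀ t : Fin k → Fin n,
      ∑ p, ∑ q, G⁻¹ p q * T (Fin.cons p (Fin.cons q t)) = 0 := fun t => by
    rcases Nat.eq_zero_or_pos n with hn | hn
    · subst hn; simp
    · have := hT 0 1 (by simp) (Fin.cons ⟨0, hn⟩ (Fin.cons ⟨0, hn⟩ t))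
      rw [← this]
      refine Finset.sum_congr rfl fun p _ => Finset.sum_congr rfl fun q _ => ?_
      congr 2
      rw [Fin.update_cons_zero, ← Fin.succ_zero_eq_one, ← Fin.cons_update, Fin.update_cons_zero]
  have hHH : ∀ c d, ∑ a, ∑ b, G⁻¹ a c * G⁻¹ b d * G a b = G⁻¹ c d := fun c d => by
    have h1 : ∀ b, ∑ a, G⁻¹ a c * G⁻¹ b d * G a b = G⁻¹ b d * if c = b then 1 else 0 := fun b => by
      rw [← hHG, Finset.mul_sum]
      exact Finset.sum_congr rfl fun a _ => by rw [hH a c]; ring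
    rw [Finset.sum_comm, Finset.sum_congr rfl fun b _ => h1 b]
    simp
  have hfix : ∀ s t : Fin k → Fin n, ∑ a, ∑ b, ∑ c, ∑ d,
      (G⁻¹ a c * (G⁻¹ b d * ∏ i, G⁻¹ (s i) (t i))) * (G a b * h s)
        * T (Fin.cons c (Fin.cons d t)) = 0 := fun s t => by
    rw [sum_sum_sum_rotate, Finset.sum_congr rfl fun c _ => sum_sum_sum_rotate _]
    have h1 : ∀ c d, ∑ a, ∑ b, (G⁻¹ a c * (G⁻¹ b d * ∏ i, G⁻¹ (s i) (t i))) * (G a b * h s)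
        * T (Fin.cons c (Fin.cons d t))
        = ((∏ i, G⁻¹ (s i) (t i)) * h s) * (G⁻¹ c d * T (Fin.cons c (Fin.cons d t))) :=
      fun c d => by
        rw [← hHH c d]
        simp only [Finset.sum_mul, Finset.mul_sum]
        exact Finset.sum_congr rfl fun a _ => Finset.sum_congr rfl fun b _ => by ring
    simp only [h1, ← Finset.mul_sum, hT', mul_zero]
  simp only [tensorInner, sum_cons_eq (n := n), Fin.prod_univ_succ, Fin.cons_zero, Fin.cons_succ,
    Fin.cons_one, Fin.tail_cons]
  rw [sum_sum_sum_rotate]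
  refine Finset.sum_eq_zero fun s _ => ?_
  rw [Finset.sum_congr rfl fun a _ => Finset.sum_congr rfl fun b _ => sum_sum_sum_rotate _,
    sum_sum_sum_rotate]
  exact Finset.sum_eq_zero fun t _ => hfix s t

lemma skewOver_comp_perm {A : Finset (Fin r)} (T : Tensor n r) (π : Perm (Fin r))
    (hπ : ∀ i, i ∉ A → π i = i) (t : Fin r → Fin n) :
    skewOver A T (t ∘ π) = ((Perm.sign π : ℤ) : ℝ) * skewOver A T t := by
  simp only [skewOver]
  rw [mul_left_comm]
  congr 1
  rw [Finset.mul_sum]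
  refine Finset.sum_equiv (Equiv.mulLeft π) (fun s => ?_) fun s _ => ?_
  · simp only [Finset.mem_filter, Finset.mem_univ, true_and, Equiv.coe_mulLeft]
    refine forall_congr' fun i => imp_congr_right fun hi => ?_
    rw [Perm.mul_apply]
    constructor
    · intro h; rw [h, hπ i hi]
    · intro h; exact π.injective (h.trans (hπ i hi).symm)
  · have h1 : t ∘ ⇑(Equiv.mulLeft π s) = (t ∘ π) ∘ s := rfl
    have h2 : ((Perm.sign π : ℤ) : ℝ) * ((Perm.sign π : ℤ) : ℝ) = 1 := by
      rw [← Int.cast_mul, ← Units.val_mul, Int.units_mul_self]; simp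
    rw [h1, Equiv.coe_mulLeft, Perm.sign_mul]
    push_cast
    rw [← mul_assoc, ← mul_assoc, h2, one_mul]

lemma IsTraceFree.comp_perm {G : Matrix (Fin n) (Fin n) ℝ} {T : Tensor n r}
    (hT : IsTraceFree G T) (π : Perm (Fin r)) : IsTraceFree G fun t => T (t ∘ π) := by
  intro i j hij t
  have h := hT (π⁻¹ i) (π⁻¹ j) (fun h => hij (π⁻¹.injective h)) (t ∘ π)
  rw [← h]
  refine Finset.sum_congr rfl fun p _ => Finset.sum_congr rfl fun q _ => ?_
  congr 1
  change T (Function.update (Function.update t i p) j q ∘ π) = _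
  have key : ∀ (s : Fin r → Fin n) (i : Fin r) (p : Fin n),
      Function.update s i p ∘ π = Function.update (s ∘ π) (π⁻¹ i) p := fun s i p =>
    Function.update_comp_equiv s π i p
  rw [key, key]

lemma exists_perm_rotate {m : ℕ} (i : Fin (m + 2)) : ∃ π : Perm (Fin (m + 2 + 2)),
    π 0 = 1 ∧ π 1 = i.succ.succ ∧ π (0 : Fin (m + 2)).succ.succ = 0 ∧
      ∀ j : Fin (m + 1), π j.succ.succ.succ = (swap 0 i j.succ).succ.succ := by
  set π : Perm (Fin (m + 2 + 2)) :=
    consPerm (consPerm (swap 0 i)) * (swap 0 1 * swap 1 2) with hπ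
  have c0 : ∀ {k : ℕ} (ρ : Perm (Fin k)), consPerm ρ 0 = 0 := fun ρ => by simp [consPerm]
  have cs : ∀ {k : ℕ} (ρ : Perm (Fin k)) (j : Fin k), consPerm ρ j.succ = (ρ j).succ :=
    fun ρ j => by simp [consPerm]
  have two : (2 : Fin (m + 2 + 2)) = (1 : Fin (m + 2 + 1)).succ := rfl
  have h02 : (0 : Fin (m + 2 + 2)) ≠ 2 := by rw [two]; exact (Fin.succ_ne_zero _).symm
  have h12 : (1 : Fin (m + 2 + 2)) ≠ 2 := by
    rw [two, ← Fin.succ_zero_eq_one]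
    exact fun h => absurd (Fin.succ_injective _ h) (by simp)
  have p0 : π 0 = 1 := by
    have h1 : swap (1 : Fin (m + 2 + 2)) 2 0 = 0 :=
      swap_apply_of_ne_of_ne (by simp) h02
    simp only [hπ, Perm.mul_apply, h1, swap_apply_left]
    rw [← Fin.succ_zero_eq_one, cs, c0]
  have p1 : π 1 = i.succ.succ := by
    have h1 : swap (0 : Fin (m + 2 + 2)) 1 2 = 2 :=
      swap_apply_of_ne_of_ne h02.symm h12.symm
    simp only [hπ, Perm.mul_apply, swap_apply_left, h1]
    rw [show (2 : Fin (m + 2 + 2)) = (0 : Fin (m + 2)).succ.succ from rfl, cs, cs,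
      swap_apply_left]
  have p2 : π (0 : Fin (m + 2)).succ.succ = 0 := by
    have h1 : ((0 : Fin (m + 2)).succ.succ : Fin (m + 2 + 2)) = 2 := rfl
    simp only [hπ, Perm.mul_apply, h1, swap_apply_right, c0]
  have p3 : ∀ j : Fin (m + 1), π j.succ.succ.succ = (swap 0 i j.succ).succ.succ :=
    fun j => by
      have h1 : swap (1 : Fin (m + 2 + 2)) 2 j.succ.succ.succ = j.succ.succ.succ :=
        swap_apply_of_ne_of_ne (fun h => by
          have := congrArg Fin.val h
          simp at this) fun h => absurd (Fin.succ_injective _ (h.trans two)) fun h => by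
          have := congrArg Fin.val h
          simp at this
      have h2 : swap (0 : Fin (m + 2 + 2)) 1 j.succ.succ.succ = j.succ.succ.succ :=
        swap_apply_of_ne_of_ne (Fin.succ_ne_zero _) (fun h => by
          have := congrArg Fin.val h
          simp at this)
      simp only [hπ, Perm.mul_apply, h1, h2, cs]
  exact ⟨π, p0, p1, p2, p3⟩

lemma tensorInner_extBy {G : Matrix (Fin n) (Fin n) ℝ} {m : ℕ} (ν : Fin n → Forms n)
    (hH : ∀ i j, G⁻¹ i j = G⁻¹ j i)
    (hHG : ∀ i j, ∑ d, G⁻¹ i d * G d j = if i = j then 1 else 0)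
    {T : Tensor n (m + 2 + 2)} (hT : IsTraceFree G T) :
    tensorInner G (fun t =>
      comp (m + 2) (extBy (G (t 1)) (ν (t 0))) (Fin.tail (Fin.tail t))) T = 0 := by
  set K : Tensor n (m + 2 + 2) := fun t => G (t 0) (t 1) *
    (fun a : Fin (m + 2) → Fin n => comp (m + 1) (ν (a 0)) (Fin.tail a))
      (Fin.tail (Fin.tail t)) with hK
  choose π p0 p1 p2 p3 using exists_perm_rotate (m := m)
  have hS : (fun t : Fin (m + 2 + 2) → Fin n =>
      comp (m + 2) (extBy (G (t 1)) (ν (t 0))) (Fin.tail (Fin.tail t))) = ∑ i : Fin (m + 2), (if i = 0 then (1 : ℝ) else -1) • fun t =>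
      K (t ∘ π i) := by
    funext t
    rw [Finset.sum_apply]
    simp only [extBy_apply, map_sum, map_smul, Finset.sum_apply, Pi.smul_apply,
      comp_eps_succ, wedge_eq_sum_swap _ (isAlt_comp _ _), smul_eq_mul, Finset.mul_sum]
    rw [Finset.sum_comm]
    refine Finset.sum_congr rfl fun i _ => ?_
    rw [Finset.sum_eq_single (Fin.tail (Fin.tail t) i)]
    · have e : (fun j : Fin (m + 1) => Fin.tail (Fin.tail t) (swap 0 i j.succ))
          = Fin.tail (Fin.tail (Fin.tail (t ∘ π i))) := by
        funext j
        simp only [Fin.tail, Function.comp_apply, p3]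
      have e' : Fin.tail (Fin.tail (t ∘ π i)) 0 = t 0 := by
        simp only [Fin.tail, Function.comp_apply, p2]
      simp only [hK, e, e', Function.comp_apply, p0, p1, if_true, one_mul]
      simp only [Fin.tail]
      ring
    · intro d _ hd; simp [Ne.symm hd]
    · simp
  rw [hS, tensorInner_sum]
  refine Finset.sum_eq_zero fun i _ => ?_
  rw [tensorInner_smul, tensorInner_perm_left, hK]
  have hz := tensorInner_metric_mul hH hHG
    (fun a : Fin (m + 2) → Fin n => comp (m + 1) (ν (a 0)) (Fin.tail a))
    (hT.comp_perm (π i)⁻¹)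
  rw [hz, mul_zero]

theorem tensorInner_eq_zero {G : Matrix (Fin n) (Fin n) ℝ} {m : ℕ}
    {X : Fin n → Fin n → Forms n} {μ ν : Fin n → Forms n} (hH : ∀ i j, G⁻¹ i j = G⁻¹ j i)
    (hHG : ∀ i j, ∑ d, G⁻¹ i d * G d j = if i = j then 1 else 0) (hX : IsSplit G X μ ν)
    {T : Tensor n (m + 2 + 2)} (hT : IsE2k0 G T) :
    tensorInner G (fun t => comp (m + 2) (X (t 0) (t 1)) (Fin.tail (Fin.tail t))) T = 0 := by
  set S₁ : Tensor n (m + 2 + 2) := fun t => comp (m + 3) (μ (t 0)) (Fin.tail t) with hS₁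
  set S₂ : Tensor n (m + 2 + 2) := fun t =>
    comp (m + 2) (extBy (G (t 1)) (ν (t 0))) (Fin.tail (Fin.tail t)) with hS₂
  have hcons : ∀ t : Fin (m + 2 + 2) → Fin n, Fin.cons (t 1) (Fin.tail (Fin.tail t)) = Fin.tail t :=
    fun t => Fin.cons_self_tail (Fin.tail t)
  have hswap : ∀ t : Fin (m + 2 + 2) → Fin n,
      Fin.tail (Fin.tail (t ∘ swap 0 1)) = Fin.tail (Fin.tail t) := fun t => by
    funext l
    simp only [Fin.tail, Function.comp_apply]
    rw [swap_apply_of_ne_of_ne (Fin.succ_ne_zero _) fun h => by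
      have := congrArg Fin.val h
      simp at this]
  have h1 : tensorInner G S₁ T = 0 := by
    refine tensorInner_eq_zero_of_skew G {i | i ≠ 0} (fun s hs t => ?_) hT.skew_tail
    have h0 : s 0 = 0 := hs 0 (by simp)
    obtain ⟨⟨p, ρ⟩, rfl⟩ := Perm.decomposeFin.symm.surjective s
    rw [Perm.decomposeFin_symm_apply_zero] at h0
    subst h0
    have h2 : Fin.tail (t ∘ ⇑(Perm.decomposeFin.symm (0, ρ))) = Fin.tail t ∘ ρ := by
      funext l; simp [Fin.tail]
    simp only [hS₁]
    rw [h2, (isAlt_comp _ _).comp_perm]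
    simp
  have h2 : tensorInner G S₂ T = 0 := tensorInner_extBy ν hH hHG hT.traceFree
  have h3 : ∀ S : Tensor n (m + 2 + 2), tensorInner G (fun t => S (t ∘ swap 0 1)) T
      = - tensorInner G S T := fun S => by
    rw [tensorInner_perm_left]
    have : (fun t => T (t ∘ ⇑(swap (0 : Fin (m + 2 + 2)) 1)⁻¹)) = (-1 : ℝ) • T := by
      funext t
      have := skewOver_comp_perm (A := {0, 1}) T (swap 0 1) (fun i hi => by
        have h0 : i ≠ 0 ∧ i ≠ 1 := by simpa using hi
        exact swap_apply_of_ne_of_ne h0.1 h0.2) t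
      rw [hT.skew_c, Perm.sign_swap (by simp)] at this
      rw [swap_inv, this]
      simp
    rw [this, tensorInner_smul_right]
    ring
  have h4 : (fun t : Fin (m + 2 + 2) → Fin n =>
        comp (m + 2) (X (t 0) (t 1)) (Fin.tail (Fin.tail t)))
      = (S₁ + S₂) + (-1 : ℝ) • fun t => (S₁ + S₂) (t ∘ swap 0 1) := by
    funext t
    have e1 : (t ∘ swap 0 1) 0 = t 1 := by simp
    have e2 : (t ∘ swap 0 1) 1 = t 0 := by simp
    have e3 : ∀ (F : Forms n) (a : Fin n) (b : Fin (m + 2) → Fin n),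
      comp (m + 2) (iota a F) b = comp (m + 3) F (Fin.cons a b) := fun _ _ _ => rfl
    simp only [Pi.add_apply, Pi.smul_apply, hS₁, hS₂]
    rw [← hcons (t ∘ swap 0 1), ← hcons t, e1, e2, hX, hswap, ← e3, ← e3]
    simp only [Fin.tail_cons, map_add, map_sub, Pi.add_apply, Pi.sub_apply, smul_eq_mul]
    ring
  rw [h4, tensorInner_add, tensorInner_smul, h3, tensorInner_add, h1, h2]
  simp

end Inner

/-! ### Coordinate expressions on a manifold -/

section Coordinates

variable {n : ℕ} {M : Type*} [TopologicalSpace M] [ChartedSpace (EuclideanSpace ℝ (Fin n)) M]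

section Forms

variable {k : ℕ}

lemma isAlt_formCoeff (τ : ∀ x : M, TangentSpace (𝓡 n) x [⋀^Fin k]→L[ℝ] ℝ) (x₀ : M)
    (y : EuclideanSpace ℝ (Fin n)) : IsAlt (formCoeff τ x₀ y) := by
  refine isAlt_of_perm fun π t => ?_
  have h := (τ ((extChartAt (𝓡 n) x₀).symm y)).toAlternatingMap.map_perm
    (fun i => coordVec x₀ y (t i)) π
  rw [Units.smul_def, zsmul_eq_mul] at h
  exact h

/-- The field of forms on the coordinate domain given by a form on the manifold. -/
def formField (τ : ∀ x : M, TangentSpace (𝓡 n) x [⋀^Fin k]→L[ℝ] ℝ) (x₀ : M)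
    (y : EuclideanSpace ℝ (Fin n)) : Forms n :=
  ofAlt (formCoeff τ x₀ y) (isAlt_formCoeff τ x₀ y)

lemma isHomog_formField (τ : ∀ x : M, TangentSpace (𝓡 n) x [⋀^Fin k]→L[ℝ] ℝ) (x₀ : M)
    (y : EuclideanSpace ℝ (Fin n)) : IsHomog k (formField τ x₀ y) :=
  isHomog_ofAlt _ _

lemma comp_formField (τ : ∀ x : M, TangentSpace (𝓡 n) x [⋀^Fin k]→L[ℝ] ℝ) (x₀ : M)
    (y : EuclideanSpace ℝ (Fin n)) : comp k (formField τ x₀ y) = formCoeff τ x₀ y :=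
  comp_ofAlt _ _

lemma SmoothForm.smoothOn (τ : SmoothForm n M k) (x₀ : M) :
    SmoothOn (extChartAt (𝓡 n) x₀).target (formField τ.val x₀) := fun j t => by
  by_cases h : j = k
  · subst h
    simp only [comp_formField]
    exact τ.smooth x₀ t
  · simp only [isHomog_formField τ.val x₀ _ j h]
    exact contDiffOn_const

lemma formField_smul {τ τ' : ∀ x : M, TangentSpace (𝓡 n) x [⋀^Fin k]→L[ℝ] ℝ} {f : M → ℝ}
    (h : ∀ x, τ' x = f x • τ x) (x₀ : M) (y : EuclideanSpace ℝ (Fin n)) :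
    formField τ' x₀ y = f ((extChartAt (𝓡 n) x₀).symm y) • formField τ x₀ y := by
  refine (isHomog_formField τ' x₀ y).ext ((isHomog_formField τ x₀ y).smul _) ?_
  rw [map_smul, comp_formField, comp_formField]
  funext t
  simp only [formCoeff, h]
  rfl

end Forms

variable [IsManifold (𝓡 n) ∞ M]

lemma contMDiffOn_coordVec (x₀ : M) (i : Fin n) :
    ContMDiffOn 𝓘(ℝ, EuclideanSpace ℝ (Fin n))
      ((𝓡 n).prod 𝓘(ℝ, EuclideanSpace ℝ (Fin n))) ∞
      (fun y => (Bundle.TotalSpace.mk' (EuclideanSpace ℝ (Fin n))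
        ((extChartAt (𝓡 n) x₀).symm y) (coordVec x₀ y i) :
        Bundle.TotalSpace (EuclideanSpace ℝ (Fin n)) (fun x : M => TangentSpace (𝓡 n) x)))
      (extChartAt (𝓡 n) x₀).target := by
  have hU := isOpen_extChartAt_target (I := 𝓡 n) x₀
  have h1 : ContMDiffOn 𝓘(ℝ, EuclideanSpace ℝ (Fin n)) (𝓡 n) ∞ (extChartAt (𝓡 n) x₀).symm
      (extChartAt (𝓡 n) x₀).target := contMDiffOn_extChartAt_symm x₀
  have h2 := h1.contMDiffOn_tangentMapWithin (m := ∞) (by simp) hU.uniqueMDiffOn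
  have h3 : ContMDiffOn 𝓘(ℝ, EuclideanSpace ℝ (Fin n))
      (𝓘(ℝ, EuclideanSpace ℝ (Fin n)).prod 𝓘(ℝ, EuclideanSpace ℝ (Fin n))) ∞
      (fun y : EuclideanSpace ℝ (Fin n) => (⟨y, EuclideanSpace.single i (1 : ℝ)⟩ :
        TangentBundle 𝓘(ℝ, EuclideanSpace ℝ (Fin n)) (EuclideanSpace ℝ (Fin n))))
      (extChartAt (𝓡 n) x₀).target :=
    contMDiffOn_vectorSpace_iff_contDiffOn.2 contDiffOn_const
  have h4 := h2.comp h3 fun y hy => hy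
  refine h4.congr fun y hy => ?_
  simp only [coordVec, Function.comp_apply, tangentMapWithin]
  rw [mfderivWithin_of_isOpen hU hy]

lemma PseudoRiemannianMetric.contDiffOn_coeff (g : PseudoRiemannianMetric n M) (x₀ : M)
    (i j : Fin n) : ContDiffOn ℝ ∞ (fun y => g.coeff x₀ y i j) (extChartAt (𝓡 n) x₀).target := by
  rw [← contMDiffOn_iff_contDiffOn]
  have hb : ContMDiffOn 𝓘(ℝ, EuclideanSpace ℝ (Fin n)) (𝓡 n) ∞ (extChartAt (𝓡 n) x₀).symm
      (extChartAt (𝓡 n) x₀).target := contMDiffOn_extChartAt_symm x₀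
  have : ContMDiffOn 𝓘(ℝ, EuclideanSpace ℝ (Fin n)) ((𝓡 n).prod 𝓘(ℝ)) ∞
      (fun y ↦ Bundle.TotalSpace.mk' ℝ (E := Bundle.Trivial M ℝ) ((extChartAt (𝓡 n) x₀).symm y)
        (g.val ((extChartAt (𝓡 n) x₀).symm y) (coordVec x₀ y i) (coordVec x₀ y j)))
      (extChartAt (𝓡 n) x₀).target := by
    apply ContMDiffOn.clm_bundle_apply₂ (F₁ := EuclideanSpace ℝ (Fin n))
      (F₂ := EuclideanSpace ℝ (Fin n))
    · exact ContMDiff.comp_contMDiffOn g.contMDiff hb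
    · exact contMDiffOn_coordVec x₀ i
    · exact contMDiffOn_coordVec x₀ j
  intro y hy
  have := this y hy
  simp only [Bundle.contMDiffWithinAt_totalSpace] at this
  exact this.2

lemma coordVec_surjective (x₀ : M) {y : EuclideanSpace ℝ (Fin n)}
    (hy : y ∈ (extChartAt (𝓡 n) x₀).target)
    (u : TangentSpace (𝓡 n) ((extChartAt (𝓡 n) x₀).symm y)) :
    (∃ b : Fin n → ℝ, ∑ i, b i • coordVec x₀ y i = u) ∧
      ∀ v : Fin n → ℝ, ∑ i, v i • coordVec x₀ y i = 0 → v = 0 := by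
  set A := mfderiv 𝓘(ℝ, EuclideanSpace ℝ (Fin n)) (𝓡 n) (extChartAt (𝓡 n) x₀).symm y with hA
  have hAinv : A.IsInvertible := by
    have h := isInvertible_mfderivWithin_extChartAt_symm (I := 𝓡 n) (x := x₀) hy
    rwa [ModelWithCorners.range_eq_univ, mfderivWithin_univ] at h
  have hsum : ∀ v : Fin n → ℝ, ∑ i, v i • coordVec x₀ y i = A (WithLp.toLp 2 v) := fun v => by
    have : (WithLp.toLp 2 v : EuclideanSpace ℝ (Fin n))
        = ∑ i, v i • EuclideanSpace.single i (1 : ℝ) := by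
      ext j
      simp [Finset.sum_apply, Pi.single_apply]
    rw [this]
    exact (map_sum A _ _).trans (Finset.sum_congr rfl fun i _ => map_smul A _ _) |>.symm
  refine ⟨?_, fun v hv => ?_⟩
  · obtain ⟨b, hb⟩ := hAinv.bijective.2 u
    exact ⟨WithLp.ofLp b, (hsum _).trans hb⟩
  · rw [hsum] at hv
    have := hAinv.bijective.1 (hv.trans (map_zero A).symm)
    exact congrArg WithLp.ofLp this

lemma PseudoRiemannianMetric.isMetricOn (g : PseudoRiemannianMetric n M) (x₀ : M) :
    IsMetricOn (extChartAt (𝓡 n) x₀).target (g.coeff x₀) where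
  smooth := g.contDiffOn_coeff x₀
  symm _ _ _ := g.symm _ _ _
  det_ne_zero y hy := by
    intro hdet
    obtain ⟨v, hv, hvG⟩ := Matrix.exists_mulVec_eq_zero_iff.2 hdet
    have hcv := coordVec_surjective x₀ hy
    set w : TangentSpace (𝓡 n) ((extChartAt (𝓡 n) x₀).symm y) := ∑ i, v i • coordVec x₀ y i with hw
    have hzero : w = 0 := by
      refine g.nondegenerate _ w fun u => ?_
      obtain ⟨b, rfl⟩ := (hcv u).1
      have hwi : ∀ i, g.val _ w (coordVec x₀ y i) = 0 := fun i => by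
        have h := congrFun hvG i
        simp only [Matrix.mulVec, dotProduct, coeff, Matrix.of_apply, Pi.zero_apply] at h
        rw [g.symm, hw, map_sum, ← h]
        exact Finset.sum_congr rfl fun j _ => by rw [map_smul, smul_eq_mul, mul_comm]
      rw [map_sum]
      exact Finset.sum_eq_zero fun i _ => by rw [map_smul, hwi, smul_zero]
    exact hv ((hcv w).2 v hzero)

lemma coeff_rescale {g g' : PseudoRiemannianMetric n M} {Υ : M → ℝ} (h : IsRescaling g g' Υ)
    (x₀ : M) (y : EuclideanSpace ℝ (Fin n)) :
    g'.coeff x₀ y = Real.exp (2 * Υ ((extChartAt (𝓡 n) x₀).symm y)) • g.coeff x₀ y := by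
  ext i j
  simp only [PseudoRiemannianMetric.coeff, Matrix.of_apply, Matrix.smul_apply, h.2]
  rfl

lemma IsRescaling.contDiffOn {g g' : PseudoRiemannianMetric n M} {Υ : M → ℝ}
    (h : IsRescaling g g' Υ) (x₀ : M) :
    ContDiffOn ℝ ∞ (fun y => Υ ((extChartAt (𝓡 n) x₀).symm y)) (extChartAt (𝓡 n) x₀).target := by
  rw [← contMDiffOn_iff_contDiffOn]
  exact h.1.comp_contMDiffOn (contMDiffOn_extChartAt_symm x₀)

/-- The coordinate expression of a conformal Killing form, in any scale. -/
lemma WeightedForm.IsConformalKilling.isCKOn {c : ConformalStructure n M} {m : ℕ}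
    {σ : WeightedForm c (m + 2) (((m + 2 : ℕ) : ℝ) + 1)} (hσ : σ.IsConformalKilling)
    (g : c.metrics) (x₀ : M) :
    IsCKOn (extChartAt (𝓡 n) x₀).target (g.1.coeff x₀) m (formField (σ.inScale g).val x₀) := by
  obtain ⟨g₀, hg₀⟩ := hσ
  have hU := isOpen_extChartAt_target (I := 𝓡 n) x₀
  obtain ⟨Υ, hΥ⟩ := (c.mem_iff g₀.1 g₀.2 g.1).1 g.2
  refine IsCKOn.rescale hU (g₀.1.isMetricOn x₀) (hΥ.contDiffOn x₀) (coeff_rescale hΥ x₀)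
    ((σ.inScale g₀).smoothOn x₀) (isHomog_formField _ x₀) (fun y => ?_)
    (isCKOn_of_cartanProj hU (g₀.1.isMetricOn x₀) ((σ.inScale g₀).smoothOn x₀)
      (isHomog_formField _ x₀) fun y hy => ?_)
  · rw [formField_smul (σ.rescale g₀ g Υ hΥ)]
    push_cast
    ring_nf
  · simp only [comp_formField]
    exact hg₀ x₀ y hy

end Coordinates

lemma curvHash_comp {n m : ℕ} {G : Matrix (Fin n) (Fin n) ℝ}
    {C : Fin n → Fin n → Fin n → Fin n → ℝ} (hH : ∀ i j, G⁻¹ i j = G⁻¹ j i)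
    (hC : ∀ b c d q, C b c q d = - C b c d q) (σ : Forms n) :
    curvHash G C (comp m σ) =
      fun t => comp m (curvAct G⁻¹ C σ (t 0) (t 1)) (Fin.tail (Fin.tail t)) := by
  funext t
  rw [curvHash, hash_eq_neg_endo]
  have h := endo_curv hH hC σ (t 0) (t 1)
  change -(comp m (endo (fun p d => ∑ q, G⁻¹ p q * C (t 0) (t 1) q d) σ)) _ = _
  rw [h, map_neg]
  exact neg_neg (comp m (curvAct G⁻¹ C σ (t 0) (t 1)) (Fin.tail (Fin.tail t)))

end ConformalKilling

end

/-- On a conformal manifold of dimension `n ≥ 3`, let `σ` be a conformal Killing `k`-form,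
`2 ≤ k ≤ n - 1`. Then, in every scale, `C ◇ σ = 0`; and the projection of `C ♯ σ` to `E(2,k)₀` is
zero, i.e. `C ♯ σ` is orthogonal to `E(2,k)₀`. -/
theorem mainTheorem3 {n : ℕ} (hn : 3 ≤ n) {M : Type*} [TopologicalSpace M]
    [ChartedSpace (EuclideanSpace ℝ (Fin n)) M] [IsManifold (𝓡 n) ∞ M]
    (c : ConformalKilling.ConformalStructure n M) {k : ℕ} (hk : 2 ≤ k) (hkn : k ≤ n - 1)
    (σ : ConformalKilling.WeightedForm c k ((k : ℝ) + 1)) (hσ : σ.IsConformalKilling)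
    (g : c.metrics) (x₀ : M) (y : EuclideanSpace ℝ (Fin n))
    (hy : y ∈ (extChartAt (𝓡 n) x₀).target) :
    ConformalKilling.lozengeCoeff g.1 (σ.inScale g) x₀ y = 0 ∧
      ∀ T : ConformalKilling.Tensor n (k + 2), ConformalKilling.IsE2k0 (g.1.coeff x₀ y) T →
        ConformalKilling.tensorInner (g.1.coeff x₀ y)
          (ConformalKilling.weylHashCoeff g.1 (σ.inScale g) x₀ y) T = 0 := by
  obtain ⟨m, rfl⟩ := Nat.exists_eq_add_of_le' hk
  have hU := isOpen_extChartAt_target (I := 𝓡 n) x₀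
  have hG := g.1.isMetricOn x₀
  have hH : ∀ i j, (g.1.coeff x₀ y)⁻¹ i j = (g.1.coeff x₀ y)⁻¹ j i := fun i j => hG.inv_symm i j
  have hC := hG.isWeylTensor hn hU hy
  obtain ⟨μ, ν, hμ, hν, hX⟩ := (hσ.isCKOn g x₀).isSplit hU hG hy ((σ.inScale g).smoothOn x₀)
    (ConformalKilling.isHomog_formField _ x₀)
  constructor
  · rw [ConformalKilling.lozengeCoeff, ← ConformalKilling.comp_formField]
    exact ConformalKilling.lozenge_eq_zero (hG.symm y) hH (hG.inv_mul hy) hC (by omega) hX hμ hν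
  · intro T hT
    rw [ConformalKilling.weylHashCoeff, ← ConformalKilling.comp_formField,
      ConformalKilling.curvHash_comp hH fun b c d q => hC.skew_snd b c q d]
    exact ConformalKilling.tensorInner_eq_zero hH (hG.inv_mul hy) hX hT
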